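/- Let $k\in\mathbb R$, $k\neq 0$. Put $\varphi_k=z$ on $\mathbb R^3$ if $k=1$, and $\varphi_k=\frac{2}{k-1}\log z$ on $\{z>0\}$ if $k\ne 1$. A smooth immersed surface in the domain of $\varphi_k$ belongs to the class $\mathcal S_k$ if $\mathbf H=(\overline\nabla\varphi_k)^\perp$, where $\mathbf H$ is the mean curvature vector (the trace of the second fundamental form); for $k=1$ it is called a translating soliton, and for $k\neq1$ a $\frac{2}{k-1}$-singular minimal surface. Let $\Sigma$ be a connected Riemann surface and $\widetilde\psi:\Sigma\to\mathbb R^3$ a conformal immersion in the class $\mathcal S_k$, with unit normal $N=(N_1,N_2,N_3)$. Let $G=\Pi\circ N=\frac{N_1+iN_2}{1+N_3}$ be its Gauss map, $\Pi$ being the stereographic projection from the south pole. Suppose that $0<|G|<1$ and that locally $G=|G|\,e^{i\nu}$ with $\nu$ harmonic ($\nu_{\zeta\bar\zeta}=0$ for every complex parameter $\zeta$), and that the argument of $G$ is not constant on $\Sigma$. Then $\widetilde\psi(\Sigma)$ lies on a surface of revolution about a vertical axis which is a translating soliton if $k=1$ and a $\frac{2}{k-1}$-singular minimal surface if $k\neq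 1$. More precisely, there are a non-empty open interval $J$, numbers $a,b\in\mathbb R$ and $\sigma\in\{1,-1\}$, a smooth function $m:J\to(0,1)$, and functions $\Phi,Q$ on $J$ with $$\Phi'=\frac{1+m^4-2km^2}{1-m^4},\qquad Q'=\frac{m^2}{1-m^4},$$ such that $$\frac{m-m'}{\sqrt{1-m^4}}=\sigma\left(\frac{1-m^2}{1+m^2}\right)^{k/2}e^{-\Phi},$$ and such that, with $$\rho=2\,\frac{m'-m}{1-m^2},\qquad h=\log\frac{1+m^2}{1-m^2}-4Q\qquad\text{if } k=1,$$ $$\gamma=\left(\frac{1+m^2}{1-m^2}\right)^{\frac{k-1}{2}}e^{2(1-k)Q},\qquad h=\left|\frac{2k}{k-1}\right|\gamma,\qquad \rho=(k-1)\,h\,\frac{m'-m}{1-m^2}\qquad\text{if } k\neq1,$$ the surface of revolution $X(u,v)=(a+\rho(u)\cos v,\ b+\rho(u)\sin v,\ h(u))$, $(u,v)\in J\times\mathbb R$, is a conformal immersion in the class $\mathcal S_k$, one has $\widetilde\psi(\Sigma)\subseteq X(J\times\mathbb R)$, and every point of $\Sigma$ has a neighbourhood with a conformal parameter $u+i\nu$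 (holomorphic or antiholomorphic, according to the orientation) with values in $J\times\mathbb R$ on which $G=m(u)\,e^{i\nu}$ and $\widetilde\psi=X(u,\nu)$. -/

import Mathlib

open scoped Manifold ContDiff InnerProductSpace

/-- Euclidean three-space with coordinates `(x, y, z) = (p 0, p 1, p 2)`. -/
abbrev E3 : Type := EuclideanSpace ℝ (Fin 3)

noncomputable section

namespace WeightedSurface

/-! ### Parametrised surfaces `X : U → ℝ³`, `U ⊆ ℂ` open, with parameter `u + i v` -/

/-- `∂X/∂u`. -/
def dU (X : ℂ → E3) (w : ℂ) : E3 := fderiv ℝ X w 1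

/-- `∂X/∂v`. -/
def dV (X : ℂ → E3) (w : ℂ) : E3 := fderiv ℝ X w Complex.I

/-- The tangent plane of `X` at the parameter `w`. -/
def tangentPlane (X : ℂ → E3) (w : ℂ) : Submodule ℝ E3 :=
  Submodule.span ℝ {dU X w, dV X w}

/-- The projection `a ↦ a^⊥` onto the normal line of `X` at the parameter `w`. -/
def normalPart (X : ℂ → E3) (w : ℂ) (a : E3) : E3 :=
  (tangentPlane X w)ᗮ.starProjection a

/-- The mean curvature vector, the trace of the vector valued second fundamental form with
respect to the first one:
`H = (⟨X_v, X_v⟩ X_uu - 2 ⟨X_u, X_v⟩ X_uv + ⟨X_u, X_u⟩ X_vv)^⊥ / (|X_u|² |X_v|² - ⟨X_u, X_v⟩²)`. -/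
def meanCurvatureVector (X : ℂ → E3) (w : ℂ) : E3 :=
  (⟪dU X w, dU X w⟫_ℝ * ⟪dV X w, dV X w⟫_ℝ - ⟪dU X w, dV X w⟫_ℝ ^ 2)⁻¹ •
    normalPart X w
      (⟪dV X w, dV X w⟫_ℝ • dU (dU X) w
        - (2 * ⟪dU X w, dV X w⟫_ℝ) • dV (dU X) w
        + ⟪dU X w, dU X w⟫_ℝ • dV (dV X) w)

/-- `X` is a smooth immersion of the open set `U` into `Ω` that satisfies the Euler-Lagrange
equation `H = (∇φ)^⊥` of the weighted area `∫ e^φ dΣ`. -/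
structure IsWeightedMinimalOn (φ : E3 → ℝ) (Ω : Set E3) (U : Set ℂ) (X : ℂ → E3) : Prop where
  smooth : ContDiffOn ℝ ∞ X U
  immersion : ∀ w ∈ U, LinearIndependent ℝ ![dU X w, dV X w]
  mapsTo : Set.MapsTo X U Ω
  euler_lagrange : ∀ w ∈ U, meanCurvatureVector X w = normalPart X w (gradient φ (X w))

/-- Translating solitons: `φ(z) = z` on `ℝ³`. -/
def IsTranslatingSolitonOn (U : Set ℂ) (X : ℂ → E3) : Prop :=
  IsWeightedMinimalOn (fun p => p 2) Set.univ U X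

/-- `α`-singular minimal surfaces: `φ(z) = α log z` on the half-space `z > 0`. -/
def IsSingularMinimalOn (α : ℝ) (U : Set ℂ) (X : ℂ → E3) : Prop :=
  IsWeightedMinimalOn (fun p => α * Real.log (p 2)) {p | 0 < p 2} U X

/-- The class `S_k`: translating solitons for `k = 1`, and `2/(k-1)`-singular minimal surfaces
for `k ≠ 1`. -/
def InClassOn (k : ℝ) (U : Set ℂ) (X : ℂ → E3) : Prop :=
  (k = 1 → IsTranslatingSolitonOn U X) ∧ (k ≠ 1 → IsSingularMinimalOn (2 / (k - 1)) U X)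

/-- `u + i v` is a conformal (isothermal) parameter for `X`. -/
def IsConformalOn (U : Set ℂ) (X : ℂ → E3) : Prop :=
  ∀ w ∈ U, ‖dU X w‖ = ‖dV X w‖ ∧ ⟪dU X w, dV X w⟫_ℝ = 0

/-! ### Immersed surfaces `ψ : S → ℝ³`, `S` a Riemann surface -/

variable {S : Type*} [TopologicalSpace S] [ChartedSpace ℂ S]

/-- `ψ` is a conformal immersion of the Riemann surface `S` that belongs to the class `S_k`. -/
def IsConformalInClass (k : ℝ) (ψ : S → E3) : Prop :=
  ∀ e ∈ atlas ℂ S, InClassOn k e.target (ψ ∘ e.symm) ∧ IsConformalOn e.target (ψ ∘ e.symm)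

/-- `N` is a unit normal field (Gauss map) of `ψ`. -/
def IsUnitNormal (ψ N : S → E3) : Prop :=
  (∀ p, ‖N p‖ = 1) ∧
    ∀ e ∈ atlas ℂ S, ∀ w ∈ e.target, N (e.symm w) ∈ (tangentPlane (ψ ∘ e.symm) w)ᗮ

/-- Stereographic projection of the unit sphere from the south pole `(0, 0, -1)`; the junk value
at that pole is `0`. -/
def stereoSouth (n : E3) : ℂ := ⟨n 0 / (1 + n 2), n 1 / (1 + n 2)⟩

/-- The real function `ν` is harmonic on the open set `W` of `S`: `ν_{ζ ζ̄} = 0` for every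
complex parameter `ζ`. -/
def IsHarmonicOn (ν : S → ℝ) (W : Set S) : Prop :=
  ∀ e ∈ atlas ℂ S, InnerProductSpace.HarmonicOnNhd (ν ∘ e.symm) (e.target ∩ e.symm ⁻¹' W)

/-- Every point has a neighbourhood on which `G = |G| e^{iν}` with a harmonic function `ν`. -/
def HasHarmonicArgument (G : S → ℂ) : Prop :=
  ∀ p : S, ∃ (W : Set S) (ν : S → ℝ), IsOpen W ∧ p ∈ W ∧ IsHarmonicOn ν W ∧
    ∀ q ∈ W, G q = ‖G q‖ * Complex.exp (Complex.I * ν q)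

/-- The argument of the nowhere vanishing function `G` is constant. -/
def HasConstantArgument (G : S → ℂ) : Prop :=
  ∃ c : ℝ, ∀ p, G p = ‖G p‖ * Complex.exp (Complex.I * c)

/-- `ζ` is a conformal parameter on the open set `W` of `S`, of either orientation: an injective
function that is holomorphic or antiholomorphic. -/
def IsConformalParameterOn (ζ : S → ℂ) (W : Set S) : Prop :=
  Set.InjOn ζ W ∧
    ((∀ e ∈ atlas ℂ S, DifferentiableOn ℂ (ζ ∘ e.symm) (e.target ∩ e.symm ⁻¹' W)) ∨
      ∀ e ∈ atlas ℂ S, DifferentiableOn ℂ (fun w => starRingEnd ℂ (ζ (e.symm w)))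
        (e.target ∩ e.symm ⁻¹' W))

/-! ### Surfaces of revolution and the explicit profile -/

/-- The surface of revolution with profile curve `(ρ, h)` about the vertical axis through
`(a, b, 0)`, with parameter `u + i v`, `v` the angle of rotation. -/
def revolution (a b : ℝ) (ρ h : ℝ → ℝ) (ζ : ℂ) : E3 :=
  !₂[a + ρ ζ.re * Real.cos ζ.im, b + ρ ζ.re * Real.sin ζ.im, h ζ.re]

/-- The vertical strip of parameters over the interval `J`. -/
def strip (J : Set ℝ) : Set ℂ := {ζ | ζ.re ∈ J}

/-- `m : J → (0, 1)` solves
`(m - m') / √(1 - m⁴) = σ ((1 - m²)/(1 + m²))^(k/2) e^{-Φ}`, where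
`Φ' = (1 + m⁴ - 2 k m²)/(1 - m⁴)`. -/
structure SolvesModulusODE (k σ : ℝ) (J : Set ℝ) (m Φ : ℝ → ℝ) : Prop where
  smooth : ContDiffOn ℝ ∞ m J
  range : ∀ u ∈ J, 0 < m u ∧ m u < 1
  primitive : ∀ u ∈ J,
    HasDerivAt Φ ((1 + m u ^ 4 - 2 * k * m u ^ 2) / (1 - m u ^ 4)) u
  ode : ∀ u ∈ J, (m u - deriv m u) / √(1 - m u ^ 4) =
    σ * ((1 - m u ^ 2) / (1 + m u ^ 2)) ^ (k / 2) * Real.exp (-Φ u)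

/-- The function `γ = ((1 + m²)/(1 - m²))^((k-1)/2) e^{2(1-k)Q}`, `Q` a primitive of
`m²/(1 - m⁴)`. -/
def profileGamma (k : ℝ) (m Q : ℝ → ℝ) (u : ℝ) : ℝ :=
  ((1 + m u ^ 2) / (1 - m u ^ 2)) ^ ((k - 1) / 2) * Real.exp (2 * (1 - k) * Q u)

open Classical in
/-- The signed distance of the profile curve to the axis. -/
def profileRadius (k : ℝ) (m Q : ℝ → ℝ) (u : ℝ) : ℝ :=
  if k = 1 then 2 * ((deriv m u - m u) / (1 - m u ^ 2))
  else (k - 1) * |2 * k / (k - 1)| * profileGamma k m Q u * ((deriv m u - m u) / (1 - m u ^ 2))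

open Classical in
/-- The height of the profile curve. -/
def profileHeight (k : ℝ) (m Q : ℝ → ℝ) (u : ℝ) : ℝ :=
  if k = 1 then Real.log ((1 + m u ^ 2) / (1 - m u ^ 2)) - 4 * Q u
  else |2 * k / (k - 1)| * profileGamma k m Q u

end WeightedSurface

end

/-! Let τ = 1/φ_k'(z), an affine function of the height z (`weightRecip`); it treats translating
solitons and singular minimal surfaces together. As |G| < 1, the unit normal n points upwards. The
Euler-Lagrange equation and the symmetry of the second fundamental form then determine the
differential of the immersion from the normal and the height: n₃ dψ = -τ (dn - ε n × (dn ∘ i)),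
where ε = ±1 is the orientation (`structure_equation`).

On a disc the harmonic argument is Re F with F holomorphic. With m = |G| and U = ε Im F, the
vertical part of the structure equation reads dz/τ = 4m/(1-m⁴) (dm - m dU)
(`IsPolarChart.fderiv_eq`). Here dz/τ and 4m dm/(1-m⁴) are exact, hence m²/(1-m⁴) dU is closed, and
dm ∧ dU = 0 (`IsPolarChart.wedge`): where dU ≠ 0, the modulus is locally a function of U.

An isolated zero of F' is impossible. There dm ≠ 0, because ψ is an immersion, whereas F' behaves
like a power c(w - w₀)^j with j ≥ 1, whose phase takes all values around w₀; this contradicts dm ∧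
dU = 0 (`IsPolarChart.eventually_eq_zero_or_ne_zero`). By the identity theorem and connectedness, a
zero of F' would make the argument of G constant on all of the surface.

So ζ = u + iν with u = U is a local conformal parameter in which m and z depend on u alone. The
angular part of dψ is ρ dν with ρ = 2τ(m'-m)/(1-m²). The difference between ψ and the surface of
revolution with profile (ρ, z) is a function of u whose derivative is radial at every angle ν; hence
this derivative vanishes and the difference is constant. Its vanishing is a second order equation
for m, and the equation of the modulus is a first integral of it
(`IsPolarChart.exists_local_representation`).

Globally, (m, Φ, Q) is an integral curve of an autonomous field (`modulusField`). Two
representations of the same piece of surface have the same axis, sign and state (m, Φ, Q) at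
corresponding points (`representation_unique`), so their curves differ by a translation of u. The
points near which one fixed maximal curve parametrises ψ thus form an open and closed set. -/

noncomputable section

namespace WeightedSurface

/-! ### Linear algebra in Euclidean three-space -/

lemma inner_E3 (x y : E3) : ⟪x, y⟫_ℝ = x 0 * y 0 + x 1 * y 1 + x 2 * y 2 := by
  simp [PiLp.inner_apply, Fin.sum_univ_three, mul_comm]

lemma norm_sq_E3 (x : E3) : ‖x‖ ^ 2 = x 0 ^ 2 + x 1 ^ 2 + x 2 ^ 2 := by
  rw [← real_inner_self_eq_norm_sq, inner_E3]; ring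

lemma E3_ext {x y : E3} (h0 : x 0 = y 0) (h1 : x 1 = y 1) (h2 : x 2 = y 2) : x = y := by
  ext i; fin_cases i <;> assumption

lemma mem_tangentPlane_orthogonal {X : ℂ → E3} {w : ℂ} {n : E3} :
    n ∈ (tangentPlane X w)ᗮ ↔ ⟪dU X w, n⟫_ℝ = 0 ∧ ⟪dV X w, n⟫_ℝ = 0 := by
  rw [tangentPlane, Submodule.mem_orthogonal]
  constructor
  · intro h
    exact ⟨h _ (Submodule.subset_span (by simp)), h _ (Submodule.subset_span (by simp))⟩
  · rintro ⟨h1, h2⟩ u hu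
    obtain ⟨a, b, rfl⟩ := Submodule.mem_span_pair.1 hu
    simp [inner_add_left, inner_smul_left, h1, h2]

/-- By a dimension count the orthogonal complement of the tangent plane is the line spanned by `n`.
-/
lemma normalPart_eq {X : ℂ → E3} {w : ℂ} {n : E3}
    (hli : LinearIndependent ℝ ![dU X w, dV X w]) (hn : ‖n‖ = 1)
    (hmem : n ∈ (tangentPlane X w)ᗮ) (a : E3) :
    normalPart X w a = ⟪n, a⟫_ℝ • n := by
  have hn0 : n ≠ 0 := by rintro rfl; simp at hn
  have hfin : Module.finrank ℝ (tangentPlane X w) = 2 := by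
    have h := finrank_span_eq_card hli
    have hr : Set.range ![dU X w, dV X w] = {dU X w, dV X w} := by
      simp [Matrix.range_cons, Matrix.range_empty, Set.pair_comm]
    rw [hr] at h
    exact h.trans (by simp)
  have hsum := Submodule.finrank_add_finrank_orthogonal (tangentPlane X w)
  rw [hfin, finrank_euclideanSpace_fin] at hsum
  have hspan : Submodule.span ℝ {n} = (tangentPlane X w)ᗮ := by
    apply Submodule.eq_of_le_of_finrank_eq
    · rw [Submodule.span_singleton_le_iff_mem]; exact hmem
    · rw [finrank_span_singleton hn0]; omega
  unfold normalPart
  -- Stated for a variable subspace, so that the equality of subspaces can be substituted.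
  have key : ∀ (K : Submodule ℝ E3) (_ : Submodule.span ℝ {n} = K),
      K.starProjection a = ⟪n, a⟫_ℝ • n := by
    rintro K rfl
    exact Submodule.starProjection_unit_singleton ℝ hn a
  exact key _ hspan

/-- Two orthogonal vectors `a`, `b` of the same length and a unit vector `n` orthogonal to both
satisfy `a × b = ± |a|² n`. -/
lemma cross_eq_of_orthogonal {a0 a1 a2 b0 b1 b2 n0 n1 n2 l : ℝ}
    (haa : a0 * a0 + a1 * a1 + a2 * a2 = l) (hbb : b0 * b0 + b1 * b1 + b2 * b2 = l)
    (hab : a0 * b0 + a1 * b1 + a2 * b2 = 0) (hnn : n0 * n0 + n1 * n1 + n2 * n2 = 1)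
    (hna : a0 * n0 + a1 * n1 + a2 * n2 = 0) (hnb : b0 * n0 + b1 * n1 + b2 * n2 = 0) :
    ∃ ε : ℝ, (ε = 1 ∨ ε = -1) ∧ a1 * b2 - a2 * b1 = ε * l * n0 ∧
      a2 * b0 - a0 * b2 = ε * l * n1 ∧ a0 * b1 - a1 * b0 = ε * l * n2 := by
  set K0 := a1 * b2 - a2 * b1 with hK0
  set K1 := a2 * b0 - a0 * b2 with hK1
  set K2 := a0 * b1 - a1 * b0 with hK2
  set s := K0 * n0 + K1 * n1 + K2 * n2 with hs
  -- K - ⟨K, n⟩ n = -n × (n × K), and n × (a × b) = ⟨n, b⟩ a - ⟨n, a⟩ b = 0.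
  have e0 : K0 = s * n0 := by
    simp only [hs, hK0, hK1, hK2]
    linear_combination (-(a1 * b2 - a2 * b1)) * hnn + (n1 * b2 - n2 * b1) * hna
      - (n1 * a2 - n2 * a1) * hnb
  have e1 : K1 = s * n1 := by
    simp only [hs, hK0, hK1, hK2]
    linear_combination (-(a2 * b0 - a0 * b2)) * hnn + (n2 * b0 - n0 * b2) * hna
      - (n2 * a0 - n0 * a2) * hnb
  have e2 : K2 = s * n2 := by
    simp only [hs, hK0, hK1, hK2]
    linear_combination (-(a0 * b1 - a1 * b0)) * hnn + (n0 * b1 - n1 * b0) * hna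
      - (n0 * a1 - n1 * a0) * hnb
  -- Lagrange's identity: |a × b|² = |a|²|b|² - ⟨a, b⟩².
  have hKK : K0 * K0 + K1 * K1 + K2 * K2 = l * l := by
    have : K0 * K0 + K1 * K1 + K2 * K2 = (a0 * a0 + a1 * a1 + a2 * a2) *
      (b0 * b0 + b1 * b1 + b2 * b2) - (a0 * b0 + a1 * b1 + a2 * b2) ^ 2 := by
      simp only [hK0, hK1, hK2]; ring
    rw [this, haa, hbb, hab]; ring
  have hsl : s * s = l * l := by
    have : K0 * K0 + K1 * K1 + K2 * K2 = s * s * (n0 * n0 + n1 * n1 + n2 * n2) := by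
      rw [e0, e1, e2]; ring
    rw [← hKK, this, hnn]; ring
  rcases mul_self_eq_mul_self_iff.1 hsl with h | h
  · exact ⟨1, Or.inl rfl, by rw [e0, h]; ring, by rw [e1, h]; ring, by rw [e2, h]; ring⟩
  · exact ⟨-1, Or.inr rfl, by rw [e0, h]; ring, by rw [e1, h]; ring, by rw [e2, h]; ring⟩

/-- A vector orthogonal to `a`, `b` and `a × b` vanishes. -/
lemma eq_zero_of_orthogonal {a0 a1 a2 b0 b1 b2 n0 n1 n2 l t0 t1 t2 : ℝ} (hl : l ≠ 0)
    (h0 : a1 * b2 - a2 * b1 = l * n0) (h1 : a2 * b0 - a0 * b2 = l * n1)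
    (h2 : a0 * b1 - a1 * b0 = l * n2) (hnn : n0 * n0 + n1 * n1 + n2 * n2 = 1)
    (hta : t0 * a0 + t1 * a1 + t2 * a2 = 0) (htb : t0 * b0 + t1 * b1 + t2 * b2 = 0)
    (htn : t0 * n0 + t1 * n1 + t2 * n2 = 0) : t0 = 0 ∧ t1 = 0 ∧ t2 = 0 := by
  -- l (t × n) = t × (a × b) = ⟨t, b⟩ a - ⟨t, a⟩ b = 0, so t is parallel to n as well as orthogonal
  -- to it.
  have c0 : t1 * n2 - t2 * n1 = 0 := by
    apply mul_left_cancel₀ hl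
    linear_combination a0 * htb - b0 * hta - t1 * h2 + t2 * h1
  have c1 : t2 * n0 - t0 * n2 = 0 := by
    apply mul_left_cancel₀ hl
    linear_combination a1 * htb - b1 * hta - t2 * h0 + t0 * h2
  have c2 : t0 * n1 - t1 * n0 = 0 := by
    apply mul_left_cancel₀ hl
    linear_combination a2 * htb - b2 * hta - t0 * h1 + t1 * h0
  refine ⟨?_, ?_, ?_⟩
  · linear_combination (-t0) * hnn + n0 * htn - n2 * c1 + n1 * c2
  · linear_combination (-t1) * hnn + n1 * htn - n0 * c2 + n2 * c0
  · linear_combination (-t2) * hnn + n2 * htn - n1 * c0 + n0 * c1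

/-! ### The Euler-Lagrange equation in conformal parameters -/

/-- In isothermal parameters the mean curvature vector is the normal part of (X_uu + X_vv)/|X_u|²,
and both sides are multiples of `n`. The number `c` plays the role of φ'(z). -/
lemma euler_lagrange_iff {X : ℂ → E3} {w : ℂ} {n : E3} {φ : E3 → ℝ} {c : ℝ}
    (hli : LinearIndependent ℝ ![dU X w, dV X w]) (hn : ‖n‖ = 1)
    (hmem : n ∈ (tangentPlane X w)ᗮ) (hnorm : ‖dU X w‖ = ‖dV X w‖)
    (horth : ⟪dU X w, dV X w⟫_ℝ = 0) (hφ : ⟪n, gradient φ (X w)⟫_ℝ = c * n 2) :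
    meanCurvatureVector X w = normalPart X w (gradient φ (X w)) ↔
      ⟪n, dU (dU X) w + dV (dV X) w⟫_ℝ = ‖dU X w‖ ^ 2 * (c * n 2) := by
  have hn0 : n ≠ 0 := by rintro rfl; simp at hn
  have hu : dU X w ≠ 0 := hli.ne_zero (0 : Fin 2)
  have hu' : ‖dU X w‖ ≠ 0 := norm_ne_zero_iff.2 hu
  rw [meanCurvatureVector, normalPart_eq hli hn hmem, normalPart_eq hli hn hmem, hφ, smul_smul,
    (smul_left_injective ℝ hn0).eq_iff]
  simp only [horth, real_inner_self_eq_norm_sq, ← hnorm, inner_add_right, inner_sub_right,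
    inner_smul_right]
  field_simp
  constructor
  · intro h
    apply mul_left_cancel₀ (pow_ne_zero 2 hu')
    linear_combination h
  · intro h
    linear_combination ‖dU X w‖ ^ 2 * h

lemma inner_gradient_height (p : E3) (n : E3) :
    ⟪n, gradient (fun p : E3 => p 2) p⟫_ℝ = 1 * n 2 := by
  have h : HasFDerivAt (fun p : E3 => p 2) (EuclideanSpace.proj (𝕜 := ℝ) (2 : Fin 3)) p :=
    (EuclideanSpace.proj (𝕜 := ℝ) (2 : Fin 3)).hasFDerivAt
  rw [real_inner_comm, gradient, InnerProductSpace.toDual_symm_apply, h.fderiv]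
  simp

lemma inner_gradient_log_height (α : ℝ) {p : E3} (hp : 0 < p 2) (n : E3) :
    ⟪n, gradient (fun p : E3 => α * Real.log (p 2)) p⟫_ℝ = α / p 2 * n 2 := by
  have h : HasFDerivAt (fun p : E3 => p 2) (EuclideanSpace.proj (𝕜 := ℝ) (2 : Fin 3)) p :=
    (EuclideanSpace.proj (𝕜 := ℝ) (2 : Fin 3)).hasFDerivAt
  have h' := (h.log hp.ne').const_mul α
  rw [real_inner_comm, gradient, InnerProductSpace.toDual_symm_apply, h'.fderiv]
  simp
  ring

open Classical in
/-- The reciprocal of the derivative of the weight `φ_k` at height `z`. -/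
def weightRecip (k z : ℝ) : ℝ := if k = 1 then 1 else (k - 1) / 2 * z

/-- The slope (k - 1)/2 is also right for k = 1; this is what allows later computations without a
case distinction. -/
lemma hasDerivAt_weightRecip (k z : ℝ) : HasDerivAt (weightRecip k) ((k - 1) / 2) z := by
  unfold weightRecip
  split_ifs with h
  · simpa [h] using hasDerivAt_const z (1 : ℝ)
  · simpa using (hasDerivAt_id z).const_mul ((k - 1) / 2)

lemma weightRecip_ne_zero {k z : ℝ} (h : k ≠ 1 → 0 < z) : weightRecip k z ≠ 0 := by
  unfold weightRecip
  split_ifs with h1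
  · exact one_ne_zero
  · exact mul_ne_zero (div_ne_zero (sub_ne_zero.2 h1) two_ne_zero) (h h1).ne'

lemma contDiff_weightRecip (k : ℝ) : ContDiff ℝ ∞ (weightRecip k) := by
  unfold weightRecip
  split_ifs <;> fun_prop

/-- Membership in the class `S_k` in terms of conformal parameters and a unit normal. -/
lemma inClassOn_iff {k : ℝ} {U : Set ℂ} {X n : ℂ → E3} (hc : IsConformalOn U X)
    (hn : ∀ w ∈ U, ‖n w‖ = 1 ∧ n w ∈ (tangentPlane X w)ᗮ) :
    InClassOn k U X ↔ ContDiffOn ℝ ∞ X U ∧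
      (∀ w ∈ U, LinearIndependent ℝ ![dU X w, dV X w]) ∧ (k ≠ 1 → ∀ w ∈ U, 0 < X w 2) ∧
      ∀ w ∈ U, weightRecip k (X w 2) * ⟪n w, dU (dU X) w + dV (dV X) w⟫_ℝ =
        ‖dU X w‖ ^ 2 * n w 2 := by
  by_cases hk : k = 1
  · subst hk
    have key : ∀ (_ : ∀ w ∈ U, LinearIndependent ℝ ![dU X w, dV X w]), ∀ w ∈ U,
        (meanCurvatureVector X w = normalPart X w (gradient (fun p : E3 => p 2) (X w)) ↔
        weightRecip 1 (X w 2) * ⟪n w, dU (dU X) w + dV (dV X) w⟫_ℝ = ‖dU X w‖ ^ 2 * n w 2) := by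
      intro hli w hw
      rw [euler_lagrange_iff (hli w hw) (hn w hw).1 (hn w hw).2 (hc w hw).1 (hc w hw).2
        (inner_gradient_height _ _)]
      simp [weightRecip]
    constructor
    · rintro ⟨h, -⟩
      obtain ⟨h1, h2, h3, h4⟩ := h rfl
      exact ⟨h1, h2, fun h => absurd rfl h, fun w hw => (key h2 w hw).1 (h4 w hw)⟩
    · rintro ⟨h1, h2, -, h4⟩
      exact ⟨fun _ => ⟨h1, h2, fun _ _ => trivial, fun w hw => (key h2 w hw).2 (h4 w hw)⟩,
        fun h => absurd rfl h⟩
  · have key : ∀ (_ : ∀ w ∈ U, LinearIndependent ℝ ![dU X w, dV X w]) (_ : ∀ w ∈ U, 0 < X w 2),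
        ∀ w ∈ U, (meanCurvatureVector X w =
          normalPart X w (gradient (fun p : E3 => 2 / (k - 1) * Real.log (p 2)) (X w)) ↔
        weightRecip k (X w 2) * ⟪n w, dU (dU X) w + dV (dV X) w⟫_ℝ = ‖dU X w‖ ^ 2 * n w 2) := by
      intro hli hpos w hw
      rw [euler_lagrange_iff (hli w hw) (hn w hw).1 (hn w hw).2 (hc w hw).1 (hc w hw).2
        (inner_gradient_log_height _ (hpos w hw) _)]
      have h1 : k - 1 ≠ 0 := sub_ne_zero.2 hk
      have h2 := (hpos w hw).ne'
      simp only [weightRecip, if_neg hk]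
      field_simp
    constructor
    · rintro ⟨-, h⟩
      obtain ⟨h1, h2, h3, h4⟩ := h hk
      exact ⟨h1, h2, fun _ => h3, fun w hw => (key h2 h3 w hw).1 (h4 w hw)⟩
    · rintro ⟨h1, h2, h3, h4⟩
      exact ⟨fun h => absurd h hk, fun _ => ⟨h1, h2, h3 hk,
        fun w hw => (key h2 (h3 hk) w hw).2 (h4 w hw)⟩⟩

/-! ### Vector fields in cylindrical components -/

/-- The vector with components `(p, q, r)` in the cylindrical frame at the angle `v`. -/
def cylVec (p q r v : ℝ) : E3 :=
  !₂[p * Real.cos v - q * Real.sin v, p * Real.sin v + q * Real.cos v, r]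

@[simp] lemma cylVec_zero (p q r v : ℝ) :
    cylVec p q r v 0 = p * Real.cos v - q * Real.sin v := rfl
@[simp] lemma cylVec_one (p q r v : ℝ) :
    cylVec p q r v 1 = p * Real.sin v + q * Real.cos v := rfl
@[simp] lemma cylVec_two (p q r v : ℝ) : cylVec p q r v 2 = r := rfl

lemma inner_cylVec (p q r p' q' r' v : ℝ) :
    ⟪cylVec p q r v, cylVec p' q' r' v⟫_ℝ = p * p' + q * q' + r * r' := by
  rw [inner_E3]
  simp only [cylVec_zero, cylVec_one, cylVec_two]
  linear_combination (p * p' + q * q') * Real.sin_sq_add_cos_sq v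

lemma norm_sq_cylVec (p q r v : ℝ) : ‖cylVec p q r v‖ ^ 2 = p ^ 2 + q ^ 2 + r ^ 2 := by
  rw [← real_inner_self_eq_norm_sq, inner_cylVec]; ring

lemma cylVec_add (p q r p' q' r' v : ℝ) :
    cylVec p q r v + cylVec p' q' r' v = cylVec (p + p') (q + q') (r + r') v := by
  refine E3_ext ?_ ?_ ?_ <;> simp <;> ring

lemma hasFDerivAt_E3 {X : ℂ → E3} {w : ℂ} {f : Fin 3 → ℂ →L[ℝ] ℝ}
    (h : ∀ i, HasFDerivAt (fun w => X w i) (f i) w) :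
    DifferentiableAt ℝ X w ∧ ∀ z i, fderiv ℝ X w z i = f i z := by
  have hd : DifferentiableAt ℝ X w := by
    rw [differentiableAt_euclidean]
    exact fun i => (h i).differentiableAt
  refine ⟨hd, fun z i => ?_⟩
  have h1 : HasFDerivAt (fun w => X w i)
      ((EuclideanSpace.proj (𝕜 := ℝ) i).comp (fderiv ℝ X w)) w :=
    ((EuclideanSpace.proj (𝕜 := ℝ) i : E3 →L[ℝ] ℝ).hasFDerivAt).comp w hd.hasFDerivAt
  rw [(h i).unique h1]
  rfl

/-- The cylindrical frame turns with the angle, so differentiation in v rotates the horizontal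
components from (p, q) to (-q, p). -/
lemma fderiv_cylVec {c : E3} {p q r : ℝ → ℝ} {p' q' r' : ℝ} {w : ℂ}
    (hp : HasDerivAt p p' w.re) (hq : HasDerivAt q q' w.re) (hr : HasDerivAt r r' w.re) (z : ℂ) :
    fderiv ℝ (fun w : ℂ => c + cylVec (p w.re) (q w.re) (r w.re) w.im) w z =
      z.re • cylVec p' q' r' w.im + z.im • cylVec (-q w.re) (p w.re) 0 w.im := by
  have hre : HasFDerivAt (fun w : ℂ => w.re) Complex.reCLM w := Complex.reCLM.hasFDerivAt
  have him : HasFDerivAt (fun w : ℂ => w.im) Complex.imCLM w := Complex.imCLM.hasFDerivAt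
  have hp1 := hp.comp_hasFDerivAt w hre
  have hq1 := hq.comp_hasFDerivAt w hre
  have hr1 := hr.comp_hasFDerivAt w hre
  have hcos := him.cos
  have hsin := him.sin
  have h0 := (((hp1.mul hcos).sub (hq1.mul hsin)).const_add (c 0))
  have h1 := (((hp1.mul hsin).add (hq1.mul hcos)).const_add (c 1))
  have h2 := hr1.const_add (c 2)
  obtain ⟨-, h⟩ := hasFDerivAt_E3 (X := fun w : ℂ => c + cylVec (p w.re) (q w.re) (r w.re) w.im)
    (w := w) (f := ![_, _, _]) (by
      intro i
      fin_cases i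
      · exact h0
      · exact h1
      · exact h2)
  refine E3_ext ?_ ?_ ?_
  · rw [h]; simp; ring
  · rw [h]; simp; ring
  · rw [h]; simp; ring

lemma dU_cylVec {c : E3} {p q r : ℝ → ℝ} {p' q' r' : ℝ} {w : ℂ}
    (hp : HasDerivAt p p' w.re) (hq : HasDerivAt q q' w.re) (hr : HasDerivAt r r' w.re) :
    dU (fun w : ℂ => c + cylVec (p w.re) (q w.re) (r w.re) w.im) w = cylVec p' q' r' w.im := by
  rw [dU, fderiv_cylVec hp hq hr]; simp

lemma dV_cylVec {c : E3} {p q r : ℝ → ℝ} {p' q' r' : ℝ} {w : ℂ}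
    (hp : HasDerivAt p p' w.re) (hq : HasDerivAt q q' w.re) (hr : HasDerivAt r r' w.re) :
    dV (fun w : ℂ => c + cylVec (p w.re) (q w.re) (r w.re) w.im) w =
      cylVec (-q w.re) (p w.re) 0 w.im := by
  rw [dV, fderiv_cylVec hp hq hr]; simp

lemma revolution_eq (a b : ℝ) (ρ h : ℝ → ℝ) :
    revolution a b ρ h = fun w : ℂ => !₂[a, b, 0] + cylVec (ρ w.re) 0 (h w.re) w.im := by
  funext w
  refine E3_ext ?_ ?_ ?_ <;> simp [revolution]

/-! ### The weight as a function of the height -/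

open Classical in
/-- The height at which the weight `φ_k`, up to an additive constant, takes the value `e`. -/
def heightOf (k e : ℝ) : ℝ :=
  if k = 1 then e else |2 * k / (k - 1)| * Real.exp ((k - 1) / 2 * e)

lemma heightOf_pos {k : ℝ} (hk : k ≠ 0) (h1 : k ≠ 1) (e : ℝ) : 0 < heightOf k e := by
  rw [heightOf, if_neg h1]
  have : 2 * k / (k - 1) ≠ 0 := div_ne_zero (by simpa using hk) (sub_ne_zero.2 h1)
  positivity

/-- The height solves dz/de = τ(z), since e is φ_k(z) up to a constant. -/
lemma hasDerivAt_heightOf (k e : ℝ) :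
    HasDerivAt (heightOf k) (weightRecip k (heightOf k e)) e := by
  by_cases h : k = 1
  · have : heightOf k = id := by funext x; simp [heightOf, h]
    rw [this]; simpa [weightRecip, h] using hasDerivAt_id e
  · have h2 : heightOf k = fun e => |2 * k / (k - 1)| * Real.exp ((k - 1) / 2 * e) := by
      funext x; simp [heightOf, h]
    have h3 := ((((hasDerivAt_id e).const_mul ((k - 1) / 2)).exp).const_mul |2 * k / (k - 1)|)
    rw [h2]
    refine h3.congr_deriv ?_
    rw [weightRecip, if_neg h]
    simp only [id, mul_one]
    ring

lemma heightOf_injective {k : ℝ} (hk : k ≠ 0) : Function.Injective (heightOf k) := by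
  intro x y h
  unfold heightOf at h
  split_ifs at h with h1
  · exact h
  · have h2 : 2 * k / (k - 1) ≠ 0 := div_ne_zero (by simpa using hk) (sub_ne_zero.2 h1)
    have h3 := Real.exp_injective (mul_left_cancel₀ (abs_ne_zero.2 h2) h)
    exact mul_left_cancel₀ (div_ne_zero (sub_ne_zero.2 h1) two_ne_zero) h3

open Classical in
/-- The inverse of `heightOf`. -/
def weightOf (k z : ℝ) : ℝ :=
  if k = 1 then z else 2 / (k - 1) * Real.log (z / |2 * k / (k - 1)|)

lemma heightOf_weightOf {k z : ℝ} (hk : k ≠ 0) (hz : k ≠ 1 → 0 < z) :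
    heightOf k (weightOf k z) = z := by
  unfold heightOf weightOf
  split_ifs with h1
  · rfl
  · have h2 : 2 * k / (k - 1) ≠ 0 := div_ne_zero (by simpa using hk) (sub_ne_zero.2 h1)
    have h3 : k - 1 ≠ 0 := sub_ne_zero.2 h1
    have h4 : (k - 1) / 2 * (2 / (k - 1) * Real.log (z / |2 * k / (k - 1)|)) =
        Real.log (z / |2 * k / (k - 1)|) := by field_simp
    rw [h4, Real.exp_log (div_pos (hz h1) (abs_pos.2 h2))]
    exact mul_div_cancel₀ _ (abs_ne_zero.2 h2)

lemma hasDerivAt_weightOf {k z : ℝ} (hk : k ≠ 0) (hz : k ≠ 1 → 0 < z) :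
    HasDerivAt (weightOf k) (weightRecip k z)⁻¹ z := by
  by_cases h1 : k = 1
  · have : weightOf k = id := by funext x; simp [weightOf, h1]
    rw [this]; simpa [weightRecip, h1] using hasDerivAt_id z
  · have h2 : 2 * k / (k - 1) ≠ 0 := div_ne_zero (by simpa using hk) (sub_ne_zero.2 h1)
    have h3 : k - 1 ≠ 0 := sub_ne_zero.2 h1
    have h4 := (abs_pos.2 h2).ne'
    have hz' := (hz h1).ne'
    have h5 : weightOf k = fun z => 2 / (k - 1) * Real.log (z / |2 * k / (k - 1)|) := by
      funext x; simp [weightOf, h1]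
    rw [h5]
    refine ((((hasDerivAt_id z).div_const _).log (div_ne_zero hz' h4)).const_mul _).congr_deriv ?_
    rw [weightRecip, if_neg h1]
    simp only [id]
    field_simp

lemma contDiffAt_weightOf {k z : ℝ} (hk : k ≠ 0) (hz : k ≠ 1 → 0 < z) :
    ContDiffAt ℝ ∞ (weightOf k) z := by
  by_cases h1 : k = 1
  · have : weightOf k = id := by funext x; simp [weightOf, h1]
    rw [this]; exact contDiffAt_id
  · have h2 : 2 * k / (k - 1) ≠ 0 := div_ne_zero (by simpa using hk) (sub_ne_zero.2 h1)
    have h5 : weightOf k = fun z => 2 / (k - 1) * Real.log (z / |2 * k / (k - 1)|) := by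
      funext x; simp [weightOf, h1]
    rw [h5]
    exact contDiffAt_const.mul ((contDiffAt_id.div_const _).log
      (div_ne_zero (hz h1).ne' (abs_ne_zero.2 h2)))

lemma contDiff_heightOf (k : ℝ) : ContDiff ℝ ∞ (heightOf k) := by
  unfold heightOf
  split_ifs <;> fun_prop

/-- The weight of a minimal surface with Gauss map of modulus `m`, a primitive of
`4 m / (1 - m⁴)`. -/
def logModulus (m : ℝ) : ℝ := Real.log ((1 + m ^ 2) / (1 - m ^ 2))

/-- The logarithm of `√(1 - m⁴) ((1 - m²)/(1 + m²))^(k/2)`. -/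
def logSpeed (k m : ℝ) : ℝ := 1 / 2 * Real.log (1 - m ^ 4) - k / 2 * logModulus m

lemma one_sub_sq_pos {m : ℝ} (h : 0 < m ∧ m < 1) : 0 < 1 - m ^ 2 := by nlinarith [h.1, h.2]

lemma one_sub_pow_four_pos {m : ℝ} (h : 0 < m ∧ m < 1) : 0 < 1 - m ^ 4 := by
  have := one_sub_sq_pos h
  nlinarith [sq_nonneg m]

lemma hasDerivAt_logModulus {m : ℝ} (h : 0 < m ∧ m < 1) :
    HasDerivAt logModulus (4 * m / (1 - m ^ 4)) m := by
  have h1 := one_sub_sq_pos h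
  have h2 := one_sub_pow_four_pos h
  have h3 : 0 < 1 + m ^ 2 := by positivity
  have hd := ((((hasDerivAt_id m).pow 2).const_add 1).div (((hasDerivAt_id m).pow 2).const_sub 1)
    h1.ne').log (div_pos h3 h1).ne'
  have h4 : 1 - m ^ 4 = (1 - m ^ 2) * (1 + m ^ 2) := by ring
  refine hd.congr_deriv ?_
  simp only [id, Pi.pow_apply, Pi.div_apply]
  rw [h4]
  field_simp
  push_cast
  ring

lemma hasDerivAt_logSpeed {m : ℝ} (k : ℝ) (h : 0 < m ∧ m < 1) :
    HasDerivAt (logSpeed k) (-(2 * m ^ 3 + 2 * k * m) / (1 - m ^ 4)) m := by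
  have h2 := one_sub_pow_four_pos h
  have hd := (((((hasDerivAt_id m).pow 4).const_sub 1).log h2.ne').const_mul (1 / 2)).sub
    ((hasDerivAt_logModulus h).const_mul (k / 2))
  refine hd.congr_deriv ?_
  simp only [id, Pi.pow_apply]
  field_simp
  push_cast
  ring

lemma exp_logSpeed {m : ℝ} (k : ℝ) (h : 0 < m ∧ m < 1) :
    Real.exp (logSpeed k m) = √(1 - m ^ 4) * ((1 - m ^ 2) / (1 + m ^ 2)) ^ (k / 2) := by
  have h1 := one_sub_sq_pos h
  have h2 := one_sub_pow_four_pos h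
  have h3 : 0 < 1 + m ^ 2 := by positivity
  rw [Real.rpow_def_of_pos (div_pos h1 h3), Real.sqrt_eq_rpow, Real.rpow_def_of_pos h2,
    ← Real.exp_add, logSpeed, logModulus, Real.log_div h3.ne' h1.ne', Real.log_div h1.ne' h3.ne']
  congr 1
  ring

lemma profileHeight_eq {k : ℝ} {m Q : ℝ → ℝ} {u : ℝ} (h : 0 < m u ∧ m u < 1) :
    profileHeight k m Q u = heightOf k (logModulus (m u) - 4 * Q u) := by
  have h1 := one_sub_sq_pos h
  have h3 : 0 < 1 + m u ^ 2 := by positivity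
  unfold profileHeight heightOf profileGamma
  split_ifs with hk
  · rfl
  · rw [Real.rpow_def_of_pos (div_pos h3 h1), ← Real.exp_add, logModulus]
    congr 2
    ring

/-- A form of the radius common to k = 1 and k ≠ 1. -/
lemma profileRadius_eq {k : ℝ} {m Q : ℝ → ℝ} (u : ℝ) :
    profileRadius k m Q u =
      2 * weightRecip k (profileHeight k m Q u) * ((deriv m u - m u) / (1 - m u ^ 2)) := by
  unfold profileHeight profileRadius weightRecip
  split_ifs with hk
  · ring
  · ring

/-- Solved for m', the equation of the modulus is an explicit first order equation depending only on
m and Φ. -/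
lemma ode_iff {k σ m m' Φ : ℝ} (h : 0 < m ∧ m < 1) :
    (m - m') / √(1 - m ^ 4) = σ * ((1 - m ^ 2) / (1 + m ^ 2)) ^ (k / 2) * Real.exp (-Φ) ↔
      m' = m - σ * Real.exp (logSpeed k m - Φ) := by
  have h2 : √(1 - m ^ 4) ≠ 0 := (Real.sqrt_pos.2 (one_sub_pow_four_pos h)).ne'
  rw [div_eq_iff h2, sub_eq_add_neg (logSpeed k m), Real.exp_add, exp_logSpeed k h]
  constructor <;> intro h <;> linear_combination -h

/-! ### The profile curve -/

section Profile

variable {k σ : ℝ} {J : Set ℝ} {m Φ Q : ℝ → ℝ} {u : ℝ}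

lemma SolvesModulusODE.hasDerivAt (hm : SolvesModulusODE k σ J m Φ) (hJ : IsOpen J) (hu : u ∈ J) :
    HasDerivAt m (deriv m u) u :=
  ((hm.smooth.contDiffAt (hJ.mem_nhds hu)).differentiableAt (by simp)).hasDerivAt

lemma SolvesModulusODE.deriv_eq (hm : SolvesModulusODE k σ J m Φ) (hu : u ∈ J) :
    deriv m u = m u - σ * Real.exp (logSpeed k (m u) - Φ u) :=
  (ode_iff (hm.range u hu)).1 (hm.ode u hu)

/-- Logarithmic differentiation of m' - m = -σ exp(`logSpeed` k m - Φ). -/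
lemma SolvesModulusODE.hasDerivAt_deriv_sub (hm : SolvesModulusODE k σ J m Φ) (hJ : IsOpen J)
    (hu : u ∈ J) :
    HasDerivAt (fun u => deriv m u - m u) ((deriv m u - m u) *
      (-(2 * m u ^ 3 + 2 * k * m u) / (1 - m u ^ 4) * deriv m u -
        (1 + m u ^ 4 - 2 * k * m u ^ 2) / (1 - m u ^ 4))) u := by
  have h1 := ((((hasDerivAt_logSpeed k (hm.range u hu)).comp u (hm.hasDerivAt hJ hu)).sub
    (hm.primitive u hu)).exp).const_mul (-σ)
  have h2 : (fun u => deriv m u - m u) =ᶠ[nhds u]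
      fun u => -σ * Real.exp (logSpeed k (m u) - Φ u) := by
    filter_upwards [hJ.mem_nhds hu] with x hx
    rw [hm.deriv_eq hx]; ring
  refine (h1.congr_of_eventuallyEq h2).congr_deriv ?_
  rw [h2.eq_of_nhds]
  simp only [Pi.sub_apply, Function.comp]
  ring

lemma SolvesModulusODE.hasDerivAt_profileHeight (hm : SolvesModulusODE k σ J m Φ) (hJ : IsOpen J)
    (hQ : ∀ u ∈ J, HasDerivAt Q (m u ^ 2 / (1 - m u ^ 4)) u) (hu : u ∈ J) :
    HasDerivAt (profileHeight k m Q)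
      (2 * m u / (1 + m u ^ 2) * profileRadius k m Q u) u := by
  have h1 := (hasDerivAt_heightOf k (logModulus (m u) - 4 * Q u)).comp u
    (((hasDerivAt_logModulus (hm.range u hu)).comp u (hm.hasDerivAt hJ hu)).sub
      ((hQ u hu).const_mul 4))
  have h2 : profileHeight k m Q =ᶠ[nhds u]
      fun u => heightOf k (logModulus (m u) - 4 * Q u) := by
    filter_upwards [hJ.mem_nhds hu] with x hx
    exact profileHeight_eq (hm.range x hx)
  refine (h1.congr_of_eventuallyEq h2).congr_deriv ?_
  rw [profileRadius_eq, h2.eq_of_nhds]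
  have h3 := one_sub_sq_pos (hm.range u hu)
  have h4 : 1 - m u ^ 4 = (1 - m u ^ 2) * (1 + m u ^ 2) := by ring
  rw [h4]
  field_simp
  ring

/-- In the logarithmic derivative of 2τ(m'-m)/(1-m²) all terms containing k or m' cancel. Together
with the formula for h', this makes the tangent of the profile ρ times a unit vector orthogonal to
the meridian normal (2m, 1-m²)/(1+m²). -/
lemma SolvesModulusODE.hasDerivAt_profileRadius (hm : SolvesModulusODE k σ J m Φ) (hJ : IsOpen J)
    (hQ : ∀ u ∈ J, HasDerivAt Q (m u ^ 2 / (1 - m u ^ 4)) u) (hu : u ∈ J) :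
    HasDerivAt (profileRadius k m Q)
      (-((1 - m u ^ 2) / (1 + m u ^ 2)) * profileRadius k m Q u) u := by
  have h3 := one_sub_sq_pos (hm.range u hu)
  have h1 := ((((hasDerivAt_weightRecip k _).comp u
    (hm.hasDerivAt_profileHeight hJ hQ hu)).const_mul 2).mul
    ((hm.hasDerivAt_deriv_sub hJ hu).div (((hm.hasDerivAt hJ hu).pow 2).const_sub 1) h3.ne'))
  have h2 : profileRadius k m Q = fun u =>
      2 * weightRecip k (profileHeight k m Q u) * ((deriv m u - m u) / (1 - m u ^ 2)) := by
    funext x; exact profileRadius_eq x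
  rw [h2]
  refine h1.congr_deriv ?_
  simp only [Function.comp, h2, Pi.pow_apply, Pi.div_apply]
  have h4 : 1 - m u ^ 4 = (1 - m u ^ 2) * (1 + m u ^ 2) := by ring
  rw [h4]
  field_simp
  push_cast
  ring

lemma SolvesModulusODE.height_pos (hm : SolvesModulusODE k σ J m Φ) (hk : k ≠ 0) (hu : u ∈ J)
    (h1 : k ≠ 1) : 0 < profileHeight k m Q u := by
  rw [profileHeight_eq (hm.range u hu)]
  exact heightOf_pos hk h1 _

/-- m' - m is ± an exponential, so the profile never meets the axis; this gives regularity of the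
surface of revolution. -/
lemma SolvesModulusODE.radius_ne_zero (hm : SolvesModulusODE k σ J m Φ) (hk : k ≠ 0)
    (hσ : σ = 1 ∨ σ = -1) (hu : u ∈ J) : profileRadius k m Q u ≠ 0 := by
  rw [profileRadius_eq, hm.deriv_eq hu]
  have h3 := one_sub_sq_pos (hm.range u hu)
  have h4 := weightRecip_ne_zero (fun h1 => hm.height_pos (Q := Q) hk hu h1)
  have h5 : σ ≠ 0 := by rcases hσ with rfl | rfl <;> norm_num
  have h6 : m u - σ * Real.exp (logSpeed k (m u) - Φ u) - m u ≠ 0 := by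
    simp [h5]
  exact mul_ne_zero (mul_ne_zero two_ne_zero h4) (div_ne_zero h6 h3.ne')

lemma contDiffOn_of_hasDerivAt {F : Type*} [NormedAddCommGroup F] [NormedSpace ℝ F]
    {f f' : ℝ → F} {J : Set ℝ} (hJ : IsOpen J)
    (h : ∀ u ∈ J, HasDerivAt f (f' u) u) (h' : ContDiffOn ℝ ∞ f' J) : ContDiffOn ℝ ∞ f J := by
  rw [contDiffOn_infty_iff_deriv_of_isOpen hJ]
  exact ⟨fun u hu => (h u hu).differentiableAt.differentiableWithinAt,
    h'.congr fun u hu => (h u hu).deriv⟩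

lemma contDiffOn_logModulus : ContDiffOn ℝ ∞ logModulus (Set.Ioo 0 1) := by
  unfold logModulus
  refine ContDiffOn.log (ContDiffOn.div (by fun_prop) (by fun_prop) ?_) ?_
  · intro x hx; exact (one_sub_sq_pos hx).ne'
  · intro x hx; exact (div_pos (by positivity) (one_sub_sq_pos hx)).ne'

lemma SolvesModulusODE.contDiffOn_Q (hm : SolvesModulusODE k σ J m Φ) (hJ : IsOpen J)
    (hQ : ∀ u ∈ J, HasDerivAt Q (m u ^ 2 / (1 - m u ^ 4)) u) : ContDiffOn ℝ ∞ Q J := by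
  refine contDiffOn_of_hasDerivAt hJ hQ ?_
  have := hm.smooth
  exact (this.pow 2).div (contDiffOn_const.sub (this.pow 4))
    fun u hu => (one_sub_pow_four_pos (hm.range u hu)).ne'

lemma SolvesModulusODE.contDiffOn_height (hm : SolvesModulusODE k σ J m Φ) (hJ : IsOpen J)
    (hQ : ∀ u ∈ J, HasDerivAt Q (m u ^ 2 / (1 - m u ^ 4)) u) :
    ContDiffOn ℝ ∞ (profileHeight k m Q) J := by
  refine ContDiffOn.congr ?_ fun u hu => profileHeight_eq (hm.range u hu)
  exact (contDiff_heightOf k).comp_contDiffOn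
    ((contDiffOn_logModulus.comp hm.smooth fun u hu => hm.range u hu).sub
      (contDiffOn_const.mul (hm.contDiffOn_Q hJ hQ)))

lemma SolvesModulusODE.contDiffOn_radius (hm : SolvesModulusODE k σ J m Φ) (hJ : IsOpen J)
    (hQ : ∀ u ∈ J, HasDerivAt Q (m u ^ 2 / (1 - m u ^ 4)) u) :
    ContDiffOn ℝ ∞ (profileRadius k m Q) J := by
  refine ContDiffOn.congr ?_ fun u hu => profileRadius_eq u
  have hd : ContDiffOn ℝ ∞ (deriv m) J :=
    ((contDiffOn_infty_iff_deriv_of_isOpen hJ).1 hm.smooth).2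
  exact (contDiffOn_const.mul ((contDiff_weightRecip k).comp_contDiffOn
    (hm.contDiffOn_height hJ hQ))).mul ((hd.sub hm.smooth).div
      (contDiffOn_const.sub (hm.smooth.pow 2))
      fun u hu => (one_sub_sq_pos (hm.range u hu)).ne')

/-! ### The surface of revolution -/

/-- The unit normal of the surface of revolution. -/
def revolutionNormal (m : ℝ → ℝ) (w : ℂ) : E3 :=
  cylVec (2 * m w.re / (1 + m w.re ^ 2)) 0 ((1 - m w.re ^ 2) / (1 + m w.re ^ 2)) w.im

lemma norm_revolutionNormal (m : ℝ → ℝ) (w : ℂ) : ‖revolutionNormal m w‖ = 1 := by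
  rw [← sq_eq_sq₀ (norm_nonneg _) zero_le_one, revolutionNormal, norm_sq_cylVec]
  field_simp
  ring

variable {a b : ℝ}

lemma SolvesModulusODE.dU_revolution (hm : SolvesModulusODE k σ J m Φ) (hJ : IsOpen J)
    (hQ : ∀ u ∈ J, HasDerivAt Q (m u ^ 2 / (1 - m u ^ 4)) u) {w : ℂ} (hw : w ∈ strip J) :
    dU (revolution a b (profileRadius k m Q) (profileHeight k m Q)) w =
      cylVec (-((1 - m w.re ^ 2) / (1 + m w.re ^ 2)) * profileRadius k m Q w.re) 0
        (2 * m w.re / (1 + m w.re ^ 2) * profileRadius k m Q w.re) w.im := by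
  rw [revolution_eq]
  exact dU_cylVec (hm.hasDerivAt_profileRadius hJ hQ hw) (hasDerivAt_const _ (0 : ℝ))
    (hm.hasDerivAt_profileHeight hJ hQ hw)

lemma SolvesModulusODE.dV_revolution (hm : SolvesModulusODE k σ J m Φ) (hJ : IsOpen J)
    (hQ : ∀ u ∈ J, HasDerivAt Q (m u ^ 2 / (1 - m u ^ 4)) u) {w : ℂ} (hw : w ∈ strip J) :
    dV (revolution a b (profileRadius k m Q) (profileHeight k m Q)) w =
      cylVec 0 (profileRadius k m Q w.re) 0 w.im := by
  rw [revolution_eq]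
  refine (dV_cylVec (hm.hasDerivAt_profileRadius hJ hQ hw) (hasDerivAt_const _ (0 : ℝ))
    (hm.hasDerivAt_profileHeight hJ hQ hw)).trans ?_
  simp

lemma isOpen_strip (hJ : IsOpen J) : IsOpen (strip J) := hJ.preimage Complex.continuous_re

lemma SolvesModulusODE.isConformalOn_revolution (hm : SolvesModulusODE k σ J m Φ) (hJ : IsOpen J)
    (hQ : ∀ u ∈ J, HasDerivAt Q (m u ^ 2 / (1 - m u ^ 4)) u) :
    IsConformalOn (strip J)
      (revolution a b (profileRadius k m Q) (profileHeight k m Q)) := by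
  intro w hw
  rw [hm.dU_revolution hJ hQ hw, hm.dV_revolution hJ hQ hw, inner_cylVec]
  refine ⟨?_, by ring⟩
  rw [← sq_eq_sq₀ (norm_nonneg _) (norm_nonneg _), norm_sq_cylVec, norm_sq_cylVec]
  field_simp
  ring

/-- As ⟨n, X_uu + X_vv⟩ = 2ρ(m'-m)/(1+m²), the Euler-Lagrange equation τ⟨n, X_uu + X_vv⟩ = ρ² n₃ is
just the formula ρ = 2τ(m'-m)/(1-m²). The equation of the modulus enters through the derivatives of
ρ and h. -/
lemma SolvesModulusODE.inClassOn_revolution (hm : SolvesModulusODE k σ J m Φ) (hJ : IsOpen J)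
    (hQ : ∀ u ∈ J, HasDerivAt Q (m u ^ 2 / (1 - m u ^ 4)) u) (hk : k ≠ 0)
    (hσ : σ = 1 ∨ σ = -1) :
    InClassOn k (strip J)
      (revolution a b (profileRadius k m Q) (profileHeight k m Q)) := by
  have hn : ∀ w ∈ strip J, ‖revolutionNormal m w‖ = 1 ∧ revolutionNormal m w ∈
      (tangentPlane (revolution a b (profileRadius k m Q) (profileHeight k m Q)) w)ᗮ := by
    intro w hw
    refine ⟨norm_revolutionNormal m w, ?_⟩
    rw [mem_tangentPlane_orthogonal, hm.dU_revolution hJ hQ hw, hm.dV_revolution hJ hQ hw,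
      revolutionNormal, inner_cylVec, inner_cylVec]
    constructor <;> ring
  rw [inClassOn_iff (hm.isConformalOn_revolution hJ hQ) hn]
  refine ⟨?_, ?_, ?_, ?_⟩
  · rw [contDiffOn_euclidean]
    have hre : ContDiffOn ℝ ∞ (fun w : ℂ => w.re) (strip J) := Complex.reCLM.contDiff.contDiffOn
    have him : ContDiffOn ℝ ∞ (fun w : ℂ => w.im) (strip J) := Complex.imCLM.contDiff.contDiffOn
    have hρ := (hm.contDiffOn_radius hJ hQ).comp hre fun w hw => hw
    have hh := (hm.contDiffOn_height hJ hQ).comp hre fun w hw => hw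
    intro i
    fin_cases i
    · exact contDiffOn_const.add (hρ.mul him.cos)
    · exact contDiffOn_const.add (hρ.mul him.sin)
    · exact hh
  · intro w hw
    have hr := hm.radius_ne_zero (Q := Q) hk hσ hw
    have hc := hm.isConformalOn_revolution (a := a) (b := b) hJ hQ w hw
    have hV : dV (revolution a b (profileRadius k m Q) (profileHeight k m Q)) w ≠ 0 := by
      rw [hm.dV_revolution hJ hQ hw, ← norm_ne_zero_iff, ← sq_pos_iff, norm_sq_cylVec]
      positivity
    have hU : dU (revolution a b (profileRadius k m Q) (profileHeight k m Q)) w ≠ 0 := by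
      rw [← norm_ne_zero_iff, hc.1, norm_ne_zero_iff]; exact hV
    refine linearIndependent_of_ne_zero_of_inner_eq_zero (𝕜 := ℝ) ?_ ?_
    · intro i; fin_cases i
      · exact hU
      · exact hV
    · intro i j hij
      fin_cases i <;> fin_cases j
      · exact absurd rfl hij
      · exact hc.2
      · exact (real_inner_comm _ _).trans hc.2
      · exact absurd rfl hij
  · intro h1 w hw
    exact hm.height_pos hk hw h1
  · intro w hw
    have hρ := hm.hasDerivAt_profileRadius hJ hQ hw
    have hd := hm.hasDerivAt hJ hw
    have h1 : (0 : ℝ) < 1 + m w.re ^ 2 := by positivity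
    have heq : dU (revolution a b (profileRadius k m Q) (profileHeight k m Q)) =ᶠ[nhds w]
        fun w => (0 : E3) + cylVec
          (-((1 - m w.re ^ 2) / (1 + m w.re ^ 2)) * profileRadius k m Q w.re) 0
          (2 * m w.re / (1 + m w.re ^ 2) * profileRadius k m Q w.re) w.im := by
      filter_upwards [(isOpen_strip hJ).mem_nhds hw] with x hx
      rw [hm.dU_revolution hJ hQ hx, zero_add]
    have hUU := dU_cylVec (c := 0)
      (p := fun u => -((1 - m u ^ 2) / (1 + m u ^ 2)) * profileRadius k m Q u)
      (q := fun _ => 0) (r := fun u => 2 * m u / (1 + m u ^ 2) * profileRadius k m Q u)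
      ((((hd.pow 2).const_sub 1).div ((hd.pow 2).const_add 1) h1.ne').neg.mul hρ)
      (hasDerivAt_const _ (0 : ℝ))
      (((hd.const_mul 2).div ((hd.pow 2).const_add 1) h1.ne').mul hρ)
    rw [dU, ← heq.fderiv_eq, ← dU] at hUU
    have hVV : dV (dV (revolution a b (profileRadius k m Q) (profileHeight k m Q))) w =
        cylVec (-profileRadius k m Q w.re) 0 0 w.im := by
      have heq : dV (revolution a b (profileRadius k m Q) (profileHeight k m Q)) =ᶠ[nhds w]
          fun w => (0 : E3) + cylVec 0 (profileRadius k m Q w.re) 0 w.im := by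
        filter_upwards [(isOpen_strip hJ).mem_nhds hw] with x hx
        rw [hm.dV_revolution hJ hQ hx, zero_add]
      rw [dV, heq.fderiv_eq]
      exact dV_cylVec (p := fun _ => 0) (r := fun _ => 0) (hasDerivAt_const _ (0 : ℝ)) hρ
        (hasDerivAt_const _ (0 : ℝ))
    rw [hUU, hVV, cylVec_add, hm.dU_revolution hJ hQ hw, norm_sq_cylVec, revolutionNormal,
      inner_cylVec, cylVec_two]
    have hX2 : revolution a b (profileRadius k m Q) (profileHeight k m Q) w 2 =
      profileHeight k m Q w.re := rfl
    have h3 := one_sub_sq_pos (hm.range _ hw)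
    rw [hX2, profileRadius_eq]
    simp only [Pi.pow_apply, Pi.div_apply, Pi.neg_apply]
    field_simp
    push_cast
    ring

end Profile

/-! ### Maximal solutions of autonomous differential equations -/

section ODE

variable {E : Type*} [NormedAddCommGroup E] [NormedSpace ℝ E]

/-- `γ` is an integral curve of `V` in `Ω`, defined on the open interval `J`. -/
structure IsSolutionOn (V : E → E) (Ω : Set E) (J : Set ℝ) (γ : ℝ → E) : Prop where
  isOpen : IsOpen J
  ordConnected : J.OrdConnected
  mapsTo : ∀ u ∈ J, γ u ∈ Ω
  hasDerivAt : ∀ u ∈ J, HasDerivAt γ (V (γ u)) u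

variable {V : E → E} {Ω : Set E} {J J' : Set ℝ} {γ γ' : ℝ → E}

/-- The set where the germs agree is open by definition. It is relatively closed because the curves
agree at its limit points by continuity, and local uniqueness applies there. -/
lemma IsSolutionOn.eqOn (hΩ : IsOpen Ω) (hV : ContDiffOn ℝ 1 V Ω) (h : IsSolutionOn V Ω J γ)
    (h' : IsSolutionOn V Ω J' γ') {t : ℝ} (ht : t ∈ J) (ht' : t ∈ J') (heq : γ t = γ' t) :
    Set.EqOn γ γ' (J ∩ J') := by
  have loc : ∀ s ∈ J ∩ J', γ s = γ' s → γ =ᶠ[nhds s] γ' := by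
    intro s hs hs'
    obtain ⟨K, T, hT, hK⟩ := (hV.contDiffAt (hΩ.mem_nhds (h.mapsTo s hs.1))).exists_lipschitzOnWith
    refine ODE_solution_unique_of_eventually (v := fun _ => V) (s := fun _ => T) (K := K)
      (Filter.Eventually.of_forall fun _ => hK) ?_ ?_ hs'
    · filter_upwards [h.isOpen.mem_nhds hs.1,
        (h.hasDerivAt s hs.1).continuousAt.preimage_mem_nhds hT] with x hx hx'
      exact ⟨h.hasDerivAt x hx, hx'⟩
    · rw [hs'] at hT
      filter_upwards [h'.isOpen.mem_nhds hs.2,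
        (h'.hasDerivAt s hs.2).continuousAt.preimage_mem_nhds hT] with x hx hx'
      exact ⟨h'.hasDerivAt x hx, hx'⟩
  have hpre : IsPreconnected (J ∩ J') :=
    (Set.OrdConnected.inter h.ordConnected h'.ordConnected).isPreconnected
  have hsub : J ∩ J' ⊆ {s | γ =ᶠ[nhds s] γ'} := by
    refine hpre.subset_of_closure_inter_subset ?_ ⟨t, ⟨ht, ht'⟩, loc t ⟨ht, ht'⟩ heq⟩ ?_
    · exact isOpen_setOfPred_eventually_nhds
    · rintro s ⟨hs, hsJ⟩
      refine loc s hsJ ?_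
      have hfr : ∃ᶠ x in nhds s, γ x = γ' x :=
        (mem_closure_iff_frequently.1 hs).mono fun x hx => Filter.EventuallyEq.eq_of_nhds hx
      by_contra hne
      have h1 := (h.hasDerivAt s hsJ.1).continuousAt
      have h2 := (h'.hasDerivAt s hsJ.2).continuousAt
      exact hfr ((h1.ne_iff_eventually_ne h2).1 hne)
  exact fun s hs => (hsub hs).eq_of_nhds

/-- The field is autonomous; translating u absorbs the free additive constant of the conformal
parameter. -/
lemma IsSolutionOn.comp_sub_const (h : IsSolutionOn V Ω J γ) (c : ℝ) :
    IsSolutionOn V Ω {u | u - c ∈ J} (fun u => γ (u - c)) where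
  isOpen := h.isOpen.preimage (continuous_sub_right c)
  ordConnected := h.ordConnected.preimage_mono fun _ _ hxy => sub_le_sub_right hxy c
  mapsTo _ hu := h.mapsTo _ hu
  hasDerivAt u hu := (h.hasDerivAt _ hu).comp_sub_const u c

/-- Every solution extends to a maximal one. -/
lemma IsSolutionOn.exists_maximal (hΩ : IsOpen Ω) (hV : ContDiffOn ℝ 1 V Ω)
    (h : IsSolutionOn V Ω J γ) {t : ℝ} (ht : t ∈ J) :
    ∃ (J₁ : Set ℝ) (γ₁ : ℝ → E), IsSolutionOn V Ω J₁ γ₁ ∧ t ∈ J₁ ∧ γ₁ t = γ t ∧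
      ∀ (J' : Set ℝ) (γ' : ℝ → E), IsSolutionOn V Ω J' γ' → ∀ s ∈ J₁, s ∈ J' → γ₁ s = γ' s →
        J' ⊆ J₁ ∧ Set.EqOn γ₁ γ' J' := by
  classical
  -- The maximal solution is the union of all solutions with the given value at `t`; by uniqueness
  -- they agree on overlaps.
  let P : Set ℝ → (ℝ → E) → Prop := fun I δ => IsSolutionOn V Ω I δ ∧ t ∈ I ∧ δ t = γ t
  let J₁ : Set ℝ := {u | ∃ I δ, P I δ ∧ u ∈ I}
  let γ₁ : ℝ → E := fun u => if hu : ∃ I δ, P I δ ∧ u ∈ I then hu.choose_spec.choose u else 0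
  have hval : ∀ I δ, P I δ → ∀ u ∈ I, γ₁ u = δ u := by
    intro I δ hP u hu
    have hex : ∃ I δ, P I δ ∧ u ∈ I := ⟨I, δ, hP, hu⟩
    have hsp := hex.choose_spec.choose_spec
    simp only [γ₁, dif_pos hex]
    exact hsp.1.1.eqOn hΩ hV hP.1 hsp.1.2.1 hP.2.1 (hsp.1.2.2.trans hP.2.2.symm) ⟨hsp.2, hu⟩
  have hsol : IsSolutionOn V Ω J₁ γ₁ := by
    have hopen : IsOpen J₁ := by
      rw [isOpen_iff_mem_nhds]
      rintro u ⟨I, δ, hP, hu⟩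
      filter_upwards [hP.1.isOpen.mem_nhds hu] with x hx
      exact ⟨I, δ, hP, hx⟩
    refine ⟨hopen, ?_, ?_, ?_⟩
    · rw [← isPreconnected_iff_ordConnected]
      refine isPreconnected_of_forall t ?_
      rintro u ⟨I, δ, hP, hu⟩
      exact ⟨I, fun x hx => ⟨I, δ, hP, hx⟩, hP.2.1, hu, hP.1.ordConnected.isPreconnected⟩
    · rintro u ⟨I, δ, hP, hu⟩
      rw [hval I δ hP u hu]
      exact hP.1.mapsTo u hu
    · rintro u ⟨I, δ, hP, hu⟩
      rw [hval I δ hP u hu]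
      refine (hP.1.hasDerivAt u hu).congr_of_eventuallyEq ?_
      filter_upwards [hP.1.isOpen.mem_nhds hu] with x hx
      exact hval I δ hP x hx
  have hP0 : P J γ := ⟨h, ht, rfl⟩
  refine ⟨J₁, γ₁, hsol, ⟨J, γ, hP0, ht⟩, hval J γ hP0 t ht, ?_⟩
  intro J' γ' h' s hs hs' heq
  have heqOn := hsol.eqOn hΩ hV h' hs hs' heq
  have hsub : J' ⊆ J₁ := by
    -- A solution that meets the maximal one is glued to it; the glued curve belongs to the family
    -- defining `J₁`.
    let γ₂ : ℝ → E := fun u => if u ∈ J₁ then γ₁ u else γ' u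
    have e1 : ∀ u ∈ J₁, γ₂ u = γ₁ u := fun u hu => if_pos hu
    have e2 : ∀ u ∈ J', γ₂ u = γ' u := by
      intro u hu
      by_cases hu1 : u ∈ J₁
      · rw [e1 u hu1]; exact heqOn ⟨hu1, hu⟩
      · exact if_neg hu1
    have h2 : IsSolutionOn V Ω (J₁ ∪ J') γ₂ := by
      refine ⟨hsol.isOpen.union h'.isOpen, ?_, ?_, ?_⟩
      · rw [← isPreconnected_iff_ordConnected]
        exact IsPreconnected.union s hs hs' hsol.ordConnected.isPreconnected
          h'.ordConnected.isPreconnected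
      · rintro u (hu | hu)
        · rw [e1 u hu]; exact hsol.mapsTo u hu
        · rw [e2 u hu]; exact h'.mapsTo u hu
      · rintro u (hu | hu)
        · rw [e1 u hu]
          refine (hsol.hasDerivAt u hu).congr_of_eventuallyEq ?_
          filter_upwards [hsol.isOpen.mem_nhds hu] with x hx using e1 x hx
        · rw [e2 u hu]
          refine (h'.hasDerivAt u hu).congr_of_eventuallyEq ?_
          filter_upwards [h'.isOpen.mem_nhds hu] with x hx using e2 x hx
    have ht1 : t ∈ J₁ := ⟨J, γ, hP0, ht⟩
    have hP2 : P (J₁ ∪ J') γ₂ :=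
      ⟨h2, Or.inl ht1, (e1 t ht1).trans (hval J γ hP0 t ht)⟩
    exact fun u hu => ⟨_, γ₂, hP2, Or.inr hu⟩
  exact ⟨hsub, fun u hu => heqOn ⟨hsub hu, hu⟩⟩

/-- Bootstrapping: if the curve is of class Cⁿ, then so is its derivative V ∘ γ. -/
lemma IsSolutionOn.contDiffOn (hV : ContDiffOn ℝ ∞ V Ω) (h : IsSolutionOn V Ω J γ) :
    ContDiffOn ℝ ∞ γ J := by
  rw [contDiffOn_infty]
  intro n
  induction n with
  | zero =>
    rw [Nat.cast_zero, contDiffOn_zero]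
    exact fun u hu => (h.hasDerivAt u hu).continuousAt.continuousWithinAt
  | succ n ih =>
    rw [Nat.cast_succ, contDiffOn_succ_iff_deriv_of_isOpen h.isOpen]
    refine ⟨fun u hu => (h.hasDerivAt u hu).differentiableAt.differentiableWithinAt, by simp, ?_⟩
    refine ContDiffOn.congr ?_ fun u hu => (h.hasDerivAt u hu).deriv
    exact (hV.of_le (by exact_mod_cast le_top)).comp ih h.mapsTo

end ODE

/-! ### The equation of the modulus as an autonomous system -/

/-- The vector field on `(m, Φ, Q)`-space whose integral curves are the solutions of the equation
of the modulus. -/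
def modulusField (k σ : ℝ) (x : ℝ × ℝ × ℝ) : ℝ × ℝ × ℝ :=
  (x.1 - σ * Real.exp (logSpeed k x.1 - x.2.1),
    (1 + x.1 ^ 4 - 2 * k * x.1 ^ 2) / (1 - x.1 ^ 4), x.1 ^ 2 / (1 - x.1 ^ 4))

/-- The domain of `modulusField`. -/
def modulusDomain : Set (ℝ × ℝ × ℝ) := {x | x.1 ∈ Set.Ioo 0 1}

lemma isOpen_modulusDomain : IsOpen modulusDomain := isOpen_Ioo.preimage continuous_fst

lemma contDiffOn_logSpeed (k : ℝ) : ContDiffOn ℝ ∞ (logSpeed k) (Set.Ioo 0 1) := by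
  unfold logSpeed
  refine ContDiffOn.sub (contDiffOn_const.mul (ContDiffOn.log (by fun_prop) ?_))
    (contDiffOn_const.mul contDiffOn_logModulus)
  exact fun x hx => (one_sub_pow_four_pos hx).ne'

lemma contDiffOn_modulusField (k σ : ℝ) : ContDiffOn ℝ ∞ (modulusField k σ) modulusDomain := by
  have h1 : ContDiffOn ℝ ∞ (fun x : ℝ × ℝ × ℝ => logSpeed k x.1) modulusDomain :=
    (contDiffOn_logSpeed k).comp contDiff_fst.contDiffOn fun x hx => hx
  have h0 : ∀ x ∈ modulusDomain, 1 - x.1 ^ 4 ≠ 0 := fun x hx => (one_sub_pow_four_pos hx).ne'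
  refine ContDiffOn.prodMk ?_ (ContDiffOn.prodMk ?_ ?_)
  · exact contDiff_fst.contDiffOn.sub (contDiffOn_const.mul
      (h1.sub (contDiff_fst.comp contDiff_snd).contDiffOn).exp)
  · exact ContDiffOn.div (by fun_prop) (by fun_prop) h0
  · exact ContDiffOn.div (by fun_prop) (by fun_prop) h0

/-- Solutions of the equation of the modulus, with the primitive `Q`, are the integral curves of
`modulusField`. -/
lemma isSolutionOn_iff {k σ : ℝ} {J : Set ℝ} {m Φ Q : ℝ → ℝ} :
    IsSolutionOn (modulusField k σ) modulusDomain J (fun u => (m u, Φ u, Q u)) ↔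
      IsOpen J ∧ J.OrdConnected ∧ SolvesModulusODE k σ J m Φ ∧
        ∀ u ∈ J, HasDerivAt Q (m u ^ 2 / (1 - m u ^ 4)) u := by
  constructor
  · intro h
    have hm : ∀ u ∈ J, HasDerivAt m (m u - σ * Real.exp (logSpeed k (m u) - Φ u)) u :=
      fun u hu => (h.hasDerivAt u hu).fst
    refine ⟨h.isOpen, h.ordConnected, ⟨?_, h.mapsTo, fun u hu => (h.hasDerivAt u hu).snd.fst, ?_⟩,
      fun u hu => (h.hasDerivAt u hu).snd.snd⟩
    · exact contDiff_fst.comp_contDiffOn (h.contDiffOn (contDiffOn_modulusField k σ))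
    · exact fun u hu => (ode_iff (h.mapsTo u hu)).2 (hm u hu).deriv
  · rintro ⟨hJ, hc, hm, hQ⟩
    refine ⟨hJ, hc, hm.range, fun u hu => ?_⟩
    refine HasDerivAt.prodMk ?_ ((hm.primitive u hu).prodMk (hQ u hu))
    have := hm.hasDerivAt hJ hu
    rwa [hm.deriv_eq hu] at this

/-! ### The Gauss map of a conformal immersion of the class `S_k` -/

/-- The vector product. -/
def crossE3 (a b : E3) : E3 :=
  !₂[a 1 * b 2 - a 2 * b 1, a 2 * b 0 - a 0 * b 2, a 0 * b 1 - a 1 * b 0]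

@[simp] lemma crossE3_zero (a b : E3) : crossE3 a b 0 = a 1 * b 2 - a 2 * b 1 := rfl
@[simp] lemma crossE3_one (a b : E3) : crossE3 a b 1 = a 2 * b 0 - a 0 * b 2 := rfl
@[simp] lemma crossE3_two (a b : E3) : crossE3 a b 2 = a 0 * b 1 - a 1 * b 0 := rfl

lemma crossE3_cylVec (p q r p' q' r' v : ℝ) :
    crossE3 (cylVec p q r v) (cylVec p' q' r' v) =
      cylVec (q * r' - r * q') (r * p' - p * r') (p * q' - q * p') v := by
  refine E3_ext ?_ ?_ ?_ <;> simp
  · ring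
  · ring
  · linear_combination (p * q' - q * p') * Real.sin_sq_add_cos_sq v

/-- The derivative of the Gauss map determines the derivative of the immersion: the case of one
coordinate direction. -/
lemma structure_equation_direction {a b n x y : E3} {l ε τ : ℝ} (hl : l ≠ 0) (hε : ε * ε = 1)
    (haa : ⟪a, a⟫_ℝ = l) (hab : ⟪a, b⟫_ℝ = 0) (hnn : ⟪n, n⟫_ℝ = 1)
    (hna : ⟪a, n⟫_ℝ = 0) (hbb : ⟪b, b⟫_ℝ = l)
    (hK : crossE3 a b = (ε * l) • n) (hxn : ⟪x, n⟫_ℝ = 0)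
    (hsym : ⟪a, y⟫_ℝ = ⟪b, x⟫_ℝ) (hEL : τ * (⟪a, x⟫_ℝ + ⟪b, y⟫_ℝ) = -(l * n 2)) :
    n 2 • a = -τ • (x - ε • crossE3 n y) := by
  have k0 : a 1 * b 2 - a 2 * b 1 = ε * l * n 0 := congrArg (fun v : E3 => v 0) hK
  have k1 : a 2 * b 0 - a 0 * b 2 = ε * l * n 1 := congrArg (fun v : E3 => v 1) hK
  have k2 : a 0 * b 1 - a 1 * b 0 = ε * l * n 2 := congrArg (fun v : E3 => v 2) hK
  simp only [inner_E3] at *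
  have hεl : ε * l ≠ 0 := mul_ne_zero (by rintro rfl; simp at hε) hl
  -- ε l (n × y) = (a × b) × y = ⟨a, y⟩ b - ⟨b, y⟩ a, here paired with a and in `e2` with b.
  have e1 : ε * ((n 1 * y 2 - n 2 * y 1) * a 0 + (n 2 * y 0 - n 0 * y 2) * a 1 +
      (n 0 * y 1 - n 1 * y 0) * a 2) = -(b 0 * y 0 + b 1 * y 1 + b 2 * y 2) := by
    apply mul_left_cancel₀ hl
    linear_combination (y 2 * a 1 - y 1 * a 2) * k0 + (y 0 * a 2 - y 2 * a 0) * k1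
      + (y 1 * a 0 - y 0 * a 1) * k2 + (y 0 * a 0 + y 1 * a 1 + y 2 * a 2) * hab
      - (y 0 * b 0 + y 1 * b 1 + y 2 * b 2) * haa
  have e2 : ε * ((n 1 * y 2 - n 2 * y 1) * b 0 + (n 2 * y 0 - n 0 * y 2) * b 1 +
      (n 0 * y 1 - n 1 * y 0) * b 2) = (a 0 * y 0 + a 1 * y 1 + a 2 * y 2) := by
    apply mul_left_cancel₀ hl
    linear_combination (y 2 * b 1 - y 1 * b 2) * k0 + (y 0 * b 2 - y 2 * b 0) * k1
      + (y 1 * b 0 - y 0 * b 1) * k2 - (y 0 * b 0 + y 1 * b 1 + y 2 * b 2) * hab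
      + (y 0 * a 0 + y 1 * a 1 + y 2 * a 2) * hbb
  -- The vector n₃ a + τ(x - ε n × y) is orthogonal to a by the Euler-Lagrange equation, to b by the
  -- symmetry of the second fundamental form, and to n.
  obtain ⟨h0, h1, h2⟩ := eq_zero_of_orthogonal (t0 := n 2 * a 0 + τ * (x 0 - ε *
      (n 1 * y 2 - n 2 * y 1))) (t1 := n 2 * a 1 + τ * (x 1 - ε * (n 2 * y 0 - n 0 * y 2)))
    (t2 := n 2 * a 2 + τ * (x 2 - ε * (n 0 * y 1 - n 1 * y 0))) hεl k0 k1 k2 hnn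
    (by linear_combination n 2 * haa + hEL - τ * e1)
    (by linear_combination n 2 * hab - τ * e2 - τ * hsym)
    (by linear_combination n 2 * hna + τ * hxn)
  refine E3_ext ?_ ?_ ?_ <;> simp
  · linear_combination h0
  · linear_combination h1
  · linear_combination h2

lemma contDiffOn_dU {X : ℂ → E3} {B : Set ℂ} (hB : IsOpen B) (hX : ContDiffOn ℝ ∞ X B) :
    ContDiffOn ℝ ∞ (dU X) B :=
  (hX.fderiv_of_isOpen hB (m := ∞) (by simp)).clm_apply contDiffOn_const

lemma contDiffOn_dV {X : ℂ → E3} {B : Set ℂ} (hB : IsOpen B) (hX : ContDiffOn ℝ ∞ X B) :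
    ContDiffOn ℝ ∞ (dV X) B :=
  (hX.fderiv_of_isOpen hB (m := ∞) (by simp)).clm_apply contDiffOn_const

lemma isSymmSndFDerivAt_of_smooth {H : Type*} [NormedAddCommGroup H] [NormedSpace ℝ H]
    {f : ℂ → H} {w : ℂ} (hf : ContDiffAt ℝ ∞ f w) : IsSymmSndFDerivAt ℝ f w :=
  hf.isSymmSndFDerivAt (by
    simpa using (WithTop.coe_le_coe.2 le_top : ((2 : ℕ∞) : WithTop ℕ∞) ≤ ((⊤ : ℕ∞) : WithTop ℕ∞)))

lemma dV_dU_eq {X : ℂ → E3} {B : Set ℂ} (hB : IsOpen B) (hX : ContDiffOn ℝ ∞ X B) {w : ℂ}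
    (hw : w ∈ B) : dV (dU X) w = dU (dV X) w := by
  have hat := hX.contDiffAt (hB.mem_nhds hw)
  have hs := isSymmSndFDerivAt_of_smooth hat
  have hd : DifferentiableAt ℝ (fderiv ℝ X) w :=
    (hat.fderiv_right (m := 1) (by norm_cast)).differentiableAt (by simp)
  have key : ∀ y z : ℂ, fderiv ℝ (fun w => fderiv ℝ X w y) w z = fderiv ℝ (fderiv ℝ X) w z y := by
    intro y z
    have := (hd.hasFDerivAt.clm_apply (hasFDerivAt_const y w)).fderiv
    rw [this]; simp
  change fderiv ℝ (fun w => fderiv ℝ X w 1) w Complex.I =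
    fderiv ℝ (fun w => fderiv ℝ X w Complex.I) w 1
  rw [key, key]
  exact hs _ _

lemma pos_or_neg_of_continuousOn {B : Set ℂ} (hB : IsPreconnected B) {f : ℂ → ℝ}
    (hf : ContinuousOn f B) (h0 : ∀ w ∈ B, f w ≠ 0) :
    (∀ w ∈ B, 0 < f w) ∨ ∀ w ∈ B, f w < 0 := by
  by_contra! h
  obtain ⟨⟨x, hx, hx'⟩, y, hy, hy'⟩ := h
  obtain ⟨z, hz, hz'⟩ := hB.intermediate_value hx hy hf ⟨hx', hy'⟩
  exact h0 z hz hz'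

lemma fderiv_eq_dU_dV (X : ℂ → E3) (w z : ℂ) :
    fderiv ℝ X w z = z.re • dU X w + z.im • dV X w := by
  have h : z = z.re • (1 : ℂ) + z.im • Complex.I := by
    simp
  conv_lhs => rw [h]
  rw [map_add, map_smul, map_smul]; rfl

/-- The upward unit normal is smooth, and with an orientation `ε` the derivative of the immersion
is expressed by that of the normal. -/
lemma structure_equation {k : ℝ} {B : Set ℂ} (hB : IsOpen B) (hBc : IsPreconnected B)
    {Y n : ℂ → E3} (hY : InClassOn k B Y) (hc : IsConformalOn B Y)
    (hn : ∀ w ∈ B, ‖n w‖ = 1 ∧ n w ∈ (tangentPlane Y w)ᗮ) (hn2 : ∀ w ∈ B, 0 < n w 2) :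
    ContDiffOn ℝ ∞ n B ∧ ∃ ε : ℝ, (ε = 1 ∨ ε = -1) ∧ ∀ w ∈ B, ∀ z : ℂ,
      n w 2 • fderiv ℝ Y w z = -weightRecip k (Y w 2) •
        (fderiv ℝ n w z - ε • crossE3 (n w) (fderiv ℝ n w (Complex.I * z))) := by
  obtain ⟨hs, hli, -, hEL⟩ := (inClassOn_iff hc hn).1 hY
  have hsU := contDiffOn_dU hB hs
  have hsV := contDiffOn_dV hB hs
  set l : ℂ → ℝ := fun w => ⟪dU Y w, dU Y w⟫_ℝ with hl
  have hl0 : ∀ w ∈ B, 0 < l w := fun w hw =>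
    real_inner_self_pos.2 ((hli w hw).ne_zero (0 : Fin 2))
  have hVV : ∀ w ∈ B, ⟪dV Y w, dV Y w⟫_ℝ = l w := by
    intro w hw
    simp only [hl, real_inner_self_eq_norm_sq, (hc w hw).1]
  have hnn : ∀ w ∈ B, ⟪n w, n w⟫_ℝ = 1 := by
    intro w hw; rw [real_inner_self_eq_norm_sq, (hn w hw).1]; norm_num
  have hnU : ∀ w ∈ B, ⟪dU Y w, n w⟫_ℝ = 0 := fun w hw =>
    (mem_tangentPlane_orthogonal.1 (hn w hw).2).1
  have hnV : ∀ w ∈ B, ⟪dV Y w, n w⟫_ℝ = 0 := fun w hw =>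
    (mem_tangentPlane_orthogonal.1 (hn w hw).2).2
  have hcross : ∀ w ∈ B, ∃ ε : ℝ, (ε = 1 ∨ ε = -1) ∧
      crossE3 (dU Y w) (dV Y w) = (ε * l w) • n w := by
    intro w hw
    have h1 : ⟪dU Y w, dU Y w⟫_ℝ = l w := rfl
    have h2 := hVV w hw
    have h3 := (hc w hw).2
    have h4 := hnn w hw
    have h5 := hnU w hw
    have h6 := hnV w hw
    rw [inner_E3] at h1 h2 h3 h4 h5 h6
    obtain ⟨ε, hε, e0, e1, e2⟩ := cross_eq_of_orthogonal h1 h2 h3 h4 h5 h6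
    exact ⟨ε, hε, E3_ext e0 e1 e2⟩
  have hsmU : ∀ i, ContDiffOn ℝ ∞ (fun w => dU Y w i) B := contDiffOn_euclidean.1 hsU
  have hsmV : ∀ i, ContDiffOn ℝ ∞ (fun w => dV Y w i) B := contDiffOn_euclidean.1 hsV
  have hsK : ContDiffOn ℝ ∞ (fun w => crossE3 (dU Y w) (dV Y w)) B := by
    rw [contDiffOn_euclidean]
    intro i
    fin_cases i
    · exact ((hsmU 1).mul (hsmV 2)).sub ((hsmU 2).mul (hsmV 1))
    · exact ((hsmU 2).mul (hsmV 0)).sub ((hsmU 0).mul (hsmV 2))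
    · exact ((hsmU 0).mul (hsmV 1)).sub ((hsmU 1).mul (hsmV 0))
  -- The orientation is constant: the third component of Y_u × Y_v is ε l n₃, continuous and nowhere
  -- zero on a connected set. Continuity of `n` is not available yet.
  obtain ⟨ε, hε, hK⟩ : ∃ ε : ℝ, (ε = 1 ∨ ε = -1) ∧ ∀ w ∈ B,
      crossE3 (dU Y w) (dV Y w) = (ε * l w) • n w := by
    have hf : ContinuousOn (fun w => crossE3 (dU Y w) (dV Y w) 2) B :=
      ((contDiffOn_euclidean.1 hsK) 2).continuousOn
    have hval : ∀ w ∈ B, ∀ ε : ℝ, crossE3 (dU Y w) (dV Y w) = (ε * l w) • n w →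
        crossE3 (dU Y w) (dV Y w) 2 = ε * (l w * n w 2) := by
      intro w hw ε h
      rw [h]; simp; ring
    have hpos : ∀ w ∈ B, 0 < l w * n w 2 := fun w hw => mul_pos (hl0 w hw) (hn2 w hw)
    have hne : ∀ w ∈ B, crossE3 (dU Y w) (dV Y w) 2 ≠ 0 := by
      intro w hw
      obtain ⟨ε, hε, h⟩ := hcross w hw
      rw [hval w hw ε h]
      refine mul_ne_zero ?_ (hpos w hw).ne'
      rcases hε with rfl | rfl <;> norm_num
    rcases pos_or_neg_of_continuousOn hBc hf hne with h | h
    · refine ⟨1, Or.inl rfl, fun w hw => ?_⟩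
      obtain ⟨ε, rfl | rfl, h'⟩ := hcross w hw
      · exact h'
      · have := h w hw
        rw [hval w hw _ h'] at this
        linarith [hpos w hw]
    · refine ⟨-1, Or.inr rfl, fun w hw => ?_⟩
      obtain ⟨ε, rfl | rfl, h'⟩ := hcross w hw
      · have := h w hw
        rw [hval w hw _ h'] at this
        linarith [hpos w hw]
      · exact h'
  have hεε : ε * ε = 1 := by rcases hε with rfl | rfl <;> norm_num
  -- Smoothness of the normal comes from n = ε (Y_u × Y_v)/l.
  have hsn : ContDiffOn ℝ ∞ n B := by
    have h1 : ContDiffOn ℝ ∞ (fun w => (ε * (l w)⁻¹) • crossE3 (dU Y w) (dV Y w)) B :=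
      (contDiffOn_const.mul ((hsU.inner ℝ hsU).inv fun w hw => (hl0 w hw).ne')).smul hsK
    refine h1.congr fun w hw => ?_
    rw [hK w hw, smul_smul]
    have : ε * (l w)⁻¹ * (ε * l w) = 1 := by
      have := (hl0 w hw).ne'
      field_simp
      linear_combination hεε
    rw [this, one_smul]
  refine ⟨hsn, ε, hε, fun w hw z => ?_⟩
  have hBw := hB.mem_nhds hw
  have hdn : DifferentiableAt ℝ n w := (hsn.contDiffAt hBw).differentiableAt (by simp)
  have hdU : DifferentiableAt ℝ (dU Y) w := (hsU.contDiffAt hBw).differentiableAt (by simp)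
  have hdV : DifferentiableAt ℝ (dV Y) w := (hsV.contDiffAt hBw).differentiableAt (by simp)
  have hzero : ∀ {f g : ℂ → E3} {c : ℝ}, DifferentiableAt ℝ f w → DifferentiableAt ℝ g w →
      (∀ w ∈ B, ⟪f w, g w⟫_ℝ = c) → ∀ z, ⟪f w, fderiv ℝ g w z⟫_ℝ = -⟪fderiv ℝ f w z, g w⟫_ℝ := by
    intro f g c hf hg h z
    have h1 := fderiv_inner_apply ℝ hf hg z
    have h2 : (fun w => ⟪f w, g w⟫_ℝ) =ᶠ[nhds w] fun _ => c := by
      filter_upwards [hBw] with x hx using h x hx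
    rw [h2.fderiv_eq] at h1
    simp at h1
    linarith
  have hx := hzero hdn hdn hnn
  have hxn : ∀ z, ⟪fderiv ℝ n w z, n w⟫_ℝ = 0 := by
    intro z
    have h1 := hx z
    rw [real_inner_comm] at h1
    linarith
  have hU := hzero hdU hdn hnU
  have hV := hzero hdV hdn hnV
  -- Both sides equal -⟨Y_uv, n⟩.
  have hsym : ⟪dU Y w, fderiv ℝ n w Complex.I⟫_ℝ = ⟪dV Y w, fderiv ℝ n w 1⟫_ℝ := by
    rw [hU, hV]
    have := dV_dU_eq hB hs hw
    rw [dV, dU] at this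
    rw [this]
  have hE := hEL w hw
  have hE' : weightRecip k (Y w 2) * (⟪dU Y w, fderiv ℝ n w 1⟫_ℝ +
      ⟪dV Y w, fderiv ℝ n w Complex.I⟫_ℝ) = -(l w * n w 2) := by
    rw [hU, hV]
    simp only [hl, real_inner_self_eq_norm_sq]
    rw [← hE, inner_add_right, real_inner_comm, real_inner_comm (dV (dV Y) w)]
    simp only [dU, dV]
    ring
  have d1 := structure_equation_direction (hl0 w hw).ne' hεε rfl (hc w hw).2 (hnn w hw)
    (hnU w hw) (hVV w hw) (hK w hw) (hxn 1) hsym hE'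
  -- The direction I is the first case for the rotated frame (Y_v, -Y_u); multiplication by I sends
  -- I to -1, whence the sign of `y`.
  have d2 := structure_equation_direction (a := dV Y w) (b := -dU Y w) (y := -fderiv ℝ n w 1)
    (τ := weightRecip k (Y w 2))
    (hl0 w hw).ne' hεε (hVV w hw)
    (by rw [inner_neg_right, real_inner_comm, (hc w hw).2, neg_zero]) (hnn w hw)
    (hnV w hw)
    (by rw [inner_neg_neg]) (by
      rw [← hK w hw]
      refine E3_ext ?_ ?_ ?_ <;> simp <;> ring) (hxn Complex.I)
    (by rw [inner_neg_right, inner_neg_left, hsym])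
    (by rw [inner_neg_neg, ← hE']; ring)
  have hIz : fderiv ℝ n w (Complex.I * z) =
      (-z.im) • fderiv ℝ n w 1 + z.re • fderiv ℝ n w Complex.I := by
    rw [fderiv_eq_dU_dV]; simp [dU, dV]
  rw [fderiv_eq_dU_dV Y, fderiv_eq_dU_dV n, hIz, smul_add, smul_comm, d1,
    smul_comm (n w 2) z.im, d2]
  refine E3_ext ?_ ?_ ?_ <;> simp [dU, dV] <;> ring

/-- Points of the sphere in terms of polar coordinates of the stereographic projection. -/
lemma eq_cylVec_of_stereoSouth {x : E3} {ν : ℝ} (hx : ‖x‖ = 1)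
    (h0 : 0 < ‖stereoSouth x‖)
    (hν : stereoSouth x = ‖stereoSouth x‖ * Complex.exp (Complex.I * ν)) :
    x = cylVec (2 * ‖stereoSouth x‖ / (1 + ‖stereoSouth x‖ ^ 2)) 0
      ((1 - ‖stereoSouth x‖ ^ 2) / (1 + ‖stereoSouth x‖ ^ 2)) ν := by
  set m := ‖stereoSouth x‖ with hm
  have hsq : x 0 ^ 2 + x 1 ^ 2 + x 2 ^ 2 = 1 := by rw [← norm_sq_E3, hx]; norm_num
  -- At the south pole the projection has the default value 0, excluded by `h0`.
  have h2 : 1 + x 2 ≠ 0 := by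
    intro h
    have : stereoSouth x = 0 := by
      rw [stereoSouth, h]; simp; rfl
    rw [hm, this, norm_zero] at h0
    exact lt_irrefl _ h0
  have hm2 : m ^ 2 = (x 0 / (1 + x 2)) ^ 2 + (x 1 / (1 + x 2)) ^ 2 := by
    rw [hm, ← Complex.normSq_eq_norm_sq, Complex.normSq_apply, stereoSouth]; ring
  have hm3 : m ^ 2 * (1 + x 2) = 1 - x 2 := by
    rw [hm2]
    field_simp
    linear_combination hsq
  have hm4 : (1 + m ^ 2) * (1 + x 2) = 2 := by linear_combination hm3
  have hm5 : 1 + m ^ 2 ≠ 0 := by positivity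
  have hx2 : 1 + x 2 = 2 / (1 + m ^ 2) := by field_simp; linear_combination hm4
  rw [mul_comm Complex.I, Complex.exp_mul_I] at hν
  have hre := congrArg Complex.re hν
  have him := congrArg Complex.im hν
  rw [← Complex.ofReal_cos, ← Complex.ofReal_sin] at hre him
  simp only [stereoSouth, Complex.mul_re, Complex.mul_im, Complex.add_re, Complex.add_im,
    Complex.ofReal_re, Complex.ofReal_im, Complex.I_re, Complex.I_im, mul_zero, mul_one, zero_mul,
    sub_zero, add_zero, zero_add] at hre him
  rw [div_eq_iff h2, hx2] at hre him
  refine E3_ext ?_ ?_ ?_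
  · rw [hre]; simp; ring
  · rw [him]; simp; ring
  · simp
    field_simp
    linear_combination hm4

/-! ### Gauss maps with harmonic argument -/

/-- The unit vector with stereographic projection `m e^{iν}`. -/
def polarNormal (m ν : ℝ) : E3 := cylVec (2 * m / (1 + m ^ 2)) 0 ((1 - m ^ 2) / (1 + m ^ 2)) ν

/-- `Y` is a surface of the class `S_k` with Gauss map `m e^{i Re F}`, `F` holomorphic, in the form
of the structure equation with orientation `ε`. -/
structure IsPolarChart (k ε : ℝ) (B : Set ℂ) (Y : ℂ → E3) (m : ℂ → ℝ) (F : ℂ → ℂ) : Prop where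
  isOpen : IsOpen B
  eps : ε = 1 ∨ ε = -1
  smooth : ContDiffOn ℝ ∞ Y B
  smooth_m : ContDiffOn ℝ ∞ m B
  range : ∀ w ∈ B, 0 < m w ∧ m w < 1
  pos : ∀ w ∈ B, k ≠ 1 → 0 < Y w 2
  injective : ∀ w ∈ B, ∀ z, fderiv ℝ Y w z = 0 → z = 0
  analytic : AnalyticOnNhd ℂ F B
  structure_eq : ∀ w ∈ B, ∀ z, polarNormal (m w) (F w).re 2 • fderiv ℝ Y w z =
    -weightRecip k (Y w 2) • (fderiv ℝ (fun w => polarNormal (m w) (F w).re) w z -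
      ε • crossE3 (polarNormal (m w) (F w).re)
        (fderiv ℝ (fun w => polarNormal (m w) (F w).re) w (Complex.I * z)))

lemma hasFDerivAt_polarNormal {m ν : ℂ → ℝ} {m' ν' : ℂ →L[ℝ] ℝ} {w : ℂ}
    (hm : HasFDerivAt m m' w) (hν : HasFDerivAt ν ν' w) (z : ℂ) :
    fderiv ℝ (fun w => polarNormal (m w) (ν w)) w z =
      cylVec ((1 - m w ^ 2) / (1 + m w ^ 2) * (2 / (1 + m w ^ 2) * m' z))
        (2 * m w / (1 + m w ^ 2) * ν' z)
        (-(2 * m w / (1 + m w ^ 2)) * (2 / (1 + m w ^ 2) * m' z)) (ν w) := by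
  have h0 : 1 + m w ^ 2 ≠ 0 := by positivity
  have hp : HasDerivAt (fun m : ℝ => 2 * m / (1 + m ^ 2))
      ((1 - m w ^ 2) / (1 + m w ^ 2) * (2 / (1 + m w ^ 2))) (m w) := by
    refine (((hasDerivAt_id (m w)).const_mul 2).div
      (((hasDerivAt_id (m w)).pow 2).const_add 1) h0).congr_deriv ?_
    simp only [id, Pi.pow_apply]
    field_simp
    push_cast
    ring
  have hr : HasDerivAt (fun m : ℝ => (1 - m ^ 2) / (1 + m ^ 2))
      (-(2 * m w / (1 + m w ^ 2)) * (2 / (1 + m w ^ 2))) (m w) := by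
    refine ((((hasDerivAt_id (m w)).pow 2).const_sub 1).div
      (((hasDerivAt_id (m w)).pow 2).const_add 1) h0).congr_deriv ?_
    simp only [id, Pi.pow_apply]
    field_simp
    push_cast
    ring
  have hp1 := hp.comp_hasFDerivAt w hm
  have hr1 := hr.comp_hasFDerivAt w hm
  have hq1 : HasFDerivAt (fun _ : ℂ => (0 : ℝ)) (0 : ℂ →L[ℝ] ℝ) w := hasFDerivAt_const 0 w
  have e0 := (hp1.mul hν.cos).sub (hq1.mul hν.sin)
  have e1 := (hp1.mul hν.sin).add (hq1.mul hν.cos)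
  obtain ⟨-, h⟩ := hasFDerivAt_E3 (X := fun w => polarNormal (m w) (ν w)) (w := w)
    (f := ![_, _, _]) (by
      intro i
      fin_cases i
      · exact e0
      · exact e1
      · exact hr1)
  refine E3_ext ?_ ?_ ?_
  · rw [h]; simp; ring
  · rw [h]; simp; ring
  · rw [h]; simp; ring

namespace IsPolarChart

variable {k ε : ℝ} {B : Set ℂ} {Y : ℂ → E3} {m : ℂ → ℝ} {F : ℂ → ℂ} {w : ℂ}

lemma eps_mul_self (h : IsPolarChart k ε B Y m F) : ε * ε = 1 := by
  rcases h.eps with rfl | rfl <;> norm_num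

lemma hasFDerivAt_F (h : IsPolarChart k ε B Y m F) (hw : w ∈ B) :
    HasFDerivAt F (((ContinuousLinearMap.toSpanSingleton ℂ (deriv F w)).restrictScalars ℝ)) w :=
  (h.analytic w hw).differentiableAt.hasDerivAt.hasFDerivAt.restrictScalars ℝ

lemma hasFDerivAt_re (h : IsPolarChart k ε B Y m F) (hw : w ∈ B) :
    ∃ L : ℂ →L[ℝ] ℝ, HasFDerivAt (fun w => (F w).re) L w ∧ ∀ z, L z = (deriv F w * z).re := by
  refine ⟨_, Complex.reCLM.hasFDerivAt.comp w (h.hasFDerivAt_F hw), fun z => ?_⟩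
  simp [mul_comm]

lemma hasFDerivAt_im (h : IsPolarChart k ε B Y m F) (hw : w ∈ B) :
    ∃ L : ℂ →L[ℝ] ℝ, HasFDerivAt (fun w => ε * (F w).im) L w ∧
      ∀ z, L z = ε * (deriv F w * z).im := by
  refine ⟨_, (Complex.imCLM.hasFDerivAt.comp w (h.hasFDerivAt_F hw)).const_mul ε, fun z => ?_⟩
  simp [mul_comm]

lemma hasFDerivAt_m (h : IsPolarChart k ε B Y m F) (hw : w ∈ B) :
    HasFDerivAt m (fderiv ℝ m w) w :=
  ((h.smooth_m.contDiffAt (h.isOpen.mem_nhds hw)).differentiableAt (by simp)).hasFDerivAt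

lemma weightRecip_ne (h : IsPolarChart k ε B Y m F) (hw : w ∈ B) : weightRecip k (Y w 2) ≠ 0 :=
  weightRecip_ne_zero (h.pos w hw)

/-- The structure equation divided by n₃ = (1-m²)/(1+m²) > 0, with Re(F' i z) = -Im(F' z). Radial
and vertical components are multiples of dm - m dU. -/
lemma fderiv_eq (h : IsPolarChart k ε B Y m F) (hw : w ∈ B) (z : ℂ) :
    fderiv ℝ Y w z = weightRecip k (Y w 2) • cylVec
      (-(2 / (1 + m w ^ 2) * (fderiv ℝ m w z - m w * (ε * (deriv F w * z).im))))
      (-(2 / (1 - m w ^ 2) * (m w * (deriv F w * z).re - ε * fderiv ℝ m w (Complex.I * z))))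
      (4 * m w / (1 - m w ^ 4) * (fderiv ℝ m w z - m w * (ε * (deriv F w * z).im)))
      (F w).re := by
  obtain ⟨L, hL, hL'⟩ := h.hasFDerivAt_re hw
  have hs := h.structure_eq w hw z
  rw [hasFDerivAt_polarNormal (h.hasFDerivAt_m hw) hL,
    hasFDerivAt_polarNormal (h.hasFDerivAt_m hw) hL, polarNormal, crossE3_cylVec, cylVec_two,
    hL', hL'] at hs
  have h1 := one_sub_sq_pos (h.range w hw)
  have h2 := one_sub_pow_four_pos (h.range w hw)
  have h3 : 0 < 1 + m w ^ 2 := by positivity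
  have hI : (deriv F w * (Complex.I * z)).re = -(deriv F w * z).im := by
    simp; ring
  rw [hI] at hs
  have h4 : 1 - m w ^ 4 = (1 - m w ^ 2) * (1 + m w ^ 2) := by ring
  have hc0 : (1 - m w ^ 2) / (1 + m w ^ 2) ≠ 0 := (div_pos h1 h3).ne'
  apply smul_right_injective E3 hc0
  dsimp only
  rw [hs, h4]
  refine E3_ext ?_ ?_ ?_ <;> simp <;> field_simp <;> ring

/-- The height and the modulus determine a primitive of `m² / (1 - m⁴) dU`. -/
lemma hasFDerivAt_primitive (h : IsPolarChart k ε B Y m F) (hk : k ≠ 0) (hw : w ∈ B) (z : ℂ) :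
    fderiv ℝ (fun w => (logModulus (m w) - weightOf k (Y w 2)) / 4) w z =
      m w ^ 2 / (1 - m w ^ 4) * (ε * (deriv F w * z).im) := by
  have hY : HasFDerivAt Y (fderiv ℝ Y w) w :=
    ((h.smooth.contDiffAt (h.isOpen.mem_nhds hw)).differentiableAt (by simp)).hasFDerivAt
  have hY2 : HasFDerivAt (fun w => Y w 2)
      ((EuclideanSpace.proj (𝕜 := ℝ) (2 : Fin 3)).comp (fderiv ℝ Y w)) w :=
    ((EuclideanSpace.proj (𝕜 := ℝ) (2 : Fin 3) : E3 →L[ℝ] ℝ).hasFDerivAt).comp w hY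
  have hd := (((hasDerivAt_logModulus (h.range w hw)).comp_hasFDerivAt w (h.hasFDerivAt_m hw)).sub
    ((hasDerivAt_weightOf hk (h.pos w hw)).comp_hasFDerivAt w hY2)).mul_const (4 : ℝ)⁻¹
  have heq : (fun w => (logModulus (m w) - weightOf k (Y w 2)) / 4) =
    fun w => ((logModulus ∘ m) w - (weightOf k ∘ fun w => Y w 2) w) * (4 : ℝ)⁻¹ := by
    funext w; simp [div_eq_mul_inv]
  have h5 := h.fderiv_eq hw z
  have hτ := h.weightRecip_ne hw
  rw [heq]
  have h6 := hd.fderiv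
  simp only [Pi.sub_apply] at h6 ⊢
  rw [show fderiv ℝ (fun w => ((logModulus ∘ m) w - (weightOf k ∘ fun w => Y w 2) w) * (4 : ℝ)⁻¹) w
    = _ from h6]
  simp [h5]
  field_simp
  ring

/-- The modulus is locally a function of the harmonic conjugate of the argument. -/
lemma wedge (h : IsPolarChart k ε B Y m F) (hk : k ≠ 0) (hw : w ∈ B) :
    fderiv ℝ m w 1 * (deriv F w).re = fderiv ℝ m w Complex.I * (deriv F w).im := by
  set T : ℂ → ℝ := fun w => (logModulus (m w) - weightOf k (Y w 2)) / 4 with hT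
  set U : ℂ → ℝ := fun w => ε * (F w).im with hU
  set κ : ℂ → ℝ := fun w => m w ^ 2 / (1 - m w ^ 4) with hκ
  have hBw := h.isOpen.mem_nhds hw
  have h2 := one_sub_pow_four_pos (h.range w hw)
  have hmw := h.smooth_m.contDiffAt hBw
  have hYw := h.smooth.contDiffAt hBw
  have hTs : ContDiffAt ℝ ∞ T w := by
    have hlog : ContDiffAt ℝ ∞ logModulus (m w) :=
      contDiffOn_logModulus.contDiffAt (isOpen_Ioo.mem_nhds (h.range w hw))
    have h3 : ContDiffAt ℝ ∞ (fun w => Y w 2) w := contDiffAt_euclidean.1 hYw 2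
    exact ((hlog.comp w hmw).sub ((contDiffAt_weightOf hk (h.pos w hw)).comp w h3)).div_const 4
  have hUs : ContDiffAt ℝ ∞ U w := by
    have h3 : ContDiffAt ℝ ∞ F w := ((h.analytic w hw).contDiffAt (n := ∞)).restrict_scalars ℝ
    exact contDiffAt_const.mul (Complex.imCLM.contDiff.contDiffAt.comp w h3)
  have hκs : DifferentiableAt ℝ κ w := by
    have h3 : ContDiffAt ℝ ∞ κ w := (hmw.pow 2).div (contDiffAt_const.sub (hmw.pow 4)) h2.ne'
    exact h3.differentiableAt (by simp)
  -- The exact form dT equals κ dU.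
  have hTU : ∀ x ∈ B, fderiv ℝ T x = κ x • fderiv ℝ U x := by
    intro x hx
    obtain ⟨L, hL, hL'⟩ := h.hasFDerivAt_im hx
    ext1 z
    rw [hT, h.hasFDerivAt_primitive hk hx z, hU, hL.fderiv]
    simp [hL', hκ]
  have hdU : DifferentiableAt ℝ (fderiv ℝ U) w :=
    (hUs.fderiv_right (m := 1) (by norm_cast)).differentiableAt (by simp)
  have hTU' : fderiv ℝ (fderiv ℝ T) w = fderiv ℝ (fun x => κ x • fderiv ℝ U x) w := by
    apply Filter.EventuallyEq.fderiv_eq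
    filter_upwards [hBw] with x hx using hTU x hx
  have hsym : ∀ {f : ℂ → ℝ}, ContDiffAt ℝ ∞ f w → ∀ y z,
      fderiv ℝ (fderiv ℝ f) w y z = fderiv ℝ (fderiv ℝ f) w z y := by
    intro f hf y z
    exact isSymmSndFDerivAt_of_smooth hf y z
  -- Symmetry of the second derivatives of T and U gives dκ ∧ dU = 0.
  have h3 := hsym hTs 1 Complex.I
  rw [hTU', fderiv_fun_smul hκs hdU] at h3
  simp only [add_apply, smul_apply,
    ContinuousLinearMap.smulRight_apply, smul_eq_mul, hsym hUs 1 Complex.I] at h3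
  have h4 : fderiv ℝ κ w 1 * fderiv ℝ U w Complex.I = fderiv ℝ κ w Complex.I * fderiv ℝ U w 1 := by
    linarith
  -- κ is a function of m with positive derivative, so dκ may be replaced by dm.
  have hκ' : HasDerivAt (fun m : ℝ => m ^ 2 / (1 - m ^ 4))
      (2 * m w * (1 + m w ^ 4) / (1 - m w ^ 4) ^ 2) (m w) := by
    refine ((hasDerivAt_pow 2 (m w)).div ((hasDerivAt_pow 4 (m w)).const_sub 1)
      h2.ne').congr_deriv ?_
    field_simp
    push_cast
    ring
  have h5 : fderiv ℝ κ w = _ := (hκ'.comp_hasFDerivAt w (h.hasFDerivAt_m hw)).fderiv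
  obtain ⟨L, hL, hL'⟩ := h.hasFDerivAt_im hw
  have h6 : fderiv ℝ U w = L := hL.fderiv
  have h7 : 2 * m w * (1 + m w ^ 4) / (1 - m w ^ 4) ^ 2 * ε ≠ 0 := by
    have := (h.range w hw).1
    refine mul_ne_zero (by positivity) ?_
    rcases h.eps with h | h <;> rw [h] <;> norm_num
  apply mul_left_cancel₀ h7
  rw [h5, h6] at h4
  simp only [smul_apply, smul_eq_mul, hL'] at h4
  simp at h4
  linear_combination h4

/-- At a critical point of the argument the modulus is not critical. -/
lemma fderiv_m_ne_zero (h : IsPolarChart k ε B Y m F) (hw : w ∈ B) (h0 : deriv F w = 0) :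
    fderiv ℝ m w ≠ 0 := by
  intro hm
  have h1 := h.fderiv_eq hw 1
  rw [h0, hm] at h1
  refine one_ne_zero (h.injective w hw 1 (h1.trans ?_))
  refine E3_ext ?_ ?_ ?_ <;> simp

/-- The argument is locally constant or has no critical points. -/
lemma eventually_eq_zero_or_ne_zero (h : IsPolarChart k ε B Y m F) (hk : k ≠ 0) (hw : w ∈ B) :
    (∀ᶠ x in nhds w, deriv F x = 0) ∨ deriv F w ≠ 0 := by
  by_contra! hcon
  obtain ⟨hne, h0⟩ := hcon
  have han : AnalyticAt ℂ (deriv F) w := (h.analytic w hw).deriv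
  have hord : analyticOrderAt (deriv F) w ≠ ⊤ := by
    rw [Ne, analyticOrderAt_eq_top]; exact Filter.not_eventually.2 hne
  obtain ⟨j, hj⟩ := ENat.ne_top_iff_exists.1 hord
  obtain ⟨g, hg, hg0, hgF⟩ := (han.analyticOrderAt_eq_natCast).1 hj.symm
  have hj0 : j ≠ 0 := by
    rintro rfl
    have := hgF.self_of_nhds
    simp [h0] at this
    exact hg0 this.symm
  -- With the gradient of m written as m_x + i m_y, the relation dm ∧ dU = 0 says Re((m_x + i m_y)
  -- F') = 0.
  set a : ℂ := ⟨fderiv ℝ m w 1, fderiv ℝ m w Complex.I⟩ with ha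
  have ha0 : a ≠ 0 := by
    intro haz
    apply h.fderiv_m_ne_zero hw h0
    ext1 z
    have h1 : fderiv ℝ m w 1 = 0 := congrArg Complex.re haz
    have h2 : fderiv ℝ m w Complex.I = 0 := congrArg Complex.im haz
    have h3 : z = z.re • (1 : ℂ) + z.im • Complex.I := by simp
    rw [h3, map_add, map_smul, map_smul, h1, h2]; simp
  have hmc : ContinuousAt (fderiv ℝ m) w :=
    ((h.smooth_m.contDiffAt (h.isOpen.mem_nhds hw)).fderiv_right (m := 1)
      (by norm_cast)).continuousAt
  -- along every ray the leading term is orthogonal to the gradient of the modulus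
  have hray : ∀ c : ℂ, c ≠ 0 → (a * (c ^ j * g w)).re = 0 := by
    intro c hc
    have hray : Filter.Tendsto (fun t : ℝ => w + t * c) (nhdsWithin 0 (Set.Ioi 0)) (nhds w) := by
      have : Continuous fun t : ℝ => w + t * c := by fun_prop
      have h1 := this.tendsto 0
      simp only [Complex.ofReal_zero, zero_mul, add_zero] at h1
      exact h1.mono_left nhdsWithin_le_nhds
    set φ : ℂ → ℝ := fun x => fderiv ℝ m x 1 * (c ^ j * g x).re -
      fderiv ℝ m x Complex.I * (c ^ j * g x).im with hφ
    have hφc : ContinuousAt φ w := by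
      have h1 : ContinuousAt (fun x => c ^ j * g x) w := continuousAt_const.mul hg.continuousAt
      have h2 := Complex.continuous_re.continuousAt.comp h1
      have h3 := Complex.continuous_im.continuousAt.comp h1
      exact ((hmc.clm_apply continuousAt_const).mul h2).sub
        ((hmc.clm_apply continuousAt_const).mul h3)
    have hzero : ∀ᶠ t : ℝ in nhdsWithin 0 (Set.Ioi 0), φ (w + t * c) = 0 := by
      filter_upwards [hray.eventually hgF, hray.eventually (h.isOpen.mem_nhds hw),
        self_mem_nhdsWithin] with t ht htB ht0
      have h1 := h.wedge hk htB
      have h2 : deriv F (w + t * c) = ((t ^ j : ℝ) : ℂ) * (c ^ j * g (w + t * c)) := by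
        rw [ht, smul_eq_mul, add_sub_cancel_left, mul_pow]; push_cast; ring
      rw [h2, Complex.re_ofReal_mul, Complex.im_ofReal_mul] at h1
      have h3 : t ^ j ≠ 0 := pow_ne_zero _ (Set.mem_Ioi.1 ht0).ne'
      apply mul_left_cancel₀ h3
      simp only [hφ]
      linear_combination h1
    have hlim : φ w = 0 := by
      have h1 := hφc.tendsto.comp hray
      refine tendsto_nhds_unique h1 (tendsto_const_nhds.congr' ?_)
      filter_upwards [hzero] with t ht using ht.symm
    rw [Complex.mul_re, ha]
    exact hlim
  -- As j ≥ 1, the rays through 1 and through a j-th root of i give both Re(a g) = 0 and Im(a g) =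
  -- 0.
  have hI : ∃ c : ℂ, c ≠ 0 ∧ c ^ j = Complex.I := by
    obtain ⟨c, hc⟩ := IsAlgClosed.exists_pow_nat_eq Complex.I (Nat.pos_of_ne_zero hj0)
    refine ⟨c, ?_, hc⟩
    rintro rfl
    rw [zero_pow hj0] at hc
    exact Complex.I_ne_zero hc.symm
  obtain ⟨c, hc, hcI⟩ := hI
  have h1 := hray 1 one_ne_zero
  have h2 := hray c hc
  rw [one_pow, one_mul] at h1
  rw [hcI] at h2
  have h3 : (a * g w).im = 0 := by
    have : a * (Complex.I * g w) = Complex.I * (a * g w) := by ring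
    rw [this, Complex.I_mul_re] at h2
    linarith
  exact mul_ne_zero ha0 hg0 (Complex.ext h1 h3)

end IsPolarChart

/-! ### Square coordinates -/

/-- The real linear map `x + i y ↦ ε y + i x`. -/
def paramMap (ε : ℝ) : ℂ →L[ℝ] ℂ :=
  (ε • Complex.imCLM).smulRight (1 : ℂ) + Complex.reCLM.smulRight Complex.I

/-- The inverse of `paramMap`. -/
def paramInv (ε : ℝ) : ℂ →L[ℝ] ℂ :=
  Complex.imCLM.smulRight (1 : ℂ) + (ε • Complex.reCLM).smulRight Complex.I

@[simp] lemma paramMap_re (ε : ℝ) (x : ℂ) : (paramMap ε x).re = ε * x.im := by simp [paramMap]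
@[simp] lemma paramMap_im (ε : ℝ) (x : ℂ) : (paramMap ε x).im = x.re := by simp [paramMap]
@[simp] lemma paramInv_re (ε : ℝ) (x : ℂ) : (paramInv ε x).re = x.im := by simp [paramInv]
@[simp] lemma paramInv_im (ε : ℝ) (x : ℂ) : (paramInv ε x).im = ε * x.re := by simp [paramInv]

lemma paramMap_paramInv {ε : ℝ} (hε : ε * ε = 1) (x : ℂ) : paramMap ε (paramInv ε x) = x := by
  apply Complex.ext
  · rw [paramMap_re, paramInv_im, ← mul_assoc, hε, one_mul]
  · rw [paramMap_im, paramInv_re]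

lemma paramInv_paramMap {ε : ℝ} (hε : ε * ε = 1) (x : ℂ) : paramInv ε (paramMap ε x) = x := by
  apply Complex.ext
  · rw [paramInv_re, paramMap_im]
  · rw [paramInv_im, paramMap_re, ← mul_assoc, hε, one_mul]

/-- The open square with centre `c` and half side `δ`. -/
def openSquare (c : ℂ) (δ : ℝ) : Set ℂ :=
  {x | x.re ∈ Set.Ioo (c.re - δ) (c.re + δ) ∧ x.im ∈ Set.Ioo (c.im - δ) (c.im + δ)}

lemma isOpen_openSquare (c : ℂ) (δ : ℝ) : IsOpen (openSquare c δ) :=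
  (isOpen_Ioo.preimage Complex.continuous_re).inter (isOpen_Ioo.preimage Complex.continuous_im)

lemma exists_openSquare_subset {c : ℂ} {T : Set ℂ} (hT : T ∈ nhds c) :
    ∃ δ, 0 < δ ∧ δ ≤ 1 ∧ openSquare c δ ⊆ T := by
  obtain ⟨r, hr, hrT⟩ := Metric.mem_nhds_iff.1 hT
  -- The bound r/2 serves |Re| + |Im| < r; the bound 1 keeps angles in the square distinct modulo
  -- 2π.
  refine ⟨min (r / 2) 1, by positivity, min_le_right _ _, fun x hx => hrT ?_⟩
  have h1 : |(x - c).re| < r / 2 := by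
    rw [Complex.sub_re, abs_lt]
    have := min_le_left (r / 2) 1
    constructor <;> linarith [hx.1.1, hx.1.2]
  have h2 : |(x - c).im| < r / 2 := by
    rw [Complex.sub_im, abs_lt]
    have := min_le_left (r / 2) 1
    constructor <;> linarith [hx.2.1, hx.2.2]
  rw [Metric.mem_ball, dist_eq_norm]
  linarith [Complex.norm_le_abs_re_add_abs_im (x - c)]

/-- `ζ` maps the open set `W` diffeomorphically onto a square, with inverse `κ`. -/
structure IsSquareChart (ζ κ : ℂ → ℂ) (W : Set ℂ) (c : ℂ) (δ : ℝ) : Prop where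
  pos : 0 < δ
  le_one : δ ≤ 1
  isOpen : IsOpen W
  smooth : ContDiffOn ℝ ∞ ζ W
  smooth_symm : ContDiffOn ℝ ∞ κ (openSquare c δ)
  mapsTo : ∀ w ∈ W, ζ w ∈ openSquare c δ
  mapsTo_symm : ∀ x ∈ openSquare c δ, κ x ∈ W
  left_inv : ∀ w ∈ W, κ (ζ w) = w
  right_inv : ∀ x ∈ openSquare c δ, ζ (κ x) = x

/-- The inverse function theorem for F. A square is used so that the lines u = const meet it in full
intervals. -/
lemma IsPolarChart.exists_isSquareChart {k ε : ℝ} {B : Set ℂ} {Y : ℂ → E3} {m : ℂ → ℝ} {F : ℂ → ℂ}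
    (h : IsPolarChart k ε B Y m F) {w : ℂ} (hw : w ∈ B) (h0 : deriv F w ≠ 0) :
    ∃ (κ : ℂ → ℂ) (W : Set ℂ) (δ : ℝ), w ∈ W ∧ W ⊆ B ∧ (∀ x ∈ W, deriv F x ≠ 0) ∧
      IsSquareChart (fun x => paramMap ε (F x)) κ W (paramMap ε (F w)) δ := by
  have hε := h.eps_mul_self
  have hFc : ContinuousOn (deriv F) B := h.analytic.deriv.continuousOn
  have hFs : ContDiffOn ℝ ∞ F B := fun x hx =>
    (((h.analytic x hx).contDiffAt (n := ∞)).restrict_scalars ℝ).contDiffWithinAt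
  -- On this set F' ≠ 0, so that the local inverse is smooth everywhere and not only at the image of
  -- w.
  set s : Set ℂ := B ∩ deriv F ⁻¹' {0}ᶜ with hs
  have hso : IsOpen s := hFc.isOpen_inter_preimage h.isOpen isOpen_compl_singleton
  have hstr := ((h.analytic w hw).contDiffAt (n := 1)).hasStrictDerivAt (by simp)
  set φ := (hstr.hasStrictFDerivAt_equiv h0).toOpenPartialHomeomorph F with hφ
  set χ := φ.restrOpen s hso with hχ
  have hχF : ∀ x, χ x = F x := fun x => rfl
  have hχs : χ.source = φ.source ∩ s := φ.restrOpen_source s hso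
  have hwχ : w ∈ χ.source := by
    rw [hχs]
    exact ⟨(hstr.hasStrictFDerivAt_equiv h0).mem_toOpenPartialHomeomorph_source, hw, h0⟩
  have hsub : ∀ x ∈ χ.source, x ∈ B ∧ deriv F x ≠ 0 := by
    intro x hx; rw [hχs] at hx; exact ⟨hx.2.1, hx.2.2⟩
  have hT : paramInv ε ⁻¹' χ.target ∈ nhds (paramMap ε (F w)) := by
    refine (paramInv ε).continuous.continuousAt.preimage_mem_nhds ?_
    rw [paramInv_paramMap hε]
    exact χ.open_target.mem_nhds (χ.map_source hwχ)
  obtain ⟨δ, hδ, hδ1, hsq⟩ := exists_openSquare_subset hT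
  have hζc : ContinuousOn (fun x => paramMap ε (F x)) χ.source :=
    (paramMap ε).continuous.comp_continuousOn (hFs.continuousOn.mono fun x hx => (hsub x hx).1)
  refine ⟨fun x => χ.symm (paramInv ε x),
    χ.source ∩ (fun x => paramMap ε (F x)) ⁻¹' openSquare (paramMap ε (F w)) δ, δ,
    ⟨hwχ, ?_⟩, fun x hx => (hsub x hx.1).1, fun x hx => (hsub x hx.1).2, hδ, hδ1,
    hζc.isOpen_inter_preimage χ.open_source (isOpen_openSquare _ _), ?_, ?_,
    fun x hx => hx.2, ?_, ?_, ?_⟩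
  · constructor <;> constructor <;> linarith
  · exact (paramMap ε).contDiff.comp_contDiffOn (hFs.mono fun x hx => (hsub x hx.1).1)
  · intro x hx
    have hxt : paramInv ε x ∈ χ.target := hsq hx
    have hmem := hsub _ (χ.map_target hxt)
    have hd : HasDerivAt χ (deriv F (χ.symm (paramInv ε x))) (χ.symm (paramInv ε x)) :=
      (h.analytic _ hmem.1).differentiableAt.hasDerivAt
    have hc : ContDiffAt ℂ ∞ χ (χ.symm (paramInv ε x)) := (h.analytic _ hmem.1).contDiffAt
    have := (χ.contDiffAt_symm_deriv hmem.2 hxt hd hc).restrict_scalars ℝ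
    exact (this.comp x (paramInv ε).contDiff.contDiffAt).contDiffWithinAt
  · intro x hx
    have hxt : paramInv ε x ∈ χ.target := hsq hx
    refine ⟨χ.map_target hxt, ?_⟩
    have : F (χ.symm (paramInv ε x)) = paramInv ε x := χ.right_inv hxt
    simp only [Set.mem_preimage, this, paramMap_paramInv hε]
    exact hx
  · intro x hx
    simp only [paramInv_paramMap hε]
    exact χ.left_inv hx.1
  · intro x hx
    have : F (χ.symm (paramInv ε x)) = paramInv ε x := χ.right_inv (hsq hx)
    simp only [this, paramMap_paramInv hε]

lemma hasDerivAt_ofReal_add (v u : ℝ) :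
    HasDerivAt (fun u : ℝ => (⟨u, v⟩ : ℂ)) 1 u := by
  have h1 : (fun u : ℝ => (⟨u, v⟩ : ℂ)) = fun u : ℝ => (u : ℂ) + v * Complex.I := by
    funext u; apply Complex.ext <;> simp
  rw [h1]
  exact Complex.ofRealCLM.hasDerivAt.add_const _

lemma hasDerivAt_add_ofReal_mul_I (u v : ℝ) :
    HasDerivAt (fun v : ℝ => (⟨u, v⟩ : ℂ)) Complex.I v := by
  have h1 : (fun v : ℝ => (⟨u, v⟩ : ℂ)) = fun v : ℝ => (u : ℂ) + v * Complex.I := by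
    funext v; apply Complex.ext <;> simp
  rw [h1]
  simpa using ((Complex.ofRealCLM.hasDerivAt (x := v)).mul_const Complex.I).const_add (u : ℂ)

/-- A function whose derivative is a multiple of the derivative of the first coordinate is a
function of the first coordinate. -/
lemma IsSquareChart.exists_eq_comp_re {ζ κ : ℂ → ℂ} {W : Set ℂ} {c : ℂ} {δ : ℝ}
    (h : IsSquareChart ζ κ W c δ) {H : Type*} [NormedAddCommGroup H] [NormedSpace ℝ H]
    {f f' : ℂ → H} (hf : ∀ w ∈ W, DifferentiableAt ℝ f w)
    (hf' : ∀ w ∈ W, ∀ z, fderiv ℝ f w z = (fderiv ℝ ζ w z).re • f' w) :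
    ∃ f₁ : ℝ → H, (∀ w ∈ W, f w = f₁ (ζ w).re ∧ HasDerivAt f₁ (f' w) (ζ w).re) ∧
      (ContDiffOn ℝ ∞ f W → ContDiffOn ℝ ∞ f₁ (Set.Ioo (c.re - δ) (c.re + δ))) := by
  have hop := isOpen_openSquare c δ
  have hder : ∀ x ∈ openSquare c δ, ∃ L : ℂ →L[ℝ] H, HasFDerivAt (fun x => f (κ x)) L x ∧
      ∀ z, L z = z.re • f' (κ x) := by
    intro x hx
    have hκ := ((h.smooth_symm.contDiffAt (hop.mem_nhds hx)).differentiableAt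
      (by simp)).hasFDerivAt
    have hW := h.mapsTo_symm x hx
    have hζ := ((h.smooth.contDiffAt (h.isOpen.mem_nhds hW)).differentiableAt
      (by simp)).hasFDerivAt
    refine ⟨_, (hf _ hW).hasFDerivAt.comp x hκ, fun z => ?_⟩
    have hid : HasFDerivAt (fun x => ζ (κ x)) (ContinuousLinearMap.id ℝ ℂ) x := by
      refine (hasFDerivAt_id x).congr_of_eventuallyEq ?_
      filter_upwards [hop.mem_nhds hx] with y hy using h.right_inv y hy
    have h1 := (hζ.comp x hκ).unique hid
    have h2 : fderiv ℝ ζ (κ x) (fderiv ℝ κ x z) = z := by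
      simpa using congrArg (fun L : ℂ →L[ℝ] ℂ => L z) h1
    rw [ContinuousLinearMap.comp_apply, hf' _ hW, h2]
  -- The derivative in v vanishes, so f ∘ κ equals its value on the middle line v = c.im.
  have hconst : ∀ u v, (⟨u, v⟩ : ℂ) ∈ openSquare c δ → f (κ ⟨u, v⟩) = f (κ ⟨u, c.im⟩) := by
    intro u v huv
    have hd : ∀ t ∈ Set.Ioo (c.im - δ) (c.im + δ),
        HasDerivAt (fun t : ℝ => f (κ ⟨u, t⟩)) 0 t := by
      intro t ht
      obtain ⟨L, hL, hL'⟩ := hder ⟨u, t⟩ ⟨huv.1, ht⟩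
      have := hL.comp_hasDerivAt t (hasDerivAt_add_ofReal_mul_I u t)
      rwa [hL', Complex.I_re, zero_smul] at this
    exact isOpen_Ioo.is_const_of_deriv_eq_zero isPreconnected_Ioo
      (fun t ht => (hd t ht).differentiableAt.differentiableWithinAt)
      (fun t ht => (hd t ht).deriv) huv.2 ⟨by linarith [h.pos], by linarith [h.pos]⟩
  refine ⟨fun u => f (κ ⟨u, c.im⟩), fun w hw => ⟨?_, ?_⟩, fun hfs => ?_⟩
  · have := hconst (ζ w).re (ζ w).im (h.mapsTo w hw)
    rw [Complex.eta, h.left_inv w hw] at this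
    exact this
  · have hsq := h.mapsTo w hw
    obtain ⟨L, hL, hL'⟩ := hder (ζ w) hsq
    have hL2 : HasFDerivAt (fun x => f (κ x)) L ⟨(ζ w).re, (ζ w).im⟩ := hL
    have h1 := hL2.comp_hasDerivAt (ζ w).re (hasDerivAt_ofReal_add (ζ w).im (ζ w).re)
    rw [hL', Complex.one_re, one_smul, h.left_inv w hw] at h1
    refine h1.congr_of_eventuallyEq ?_
    filter_upwards [isOpen_Ioo.mem_nhds hsq.1] with u hu
    exact (hconst u (ζ w).im ⟨hu, hsq.2⟩).symm
  · have h1 : ContDiff ℝ ∞ fun u : ℝ => (⟨u, c.im⟩ : ℂ) := by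
      have : (fun u : ℝ => (⟨u, c.im⟩ : ℂ)) = fun u : ℝ => (u : ℂ) + c.im * Complex.I := by
        funext u; apply Complex.ext <;> simp
      rw [this]
      exact Complex.ofRealCLM.contDiff.add contDiff_const
    have hmem : ∀ u ∈ Set.Ioo (c.re - δ) (c.re + δ), (⟨u, c.im⟩ : ℂ) ∈ openSquare c δ :=
      fun u hu => ⟨hu, by simp only; linarith [h.pos], by simp only; linarith [h.pos]⟩
    exact hfs.comp (h.smooth_symm.comp h1.contDiffOn hmem) fun u hu => h.mapsTo_symm _ (hmem u hu)

/-! ### Local representation as a surface of revolution -/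

lemma differentiableAt_cylVec {p r : ℝ → ℝ} {w : ℂ} (hp : DifferentiableAt ℝ p w.re)
    (hr : DifferentiableAt ℝ r w.re) :
    DifferentiableAt ℝ (fun w : ℂ => cylVec (p w.re) 0 (r w.re) w.im) w := by
  have hre : DifferentiableAt ℝ (fun w : ℂ => w.re) w := Complex.reCLM.differentiableAt
  have him : DifferentiableAt ℝ (fun w : ℂ => w.im) w := Complex.imCLM.differentiableAt
  have hp1 : DifferentiableAt ℝ (fun w : ℂ => p w.re) w := hp.comp w hre
  have hr1 : DifferentiableAt ℝ (fun w : ℂ => r w.re) w := hr.comp w hre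
  rw [differentiableAt_euclidean]
  intro i
  fin_cases i
  · simpa using hp1.fun_mul him.cos
  · simpa using hp1.fun_mul him.sin
  · simpa using hr1

lemma fderiv_cylVec_comp {p r : ℝ → ℝ} {p' r' : ℝ} {ζ : ℂ → ℂ} {w : ℂ}
    (hp : HasDerivAt p p' (ζ w).re) (hr : HasDerivAt r r' (ζ w).re)
    (hζ : DifferentiableAt ℝ ζ w) (z : ℂ) :
    DifferentiableAt ℝ (fun w => cylVec (p (ζ w).re) 0 (r (ζ w).re) (ζ w).im) w ∧
    fderiv ℝ (fun w => cylVec (p (ζ w).re) 0 (r (ζ w).re) (ζ w).im) w z =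
      (fderiv ℝ ζ w z).re • cylVec p' 0 r' (ζ w).im +
        (fderiv ℝ ζ w z).im • cylVec 0 (p (ζ w).re) 0 (ζ w).im := by
  have hd := differentiableAt_cylVec (w := ζ w) hp.differentiableAt hr.differentiableAt
  have h1 := hd.hasFDerivAt.comp w hζ.hasFDerivAt
  refine ⟨h1.differentiableAt, ?_⟩
  have h2 := fderiv_cylVec (c := 0) hp (hasDerivAt_const _ (0 : ℝ)) hr (fderiv ℝ ζ w z)
  simp only [zero_add, neg_zero] at h2
  rw [← h2]
  exact congrArg (fun L : ℂ →L[ℝ] E3 => L z) h1.fderiv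

/-- If β ≠ 0, the angles have the same sine and cosine, so cos(v' - v) = 1, impossible for 0 < v' -
v ≤ 1. -/
lemma eq_zero_of_cylVec_eq {β v v' : ℝ} (h : cylVec β 0 0 v = cylVec β 0 0 v')
    (h0 : 0 < v' - v) (h1 : v' - v ≤ 1) : β = 0 := by
  have e0 := congrArg (fun x : E3 => x 0) h
  have e1 := congrArg (fun x : E3 => x 1) h
  simp at e0 e1
  by_contra hβ
  have c0 : Real.cos v = Real.cos v' := by tauto
  have c1 : Real.sin v = Real.sin v' := by tauto
  have hcos : Real.cos (v' - v) = 1 := by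
    rw [Real.cos_sub, c0, c1]
    linear_combination Real.sin_sq_add_cos_sq v'
  rw [Real.cos_eq_one_iff_of_lt_of_lt (by linarith [Real.pi_gt_three])
    (by linarith [Real.pi_gt_three])] at hcos
  exact h0.ne' hcos

namespace IsPolarChart

variable {k ε : ℝ} {B : Set ℂ} {Y : ℂ → E3} {m : ℂ → ℝ} {F : ℂ → ℂ} {w : ℂ}

/-- The derivative of the conformal parameter `u + iν`. -/
lemma fderiv_param (h : IsPolarChart k ε B Y m F) (hw : w ∈ B) (z : ℂ) :
    fderiv ℝ (fun x => paramMap ε (F x)) w z = paramMap ε (deriv F w * z) := by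
  have h1 := (paramMap ε).hasFDerivAt.comp w (h.hasFDerivAt_F hw)
  have h2 : fderiv ℝ (fun x => paramMap ε (F x)) w = _ := h1.fderiv
  rw [h2]; simp [mul_comm]

/-- The derivative of the modulus with respect to `u`. -/
lemma exists_fderiv_m (h : IsPolarChart k ε B Y m F) (hk : k ≠ 0) (hw : w ∈ B)
    (h0 : deriv F w ≠ 0) :
    ∃ m₁ : ℝ, ∀ z, fderiv ℝ m w z = (ε * (deriv F w * z).im) * m₁ := by
  have hwd := h.wedge hk hw
  have hε := h.eps_mul_self
  set f := deriv F w
  have hf : f.re ^ 2 + f.im ^ 2 ≠ 0 := by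
    intro hz
    apply h0
    apply Complex.ext <;> simp <;> nlinarith [sq_nonneg f.re, sq_nonneg f.im]
  -- The coefficient is ⟨dm, dU⟩/|dU|².
  refine ⟨ε * (fderiv ℝ m w 1 * f.im + fderiv ℝ m w Complex.I * f.re) / (f.re ^ 2 + f.im ^ 2),
    fun z => ?_⟩
  have h3 : z = z.re • (1 : ℂ) + z.im • Complex.I := by simp
  have h4 : fderiv ℝ m w z = z.re * fderiv ℝ m w 1 + z.im * fderiv ℝ m w Complex.I := by
    conv_lhs => rw [h3]
    rw [map_add, map_smul, map_smul, smul_eq_mul, smul_eq_mul]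
  rw [h4, Complex.mul_im]
  field_simp
  linear_combination (z.re * f.re - z.im * f.im) * hwd - (f.re * z.im + f.im * z.re) *
    (fderiv ℝ m w 1 * f.im + fderiv ℝ m w Complex.I * f.re) * hε

/-- With dm = m₁ dU every component has the factor m₁ - m; the radial and vertical ones are
multiples of dU, the angular one of dν. -/
lemma fderiv_eq_of_fderiv_m (h : IsPolarChart k ε B Y m F) (hw : w ∈ B) {m₁ : ℝ}
    (hm₁ : ∀ z, fderiv ℝ m w z = (ε * (deriv F w * z).im) * m₁) (z : ℂ) :
    fderiv ℝ Y w z = weightRecip k (Y w 2) • cylVec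
      (-(2 / (1 + m w ^ 2) * (m₁ - m w)) * (ε * (deriv F w * z).im))
      (2 / (1 - m w ^ 2) * (m₁ - m w) * (deriv F w * z).re)
      (4 * m w / (1 - m w ^ 4) * (m₁ - m w) * (ε * (deriv F w * z).im)) (F w).re := by
  rw [h.fderiv_eq hw z, hm₁, hm₁]
  have hI : (deriv F w * (Complex.I * z)).im = (deriv F w * z).re := by
    simp; ring
  rw [hI]
  have hε := h.eps_mul_self
  congr 2
  · ring
  · linear_combination (2 / (1 - m w ^ 2) * m₁ * (deriv F w * z).re) * hε
  · ring

/-- Away from critical points of the argument, the surface is locally a surface of revolution. -/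
theorem exists_local_representation (h : IsPolarChart k ε B Y m F) (hk : k ≠ 0) {w₀ : ℂ}
    (hw₀ : w₀ ∈ B) (h0 : deriv F w₀ ≠ 0) :
    ∃ (W : Set ℂ) (a b : ℝ) (J : Set ℝ) (M Φ Q : ℝ → ℝ) (σ : ℝ), IsOpen W ∧ w₀ ∈ W ∧ W ⊆ B ∧
      (∀ w ∈ W, deriv F w ≠ 0) ∧ Set.InjOn (fun w => paramMap ε (F w)) W ∧
      (σ = 1 ∨ σ = -1) ∧
      IsSolutionOn (modulusField k σ) modulusDomain J (fun u => (M u, Φ u, Q u)) ∧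
      ∀ w ∈ W, paramMap ε (F w) ∈ strip J ∧ m w = M (paramMap ε (F w)).re ∧
        Y w = revolution a b (profileRadius k M Q) (profileHeight k M Q) (paramMap ε (F w)) := by
  obtain ⟨κ, W, δ, hwW, hWB, hWne, hS⟩ := h.exists_isSquareChart hw₀ h0
  set ζ : ℂ → ℂ := fun x => paramMap ε (F x) with hζ
  set c := ζ w₀ with hc
  set J := Set.Ioo (c.re - δ) (c.re + δ) with hJ
  have hJo : IsOpen J := isOpen_Ioo
  have hJsurj : ∀ u ∈ J, ∀ v ∈ Set.Ioo (c.im - δ) (c.im + δ), ∃ w ∈ W, (ζ w).re = u ∧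
      (ζ w).im = v := by
    intro u hu v hv
    have hsq : (⟨u, v⟩ : ℂ) ∈ openSquare c δ := ⟨hu, hv⟩
    have h1 : ζ (κ ⟨u, v⟩) = ⟨u, v⟩ := hS.right_inv _ hsq
    exact ⟨κ ⟨u, v⟩, hS.mapsTo_symm _ hsq, by rw [h1], by rw [h1]⟩
  have hcim : c.im ∈ Set.Ioo (c.im - δ) (c.im + δ) := ⟨by linarith [hS.pos], by linarith [hS.pos]⟩
  have hJW : ∀ u ∈ J, ∃ w ∈ W, (ζ w).re = u := by
    intro u hu
    obtain ⟨w, hw, h1, -⟩ := hJsurj u hu c.im hcim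
    exact ⟨w, hw, h1⟩
  have hζd : ∀ w ∈ W, ∀ z, fderiv ℝ ζ w z = paramMap ε (deriv F w * z) :=
    fun w hw z => h.fderiv_param (hWB hw) z
  have hζim : ∀ w, (ζ w).im = (F w).re := fun w => paramMap_im ε (F w)
  -- the modulus is a function `M` of `u`
  have hex : ∀ w : ℂ, ∃ m₁ : ℝ, w ∈ W → ∀ z, fderiv ℝ m w z = (ε * (deriv F w * z).im) * m₁ := by
    intro w
    by_cases hw : w ∈ W
    · obtain ⟨m₁, hm₁⟩ := h.exists_fderiv_m hk (hWB hw) (hWne w hw)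
      exact ⟨m₁, fun _ => hm₁⟩
    · exact ⟨0, fun h => absurd h hw⟩
  choose m₁ hm₁ using hex
  obtain ⟨M, hM, hMs⟩ := hS.exists_eq_comp_re (f := m) (f' := m₁)
    (fun w hw => (h.hasFDerivAt_m (hWB hw)).differentiableAt) (by
      intro w hw z
      rw [hm₁ w hw, hζd w hw, paramMap_re, smul_eq_mul])
  replace hMs := hMs (h.smooth_m.mono hWB)
  have hMr : ∀ u ∈ J, 0 < M u ∧ M u < 1 := by
    intro u hu
    obtain ⟨w, hw, rfl⟩ := hJW u hu
    rw [← (hM w hw).1]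
    exact h.range w (hWB hw)
  have hMd : ∀ w ∈ W, deriv M (ζ w).re = m₁ w := fun w hw => (hM w hw).2.deriv
  have hMder : ∀ u ∈ J, HasDerivAt M (deriv M u) u := fun u hu =>
    ((hMs.contDiffAt (hJo.mem_nhds hu)).differentiableAt (by simp)).hasDerivAt
  have hM'der : ∀ u ∈ J, HasDerivAt (deriv M) (deriv (deriv M) u) u := fun u hu =>
    ((((contDiffOn_infty_iff_deriv_of_isOpen hJo).1 hMs).2.contDiffAt
      (hJo.mem_nhds hu)).differentiableAt (by simp)).hasDerivAt
  have hYd : ∀ w ∈ W, DifferentiableAt ℝ Y w := fun w hw =>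
    (h.smooth.contDiffAt (h.isOpen.mem_nhds (hWB hw))).differentiableAt (by simp)
  -- the height is a function `Z` of `u`
  obtain ⟨Z, hZ, -⟩ := hS.exists_eq_comp_re (f := fun w => Y w 2)
    (f' := fun w => weightRecip k (Y w 2) * (4 * m w / (1 - m w ^ 4) * (m₁ w - m w)))
    (fun w hw => differentiableAt_euclidean.1 (hYd w hw) 2) (by
      intro w hw z
      have h1 : HasFDerivAt (fun w => Y w 2)
          ((EuclideanSpace.proj (𝕜 := ℝ) (2 : Fin 3)).comp (fderiv ℝ Y w)) w :=
        ((EuclideanSpace.proj (𝕜 := ℝ) (2 : Fin 3) : E3 →L[ℝ] ℝ).hasFDerivAt).comp w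
          (hYd w hw).hasFDerivAt
      rw [h1.fderiv, hζd w hw, paramMap_re, ContinuousLinearMap.comp_apply,
        h.fderiv_eq_of_fderiv_m (hWB hw) (hm₁ w hw)]
      simp
      ring)
  have hZpos : ∀ u ∈ J, k ≠ 1 → 0 < Z u := by
    intro u hu
    obtain ⟨w, hw, rfl⟩ := hJW u hu
    rw [← (hZ w hw).1]
    exact h.pos w (hWB hw)
  have hZder : ∀ u ∈ J, HasDerivAt Z
      (weightRecip k (Z u) * (4 * M u / (1 - M u ^ 4) * (deriv M u - M u))) u := by
    intro u hu
    obtain ⟨w, hw, rfl⟩ := hJW u hu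
    rw [← (hZ w hw).1, ← (hM w hw).1, hMd w hw]
    exact (hZ w hw).2
  -- the distance to the axis
  set ρ : ℝ → ℝ := fun u => 2 * weightRecip k (Z u) * ((deriv M u - M u) / (1 - M u ^ 2)) with hρ
  have hρder : ∀ u ∈ J, HasDerivAt ρ
      (2 * ((k - 1) / 2 * (weightRecip k (Z u) * (4 * M u / (1 - M u ^ 4) * (deriv M u - M u)))) *
        ((deriv M u - M u) / (1 - M u ^ 2)) + 2 * weightRecip k (Z u) *
        (((deriv (deriv M) u - deriv M u) * (1 - M u ^ 2) - (deriv M u - M u) *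
          (-(2 * M u * deriv M u))) / (1 - M u ^ 2) ^ 2)) u := by
    intro u hu
    have h3 := one_sub_sq_pos (hMr u hu)
    refine (((((hasDerivAt_weightRecip k _).comp u (hZder u hu)).const_mul 2).mul
      (((hM'der u hu).sub (hMder u hu)).div (((hMder u hu).pow 2).const_sub 1)
        h3.ne'))).congr_deriv ?_
    simp
  -- The defect between the radial component of dY and ρ'.
  set β : ℝ → ℝ := fun u => -(2 / (1 + M u ^ 2) * (deriv M u - M u)) * weightRecip k (Z u) -
    deriv ρ u with hβ
  -- Angular and vertical parts cancel in the difference to the surface of revolution, leaving β(u)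
  -- du in the radial direction.
  obtain ⟨L, hL, -⟩ := hS.exists_eq_comp_re
    (f := fun w => Y w - cylVec (ρ (ζ w).re) 0 (Z (ζ w).re) (ζ w).im)
    (f' := fun w => cylVec (β (ζ w).re) 0 0 (ζ w).im)
    (fun w hw => by
      have hu := (hS.mapsTo w hw).1
      exact (hYd w hw).sub (fderiv_cylVec_comp (hρder _ hu) (hZder _ hu)
        ((hS.smooth.contDiffAt (hS.isOpen.mem_nhds hw)).differentiableAt (by simp)) 1).1)
    (by
      intro w hw z
      have hu := (hS.mapsTo w hw).1
      obtain ⟨hd, hd'⟩ := fderiv_cylVec_comp (hρder _ hu).differentiableAt.hasDerivAt (hZder _ hu)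
        ((hS.smooth.contDiffAt (hS.isOpen.mem_nhds hw)).differentiableAt (by simp)) z
      rw [fderiv_fun_sub (hYd w hw) hd, sub_apply, hd', hζd w hw,
        h.fderiv_eq_of_fderiv_m (hWB hw) (hm₁ w hw)]
      simp only [paramMap_re, paramMap_im, hβ, hρ, ← (hZ w hw).1, ← (hM w hw).1, hMd w hw, hζim]
      refine E3_ext ?_ ?_ ?_ <;> simp <;> ring)
  -- L'(u) is radial of length |β(u)| at two different angles.
  have hβ0 : ∀ u ∈ J, β u = 0 := by
    intro u hu
    obtain ⟨w, hw, hwu, hwv⟩ := hJsurj u hu c.im hcim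
    obtain ⟨w', hw', hwu', hwv'⟩ := hJsurj u hu (c.im + δ / 2)
      ⟨by linarith [hS.pos], by linarith [hS.pos]⟩
    have h1 := (hL w hw).2
    have h2 := (hL w' hw').2
    rw [hwu, hwv] at h1
    rw [hwu', hwv'] at h2
    exact eq_zero_of_cylVec_eq (h1.unique h2) (by linarith [hS.pos])
      (by linarith [hS.pos, hS.le_one])
  have hLder : ∀ u ∈ J, HasDerivAt L 0 u := by
    intro u hu
    obtain ⟨w, hw, rfl⟩ := hJW u hu
    have h1 := (hL w hw).2
    rw [hβ0 _ hu] at h1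
    refine h1.congr_deriv ?_
    refine E3_ext ?_ ?_ ?_ <;> simp
  have hcre : c.re ∈ J := ⟨by linarith [hS.pos], by linarith [hS.pos]⟩
  have hLconst : ∀ u ∈ J, L u = L c.re := fun u hu =>
    hJo.is_const_of_deriv_eq_zero isPreconnected_Ioo
      (fun u hu => (hLder u hu).differentiableAt.differentiableWithinAt)
      (fun u hu => (hLder u hu).deriv) hu hcre
  have hY : ∀ w ∈ W, Y w = L c.re + cylVec (ρ (ζ w).re) 0 (Z (ζ w).re) (ζ w).im := by
    intro w hw
    rw [← hLconst _ (hS.mapsTo w hw).1, ← (hL w hw).1]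
    simp
  have hL2 : L c.re 2 = 0 := by
    have h1 := congrArg (fun x : E3 => x 2) (hY w₀ hwW)
    simp only [PiLp.add_apply, cylVec_two] at h1
    rw [(hZ w₀ hwW).1] at h1
    linarith
  -- the equation of the modulus
  have hMne : ∀ u ∈ J, deriv M u - M u ≠ 0 := by
    intro u hu hcon
    obtain ⟨w, hw, rfl⟩ := hJW u hu
    rw [hMd w hw, ← (hM w hw).1] at hcon
    have h1 := h.fderiv_eq_of_fderiv_m (hWB hw) (hm₁ w hw) 1
    rw [hcon] at h1
    refine one_ne_zero (h.injective w (hWB hw) 1 (h1.trans ?_))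
    refine E3_ext ?_ ?_ ?_ <;> simp
  -- M' - M has no zeros on the interval, hence a constant sign; σ is the opposite sign.
  obtain ⟨σ, hσ, hσM⟩ : ∃ σ : ℝ, (σ = 1 ∨ σ = -1) ∧
      ∀ u ∈ J, deriv M u - M u = -σ * |deriv M u - M u| := by
    have hcont : ContinuousOn (fun x : ℂ => deriv M x.re - M x.re) (strip J) := by
      have h1 : ContinuousOn (fun u => deriv M u - M u) J := fun u hu =>
        ((hM'der u hu).continuousAt.sub (hMder u hu).continuousAt).continuousWithinAt
      exact h1.comp Complex.continuous_re.continuousOn fun x hx => hx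
    have hpre : IsPreconnected (strip J) :=
      ((convex_Ioo _ _).linear_preimage Complex.reLm).isPreconnected
    have hin : ∀ u ∈ J, ((u : ℝ) : ℂ) ∈ strip J := fun u hu => by simpa [strip] using hu
    rcases pos_or_neg_of_continuousOn hpre hcont (fun x hx => hMne _ hx) with hp | hp
    · refine ⟨-1, Or.inr rfl, fun u hu => ?_⟩
      have := hp u (hin u hu)
      rw [Complex.ofReal_re] at this
      rw [abs_of_pos this]; ring
    · refine ⟨1, Or.inl rfl, fun u hu => ?_⟩
      have := hp u (hin u hu)
      rw [Complex.ofReal_re] at this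
      rw [abs_of_neg this]; ring
  -- Φ is the equation of the modulus solved for Φ, the logarithm being that of |M' - M|. In the
  -- next line Q is the formula for the height solved for Q.
  set Φ : ℝ → ℝ := fun u => logSpeed k (M u) - Real.log (deriv M u - M u) with hΦ
  set Q : ℝ → ℝ := fun u => (logModulus (M u) - weightOf k (Z u)) / 4 with hQ
  have hτ : ∀ u ∈ J, weightRecip k (Z u) ≠ 0 := fun u hu => weightRecip_ne_zero (hZpos u hu)
  have hode : SolvesModulusODE k σ J M Φ := by
    refine ⟨hMs, hMr, fun u hu => ?_, fun u hu => ?_⟩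
    · have h3 := one_sub_sq_pos (hMr u hu)
      have h5 : 0 < 1 + M u ^ 2 := by positivity
      have h4 : 1 - M u ^ 4 = (1 - M u ^ 2) * (1 + M u ^ 2) := by ring
      have hτu := hτ u hu
      have hne := hMne u hu
      -- The condition β = 0 as a second order equation for M.
      have hM2 : deriv (deriv M) u - deriv M u = -(deriv M u - M u) * ((1 - M u ^ 2) /
          (1 + M u ^ 2)) - 2 * (k - 1) * M u * (deriv M u - M u) ^ 2 / (1 - M u ^ 4) -
          2 * M u * deriv M u * (deriv M u - M u) / (1 - M u ^ 2) := by
        have h6 := hβ0 u hu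
        simp only [hβ] at h6
        rw [(hρder u hu).deriv, h4] at h6
        rw [h4]
        field_simp at h6 ⊢
        apply mul_left_cancel₀ (mul_ne_zero two_ne_zero hτu)
        linear_combination -h6
      refine (((hasDerivAt_logSpeed k (hMr u hu)).comp u (hMder u hu)).sub
        (((hM'der u hu).sub (hMder u hu)).log hne)).congr_deriv ?_
      simp only [Pi.sub_apply]
      rw [hM2, h4]
      field_simp
      ring
    · rw [ode_iff (hMr u hu)]
      simp only [hΦ]
      rw [sub_sub_cancel, Real.exp_log_eq_abs (hMne u hu)]
      linear_combination hσM u hu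
  have hQder : ∀ u ∈ J, HasDerivAt Q (M u ^ 2 / (1 - M u ^ 4)) u := by
    intro u hu
    have h3 := one_sub_pow_four_pos (hMr u hu)
    have hτu := hτ u hu
    refine ((((hasDerivAt_logModulus (hMr u hu)).comp u (hMder u hu)).sub
      ((hasDerivAt_weightOf hk (hZpos u hu)).comp u (hZder u hu))).div_const 4).congr_deriv ?_
    field_simp
    ring
  have hheight : ∀ u ∈ J, profileHeight k M Q u = Z u := by
    intro u hu
    rw [profileHeight_eq (hMr u hu)]
    simp only [hQ]
    rw [mul_div_cancel₀ _ (four_ne_zero' ℝ), sub_sub_cancel]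
    exact heightOf_weightOf hk (hZpos u hu)
  have hradius : ∀ u ∈ J, profileRadius k M Q u = ρ u := by
    intro u hu
    rw [profileRadius_eq, hheight u hu]
  refine ⟨W, L c.re 0, L c.re 1, J, M, Φ, Q, σ, hS.isOpen, hwW, hWB, hWne, ?_, hσ,
    isSolutionOn_iff.2 ⟨hJo, Set.ordConnected_Ioo, hode, hQder⟩, fun w hw => ?_⟩
  · intro x hx y hy hxy
    rw [← hS.left_inv x hx, ← hS.left_inv y hy]
    exact congrArg κ hxy
  · have hu := (hS.mapsTo w hw).1
    refine ⟨hu, (hM w hw).1, ?_⟩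
    rw [revolution_eq, hY w hw]
    change _ = _ + cylVec (profileRadius k M Q (ζ w).re) 0 (profileHeight k M Q (ζ w).re) (ζ w).im
    rw [hheight _ hu, hradius _ hu]
    congr 1
    exact E3_ext rfl rfl hL2

end IsPolarChart

/-! ### Comparison of two representations -/

/-- Two representations of the same surface as a surface of revolution agree up to the choice of
the origin of the parameter `u`. -/
lemma representation_unique {k : ℝ} (hk : k ≠ 0) {ζ₁ ζ₂ : ℂ → ℂ} {x : ℂ} {J₁ J₂ : Set ℝ}
    {m₁ Φ₁ Q₁ m₂ Φ₂ Q₂ : ℝ → ℝ} {a₁ b₁ σ₁ a₂ b₂ σ₂ : ℝ}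
    (h₁ : IsSolutionOn (modulusField k σ₁) modulusDomain J₁ (fun u => (m₁ u, Φ₁ u, Q₁ u)))
    (h₂ : IsSolutionOn (modulusField k σ₂) modulusDomain J₂ (fun u => (m₂ u, Φ₂ u, Q₂ u)))
    (hσ₁ : σ₁ = 1 ∨ σ₁ = -1) (hσ₂ : σ₂ = 1 ∨ σ₂ = -1)
    (hd₁ : DifferentiableAt ℝ ζ₁ x) (hd₂ : DifferentiableAt ℝ ζ₂ x)
    (hne : ∃ z, (fderiv ℝ ζ₂ x z).re ≠ 0)
    (hJ₁ : ∀ᶠ y in nhds x, ζ₁ y ∈ strip J₁) (hJ₂ : ∀ᶠ y in nhds x, ζ₂ y ∈ strip J₂)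
    (hG : ∀ᶠ y in nhds x, (m₁ (ζ₁ y).re : ℂ) * Complex.exp (Complex.I * (ζ₁ y).im) =
      m₂ (ζ₂ y).re * Complex.exp (Complex.I * (ζ₂ y).im))
    (hX : ∀ᶠ y in nhds x,
      revolution a₁ b₁ (profileRadius k m₁ Q₁) (profileHeight k m₁ Q₁) (ζ₁ y) =
      revolution a₂ b₂ (profileRadius k m₂ Q₂) (profileHeight k m₂ Q₂) (ζ₂ y)) :
    σ₁ = σ₂ ∧ a₁ = a₂ ∧ b₁ = b₂ ∧ m₁ (ζ₁ x).re = m₂ (ζ₂ x).re ∧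
      Φ₁ (ζ₁ x).re = Φ₂ (ζ₂ x).re ∧ Q₁ (ζ₁ x).re = Q₂ (ζ₂ x).re := by
  obtain ⟨hJo₁, -, hm₁, hQ₁⟩ := isSolutionOn_iff.1 h₁
  obtain ⟨hJo₂, -, hm₂, hQ₂⟩ := isSolutionOn_iff.1 h₂
  have hmm : ∀ᶠ y in nhds x, m₁ (ζ₁ y).re = m₂ (ζ₂ y).re := by
    filter_upwards [hG, hJ₁, hJ₂] with y hy h1 h2
    have := congrArg norm hy
    simp only [norm_mul, Complex.norm_real, mul_comm Complex.I, Complex.norm_exp_ofReal_mul_I,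
      mul_one, Real.norm_eq_abs] at this
    rwa [abs_of_pos (hm₁.range _ h1).1, abs_of_pos (hm₂.range _ h2).1] at this
  -- The height and the modulus determine Q.
  have hQQ : ∀ᶠ y in nhds x, Q₁ (ζ₁ y).re = Q₂ (ζ₂ y).re := by
    filter_upwards [hX, hmm, hJ₁, hJ₂] with y hy hmy h1 h2
    have h3 : profileHeight k m₁ Q₁ (ζ₁ y).re = profileHeight k m₂ Q₂ (ζ₂ y).re :=
      congrArg (fun v : E3 => v 2) hy
    rw [profileHeight_eq (hm₁.range _ h1), profileHeight_eq (hm₂.range _ h2), hmy] at h3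
    have := heightOf_injective hk h3
    linarith
  have hu₁ : HasFDerivAt (fun y => (ζ₁ y).re) (Complex.reCLM.comp (fderiv ℝ ζ₁ x)) x :=
    Complex.reCLM.hasFDerivAt.comp x hd₁.hasFDerivAt
  have hu₂ : HasFDerivAt (fun y => (ζ₂ y).re) (Complex.reCLM.comp (fderiv ℝ ζ₂ x)) x :=
    Complex.reCLM.hasFDerivAt.comp x hd₂.hasFDerivAt
  have hx₁ : (ζ₁ x).re ∈ J₁ := hJ₁.self_of_nhds
  have hx₂ : (ζ₂ x).re ∈ J₂ := hJ₂.self_of_nhds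
  have hmx := hmm.self_of_nhds
  have hQx := hQQ.self_of_nhds
  -- Differentiating Q gives du₁ = du₂, as m²/(1-m⁴) ≠ 0; differentiating m then gives m₁' = m₂', as
  -- du₂ ≠ 0.
  have hdQ := ((hQ₁ _ hx₁).comp_hasFDerivAt x hu₁).unique
    (((hQ₂ _ hx₂).comp_hasFDerivAt x hu₂).congr_of_eventuallyEq hQQ)
  have hdm := ((hm₁.hasDerivAt hJo₁ hx₁).comp_hasFDerivAt x hu₁).unique
    (((hm₂.hasDerivAt hJo₂ hx₂).comp_hasFDerivAt x hu₂).congr_of_eventuallyEq hmm)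
  obtain ⟨z, hz⟩ := hne
  have e1 := congrArg (fun L : ℂ →L[ℝ] ℝ => L z) hdQ
  have e2 := congrArg (fun L : ℂ →L[ℝ] ℝ => L z) hdm
  simp only [smul_apply, ContinuousLinearMap.comp_apply, Complex.reCLM_apply, smul_eq_mul,
    hmx] at e1 e2
  have hr := hm₂.range _ hx₂
  have h4 := one_sub_pow_four_pos hr
  have h5 : m₂ (ζ₂ x).re ^ 2 / (1 - m₂ (ζ₂ x).re ^ 4) ≠ 0 :=
    (div_pos (pow_pos hr.1 2) h4).ne'
  have e3 := mul_left_cancel₀ h5 e1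
  rw [e3] at e2
  have e4 := mul_right_cancel₀ hz e2
  have e5 := hm₁.deriv_eq hx₁
  have e6 := hm₂.deriv_eq hx₂
  rw [e4, e6, hmx] at e5
  -- The equation of the modulus recovers σ from the sign and Φ from the size of m' - m.
  have e7 : σ₂ * Real.exp (logSpeed k (m₂ (ζ₂ x).re) - Φ₂ (ζ₂ x).re) =
    σ₁ * Real.exp (logSpeed k (m₂ (ζ₂ x).re) - Φ₁ (ζ₁ x).re) := by linarith
  have hσ : σ₁ = σ₂ := by
    have p1 := Real.exp_pos (logSpeed k (m₂ (ζ₂ x).re) - Φ₂ (ζ₂ x).re)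
    have p2 := Real.exp_pos (logSpeed k (m₂ (ζ₂ x).re) - Φ₁ (ζ₁ x).re)
    rcases hσ₁ with h | h <;> rcases hσ₂ with h' | h' <;> rw [h, h'] at e7 ⊢ <;> linarith
  have hσ0 : σ₂ ≠ 0 := by rcases hσ₂ with h | h <;> rw [h] <;> norm_num
  rw [hσ] at e7
  have e8 := Real.exp_injective (mul_left_cancel₀ hσ0 e7)
  have hΦ : Φ₁ (ζ₁ x).re = Φ₂ (ζ₂ x).re := by linarith
  have hXx := hX.self_of_nhds
  have hh : profileHeight k m₁ Q₁ (ζ₁ x).re = profileHeight k m₂ Q₂ (ζ₂ x).re :=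
    congrArg (fun v : E3 => v 2) hXx
  have hρ : profileRadius k m₁ Q₁ (ζ₁ x).re = profileRadius k m₂ Q₂ (ζ₂ x).re := by
    rw [profileRadius_eq, profileRadius_eq, hh, e4, hmx]
  have hexp := hG.self_of_nhds
  rw [hmx] at hexp
  have hexp' := mul_left_cancel₀ (Complex.ofReal_ne_zero.2 hr.1.ne') hexp
  rw [mul_comm Complex.I, mul_comm Complex.I, Complex.exp_mul_I, Complex.exp_mul_I,
    ← Complex.ofReal_cos, ← Complex.ofReal_sin, ← Complex.ofReal_cos, ← Complex.ofReal_sin] at hexp'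
  have hcos : Real.cos (ζ₁ x).im = Real.cos (ζ₂ x).im := by
    simpa [-Complex.ofReal_cos, -Complex.ofReal_sin] using congrArg Complex.re hexp'
  have hsin : Real.sin (ζ₁ x).im = Real.sin (ζ₂ x).im := by
    simpa [-Complex.ofReal_cos, -Complex.ofReal_sin] using congrArg Complex.im hexp'
  have ha := congrArg (fun v : E3 => v 0) hXx
  have hb := congrArg (fun v : E3 => v 1) hXx
  simp [revolution, hρ, hcos, hsin] at ha hb
  exact ⟨hσ, ha, hb, hmx, hΦ, hQx⟩

/-- The surface of revolution depends only on the integral curve, up to translations of the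
parameter. -/
lemma revolution_add_eq {k σ a b : ℝ} {J J' : Set ℝ} {m Φ Q m' Φ' Q' : ℝ → ℝ}
    (h : IsSolutionOn (modulusField k σ) modulusDomain J (fun u => (m u, Φ u, Q u)))
    (h' : IsSolutionOn (modulusField k σ) modulusDomain J' (fun u => (m' u, Φ' u, Q' u)))
    {x y : ℂ} (hy : y ∈ strip J) (hx : x ∈ strip J') (him : y.im = x.im)
    (hm : m y.re = m' x.re) (hΦ : Φ y.re = Φ' x.re) (hQ : Q y.re = Q' x.re) :
    revolution a b (profileRadius k m Q) (profileHeight k m Q) y =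
      revolution a b (profileRadius k m' Q') (profileHeight k m' Q') x := by
  obtain ⟨-, -, hs, -⟩ := isSolutionOn_iff.1 h
  obtain ⟨-, -, hs', -⟩ := isSolutionOn_iff.1 h'
  have hd : deriv m y.re = deriv m' x.re := by
    rw [hs.deriv_eq hy, hs'.deriv_eq hx, hm, hΦ]
  have hh : profileHeight k m Q y.re = profileHeight k m' Q' x.re := by
    rw [profileHeight_eq (hs.range _ hy), profileHeight_eq (hs'.range _ hx), hm, hQ]
  have hρ : profileRadius k m Q y.re = profileRadius k m' Q' x.re := by
    rw [profileRadius_eq, profileRadius_eq, hh, hd, hm]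
  simp only [revolution, hh, hρ, him]

/-! ### Charts of the Riemann surface -/

lemma InClassOn.mono {k : ℝ} {U V : Set ℂ} {X : ℂ → E3} (h : InClassOn k V X) (hUV : U ⊆ V) :
    InClassOn k U X := by
  have key : ∀ {φ : E3 → ℝ} {Ω : Set E3}, IsWeightedMinimalOn φ Ω V X →
      IsWeightedMinimalOn φ Ω U X := fun h =>
    ⟨h.smooth.mono hUV, fun w hw => h.immersion w (hUV hw), h.mapsTo.mono_left hUV,
      fun w hw => h.euler_lagrange w (hUV hw)⟩
  exact ⟨fun hk => key (h.1 hk), fun hk => key (h.2 hk)⟩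

variable {S : Type*} [TopologicalSpace S] [ChartedSpace ℂ S]

/-- Near every point the surface is described by a holomorphic function whose real part is the
argument of the Gauss map. -/
lemma exists_isPolarChart {k : ℝ} {ψ N : S → E3} {G : S → ℂ}
    (hψ : IsConformalInClass k ψ) (hN : IsUnitNormal ψ N)
    (hG : ∀ p, G p = stereoSouth (N p)) (hm : ∀ p, 0 < ‖G p‖ ∧ ‖G p‖ < 1)
    (hν : HasHarmonicArgument G) (p : S) :
    ∃ (R ε : ℝ) (F : ℂ → ℂ), 0 < R ∧ Metric.ball (chartAt ℂ p p) R ⊆ (chartAt ℂ p).target ∧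
      IsPolarChart k ε (Metric.ball (chartAt ℂ p p) R) (ψ ∘ (chartAt ℂ p).symm)
        (fun w => ‖G ((chartAt ℂ p).symm w)‖) F ∧
      ∀ w ∈ Metric.ball (chartAt ℂ p p) R, G ((chartAt ℂ p).symm w) =
        ‖G ((chartAt ℂ p).symm w)‖ * Complex.exp (Complex.I * (F w).re) := by
  set e := chartAt ℂ p with he
  have heA : e ∈ atlas ℂ S := chart_mem_atlas ℂ p
  obtain ⟨W, ν, hW, hpW, hharm, hGν⟩ := hν p
  have hU : IsOpen (e.target ∩ e.symm ⁻¹' W) := e.isOpen_inter_preimage_symm hW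
  have hpU : e p ∈ e.target ∩ e.symm ⁻¹' W := by
    refine ⟨mem_chart_target ℂ p, ?_⟩
    rw [Set.mem_preimage, e.left_inv (mem_chart_source ℂ p)]
    exact hpW
  obtain ⟨R, hR, hRU⟩ := Metric.isOpen_iff.1 hU _ hpU
  set B := Metric.ball (e p) R with hB
  have hBt : B ⊆ e.target := fun w hw => (hRU hw).1
  -- On a disc a harmonic function is the real part of a holomorphic one.
  obtain ⟨F, hF, hFν⟩ := ((hharm e heA).mono hRU).exists_analyticOnNhd_ball_re_eq
  have hBo : IsOpen B := Metric.isOpen_ball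
  have hgν : ∀ w ∈ B, G (e.symm w) = ‖G (e.symm w)‖ * Complex.exp (Complex.I * (F w).re) := by
    intro w hw
    have h1 : (F w).re = ν (e.symm w) := hFν hw
    rw [h1]
    exact hGν _ (hRU hw).2
  have hY : InClassOn k B (ψ ∘ e.symm) := (hψ e heA).1.mono hBt
  have hc : IsConformalOn B (ψ ∘ e.symm) := fun w hw => (hψ e heA).2 w (hBt hw)
  have hn : ∀ w ∈ B, ‖(N ∘ e.symm) w‖ = 1 ∧ (N ∘ e.symm) w ∈ (tangentPlane (ψ ∘ e.symm) w)ᗮ :=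
    fun w hw => ⟨hN.1 _, hN.2 e heA w (hBt hw)⟩
  have hpol : ∀ w ∈ B, (N ∘ e.symm) w = polarNormal ‖G (e.symm w)‖ (F w).re := by
    intro w hw
    have h1 := hgν w hw
    have h2 := (hm (e.symm w)).1
    rw [hG] at h1 h2 ⊢
    exact eq_cylVec_of_stereoSouth (hN.1 _) h2 h1
  -- |G| < 1 places the normal in the open upper hemisphere.
  have hn2 : ∀ w ∈ B, 0 < (N ∘ e.symm) w 2 := by
    intro w hw
    rw [hpol w hw, polarNormal, cylVec_two]
    exact div_pos (one_sub_sq_pos (hm _)) (by positivity)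
  obtain ⟨hns, ε, hε, hst⟩ := structure_equation hBo (convex_ball _ _).isPreconnected hY hc hn hn2
  obtain ⟨hs, hli, hpos, -⟩ := (inClassOn_iff hc hn).1 hY
  refine ⟨R, ε, F, hR, hBt, ⟨hBo, hε, hs, ?_, fun w _ => hm _, fun w hw h1 => hpos h1 w hw, ?_, hF,
    ?_⟩, hgν⟩
  · have h1 : ContDiffOn ℝ ∞ (fun w => (N ∘ e.symm) w 2) B := contDiffOn_euclidean.1 hns 2
    -- The modulus is recovered from the smooth normal as √((1-n₃)/(1+n₃)); the radicand is positive
    -- because G ≠ 0.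
    have h2 : ContDiffOn ℝ ∞ (fun w => √((1 - (N ∘ e.symm) w 2) / (1 + (N ∘ e.symm) w 2))) B := by
      refine ContDiffOn.sqrt ((contDiffOn_const.sub h1).div (contDiffOn_const.add h1) ?_) ?_
      · intro w hw
        have := hn2 w hw
        positivity
      · intro w hw
        have h3 := hn2 w hw
        have h4 := hm (e.symm w)
        have h5 : (1 - (N ∘ e.symm) w 2) = 2 * ‖G (e.symm w)‖ ^ 2 / (1 + ‖G (e.symm w)‖ ^ 2) := by
          rw [hpol w hw, polarNormal, cylVec_two]
          field_simp
          ring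
        rw [h5]
        have := h4.1
        positivity
    refine h2.congr fun w hw => ?_
    have h4 := hm (e.symm w)
    rw [hpol w hw, polarNormal, cylVec_two]
    have h5 : (1 - (1 - ‖G (e.symm w)‖ ^ 2) / (1 + ‖G (e.symm w)‖ ^ 2)) /
        (1 + (1 - ‖G (e.symm w)‖ ^ 2) / (1 + ‖G (e.symm w)‖ ^ 2)) = ‖G (e.symm w)‖ ^ 2 := by
      field_simp
      ring
    rw [h5, Real.sqrt_sq h4.1.le]
  · intro w hw z hz
    rw [fderiv_eq_dU_dV] at hz
    have := LinearIndependent.pair_iff.1 (hli w hw) _ _ hz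
    exact Complex.ext this.1 this.2
  · intro w hw z
    have heq : (N ∘ e.symm) =ᶠ[nhds w] fun w => polarNormal ‖G (e.symm w)‖ (F w).re := by
      filter_upwards [hBo.mem_nhds hw] with x hx using hpol x hx
    rw [← heq.fderiv_eq, ← hpol w hw]
    exact hst w hw z

/-- If the argument of the Gauss map is not constant, then it has no critical points. -/
lemma IsPolarChart.deriv_ne_zero_of_not_constant [ConnectedSpace S] {k : ℝ} (hk : k ≠ 0)
    {ψ N : S → E3} {G : S → ℂ}
    (hψ : IsConformalInClass k ψ) (hN : IsUnitNormal ψ N)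
    (hG : ∀ p, G p = stereoSouth (N p)) (hm : ∀ p, 0 < ‖G p‖ ∧ ‖G p‖ < 1)
    (hν : HasHarmonicArgument G) (hν' : ¬ HasConstantArgument G) {p : S} {R ε : ℝ} {F : ℂ → ℂ}
    (hR : 0 < R) (hBt : Metric.ball (chartAt ℂ p p) R ⊆ (chartAt ℂ p).target)
    (hP : IsPolarChart k ε (Metric.ball (chartAt ℂ p p) R) (ψ ∘ (chartAt ℂ p).symm)
        (fun w => ‖G ((chartAt ℂ p).symm w)‖) F)
    (hgν : ∀ w ∈ Metric.ball (chartAt ℂ p p) R, G ((chartAt ℂ p).symm w) =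
        ‖G ((chartAt ℂ p).symm w)‖ * Complex.exp (Complex.I * (F w).re)) :
    deriv F (chartAt ℂ p p) ≠ 0 := by
  intro h0
  apply hν'
  -- The points near which the argument is constant; this set turns out to be open, closed and
  -- non-empty.
  set A : Set S := {p | ∃ c : ℝ, ∀ᶠ q in nhds p, G q = ‖G q‖ * Complex.exp (Complex.I * c)} with hA
  -- a point of the chart where the derivative vanishes identically forces constancy on the chart
  have key : ∀ {p : S} {R ε : ℝ} {F : ℂ → ℂ}, 0 < R →
      Metric.ball (chartAt ℂ p p) R ⊆ (chartAt ℂ p).target →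
      IsPolarChart k ε (Metric.ball (chartAt ℂ p p) R) (ψ ∘ (chartAt ℂ p).symm)
        (fun w => ‖G ((chartAt ℂ p).symm w)‖) F →
      (∀ w ∈ Metric.ball (chartAt ℂ p p) R, G ((chartAt ℂ p).symm w) =
        ‖G ((chartAt ℂ p).symm w)‖ * Complex.exp (Complex.I * (F w).re)) →
      ∀ w ∈ Metric.ball (chartAt ℂ p p) R, (∀ᶠ x in nhds w, deriv F x = 0) → p ∈ A := by
    intro p R ε F hR hBt hP hgν w hw hz
    have h1 : Set.EqOn (deriv F) 0 (Metric.ball (chartAt ℂ p p) R) :=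
      hP.analytic.deriv.eqOn_zero_of_preconnected_of_eventuallyEq_zero
        (convex_ball _ _).isPreconnected hw hz
    have hpB : chartAt ℂ p p ∈ Metric.ball (chartAt ℂ p p) R := Metric.mem_ball_self hR
    have h2 : ∀ x ∈ Metric.ball (chartAt ℂ p p) R, F x = F (chartAt ℂ p p) := fun x hx =>
      Metric.isOpen_ball.is_const_of_deriv_eq_zero (convex_ball _ _).isPreconnected
        hP.analytic.differentiableOn h1 hx hpB
    refine ⟨(F (chartAt ℂ p p)).re, ?_⟩
    have hcont := (chartAt ℂ p).continuousAt (mem_chart_source ℂ p)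
    filter_upwards [hcont.preimage_mem_nhds (Metric.ball_mem_nhds _ hR),
      (chartAt ℂ p).open_source.mem_nhds (mem_chart_source ℂ p)] with q hq hqs
    have := hgν _ hq
    rwa [(chartAt ℂ p).left_inv hqs, h2 _ hq] at this
  have hpA : p ∈ A := by
    have hpB : chartAt ℂ p p ∈ Metric.ball (chartAt ℂ p p) R := Metric.mem_ball_self hR
    rcases hP.eventually_eq_zero_or_ne_zero hk hpB with h | h
    · exact key hR hBt hP hgν _ hpB h
    · exact absurd h0 h
  have hAo : IsOpen A := by
    rw [isOpen_iff_eventually]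
    rintro q ⟨c, hc⟩
    filter_upwards [hc.eventually_nhds] with x hx using ⟨c, hx⟩
  -- The disc around a limit point meets A, so F' vanishes near some point of it, and the identity
  -- theorem applies.
  have hAc : IsClosed A := by
    rw [← closure_subset_iff_isClosed]
    intro q hq
    obtain ⟨R, ε, F, hR, hBt, hP, hgν⟩ := exists_isPolarChart hψ hN hG hm hν q
    have hnb : (chartAt ℂ q).source ∩ chartAt ℂ q ⁻¹' Metric.ball (chartAt ℂ q q) R ∈ nhds q :=
      Filter.inter_mem ((chartAt ℂ q).open_source.mem_nhds (mem_chart_source ℂ q))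
        (((chartAt ℂ q).continuousAt (mem_chart_source ℂ q)).preimage_mem_nhds
          (Metric.ball_mem_nhds _ hR))
    obtain ⟨x, ⟨hxs, hxB⟩, c, hc⟩ := mem_closure_iff_nhds.1 hq _ hnb
    refine key hR hBt hP hgν (chartAt ℂ q x) hxB ?_
    have hcont : Filter.Tendsto (chartAt ℂ q).symm (nhds (chartAt ℂ q x)) (nhds x) := by
      have := (chartAt ℂ q).continuousAt_symm ((chartAt ℂ q).map_source hxs)
      rwa [ContinuousAt, (chartAt ℂ q).left_inv hxs] at this
    have hev : ∀ᶠ y in nhds (chartAt ℂ q x),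
        Complex.exp (Complex.I * (F y).re) = Complex.exp (Complex.I * c) := by
      filter_upwards [hcont.eventually hc, Metric.isOpen_ball.mem_nhds hxB] with y hy hyB
      have h1 := hgν y hyB
      rw [hy] at h1
      have h2 : (‖G ((chartAt ℂ q).symm y)‖ : ℂ) ≠ 0 := Complex.ofReal_ne_zero.2 (hm _).1.ne'
      simp only [norm_mul, Complex.norm_real, norm_norm, mul_comm Complex.I,
        Complex.norm_exp_ofReal_mul_I, mul_one] at h1
      rw [mul_comm Complex.I, mul_comm Complex.I]
      exact (mul_left_cancel₀ h2 h1).symm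
    filter_upwards [hev.eventually_nhds, Metric.isOpen_ball.mem_nhds hxB] with y hy hyB
    obtain ⟨L, hL, hL'⟩ := hP.hasFDerivAt_re hyB
    have h1 : HasFDerivAt (fun y => Complex.exp (Complex.I * ((F y).re : ℂ))) _ y :=
      ((Complex.ofRealCLM.hasFDerivAt.comp y hL).const_mul Complex.I).cexp
    have h2 := h1.unique ((hasFDerivAt_const (Complex.exp (Complex.I * c)) y).congr_of_eventuallyEq
      hy)
    have h3 : ∀ z, (deriv F y * z).re = 0 := by
      intro z
      have h4 := congrArg (fun L : ℂ →L[ℝ] ℂ => L z) h2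
      have h5 : ((L z : ℝ) : ℂ) = 0 := by simpa [Complex.exp_ne_zero] using h4
      rw [← hL' z]
      exact_mod_cast h5
    have h4 := h3 1
    have h5 := h3 Complex.I
    simp at h4 h5
    exact Complex.ext h4 h5
  have huniv : A = Set.univ := IsClopen.eq_univ ⟨hAc, hAo⟩ ⟨p, hpA⟩
  -- The local constants c are unique only modulo 2π, so the phase G/|G| is used instead.
  have hloc : IsLocallyConstant fun q => G q / ‖G q‖ := by
    rw [IsLocallyConstant.iff_eventually_eq]
    intro q
    obtain ⟨c, hc⟩ : q ∈ A := huniv ▸ Set.mem_univ q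
    have h1 : ∀ x, G x = ‖G x‖ * Complex.exp (Complex.I * c) →
        G x / ‖G x‖ = Complex.exp (Complex.I * c) := by
      intro x hx
      rw [div_eq_iff (Complex.ofReal_ne_zero.2 (hm x).1.ne'), mul_comm]
      exact hx
    filter_upwards [hc] with x hx
    rw [h1 x hx, h1 q hc.self_of_nhds]
  obtain ⟨c, hc⟩ : p ∈ A := hpA
  refine ⟨c, fun q => ?_⟩
  have h1 := hloc.apply_eq_of_preconnectedSpace q p
  have h2 := hc.self_of_nhds
  have hp0 : (‖G p‖ : ℂ) ≠ 0 := Complex.ofReal_ne_zero.2 (hm p).1.ne'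
  have hq0 : (‖G q‖ : ℂ) ≠ 0 := Complex.ofReal_ne_zero.2 (hm q).1.ne'
  have h3 : G p / ‖G p‖ = Complex.exp (Complex.I * c) := by
    rw [div_eq_iff hp0, mul_comm]; exact h2
  rw [h3, div_eq_iff hq0, mul_comm] at h1
  exact h1

/-! ### Conformal parameters -/

lemma differentiableOn_chart_comp [IsManifold 𝓘(ℂ) ω S] {e e' : OpenPartialHomeomorph S ℂ}
    (he : e ∈ atlas ℂ S) (he' : e' ∈ atlas ℂ S) :
    DifferentiableOn ℂ (e ∘ e'.symm) (e'.target ∩ e'.symm ⁻¹' e.source) := by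
  have h := HasGroupoid.compatible (G := contDiffGroupoid ω 𝓘(ℂ)) he' he
  have h1 := contMDiffOn_of_mem_contDiffGroupoid h
  rw [contMDiffOn_iff_contDiffOn] at h1
  have h2 := h1.differentiableOn (by simp)
  rwa [OpenPartialHomeomorph.trans_source, OpenPartialHomeomorph.symm_source] at h2

lemma paramMap_neg_one (x : ℂ) : paramMap (-1) x = Complex.I * x := by
  apply Complex.ext <;> simp

lemma conj_paramMap_one (x : ℂ) : starRingEnd ℂ (paramMap 1 x) = -(Complex.I * x) := by
  apply Complex.ext <;> simp

/-- The parameter is iF for ε = -1 and i times the conjugate of F for ε = 1, hence holomorphic or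
antiholomorphic. -/
lemma isConformalParameterOn_paramMap [IsManifold 𝓘(ℂ) ω S] {e : OpenPartialHomeomorph S ℂ}
    (he : e ∈ atlas ℂ S) {ε : ℝ} (hε : ε = 1 ∨ ε = -1) {F : ℂ → ℂ} {W : Set ℂ}
    (hF : DifferentiableOn ℂ F W) (hinj : Set.InjOn (fun w => paramMap ε (F w)) W) :
    IsConformalParameterOn (fun q => paramMap ε (F (e q))) (e.source ∩ e ⁻¹' W) := by
  refine ⟨fun x hx y hy hxy => e.injOn hx.1 hy.1 (hinj hx.2 hy.2 hxy), ?_⟩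
  have hFe : ∀ e' ∈ atlas ℂ S, DifferentiableOn ℂ (fun w => F (e (e'.symm w)))
      (e'.target ∩ e'.symm ⁻¹' (e.source ∩ e ⁻¹' W)) := by
    intro e' he'
    exact hF.comp ((differentiableOn_chart_comp he he').mono fun w hw => ⟨hw.1, hw.2.1⟩)
      fun w hw => hw.2.2
  rcases hε with rfl | rfl
  · refine Or.inr fun e' he' => ?_
    simp only [conj_paramMap_one]
    exact ((hFe e' he').const_mul _).neg
  · refine Or.inl fun e' he' => ?_
    have : ((fun q => paramMap (-1) (F (e q))) ∘ e'.symm) =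
        fun w => Complex.I * F (e (e'.symm w)) := by
      funext w; exact paramMap_neg_one _
    rw [this]
    exact (hFe e' he').const_mul _

lemma IsConformalParameterOn.add_const {ζ : S → ℂ} {W : Set S} (h : IsConformalParameterOn ζ W)
    (c : ℂ) : IsConformalParameterOn (fun q => ζ q + c) W := by
  refine ⟨fun x hx y hy hxy => h.1 hx hy (add_right_cancel hxy), h.2.imp ?_ ?_⟩
  · exact fun h e he => (h e he).add_const c
  · intro h e he
    simp only [map_add]
    exact (h e he).add_const _

lemma IsConformalParameterOn.differentiableAt {ζ : S → ℂ} {W : Set S}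
    (h : IsConformalParameterOn ζ W) (hW : IsOpen W) {e : OpenPartialHomeomorph S ℂ}
    (he : e ∈ atlas ℂ S) {q : S} (hq : q ∈ W) (hqe : q ∈ e.source) :
    DifferentiableAt ℝ (ζ ∘ e.symm) (e q) := by
  have hn : e.target ∩ e.symm ⁻¹' W ∈ nhds (e q) := by
    refine (e.isOpen_inter_preimage_symm hW).mem_nhds ⟨e.map_source hqe, ?_⟩
    rw [Set.mem_preimage, e.left_inv hqe]
    exact hq
  rcases h.2 with h | h
  · exact ((h e he).differentiableAt hn).restrictScalars ℝ
  · have h1 := ((h e he).differentiableAt hn).restrictScalars ℝ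
    have h2 := Complex.conjCLE.differentiableAt.comp (e q) h1
    refine h2.congr_of_eventuallyEq (Filter.Eventually.of_forall fun w => ?_)
    simp

/-! ### Local and global representation -/

/-- Near `p`, the surface `ψ` with Gauss map `G` is parametrised by `X`, with a conformal parameter
`u + iν` with values in the strip over `J` such that `G = m(u) e^{iν}`. -/
def IsParametrizedNear (ψ : S → E3) (G : S → ℂ) (X : ℂ → E3) (J : Set ℝ) (m : ℝ → ℝ) (p : S) :
    Prop :=
  ∃ (W : Set S) (ζ : S → ℂ), IsOpen W ∧ p ∈ W ∧ IsConformalParameterOn ζ W ∧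
    ∀ q ∈ W, ζ q ∈ strip J ∧ G q = m (ζ q).re * Complex.exp (Complex.I * (ζ q).im) ∧ ψ q = X (ζ q)

/-- A surface with non-constant harmonic argument is locally a surface of revolution. -/
lemma exists_local_representation [ConnectedSpace S] [IsManifold 𝓘(ℂ) ω S]
    {k : ℝ} (hk : k ≠ 0) {ψ N : S → E3} {G : S → ℂ}
    (hψ : IsConformalInClass k ψ) (hN : IsUnitNormal ψ N)
    (hG : ∀ p, G p = stereoSouth (N p)) (hm : ∀ p, 0 < ‖G p‖ ∧ ‖G p‖ < 1)
    (hν : HasHarmonicArgument G) (hν' : ¬ HasConstantArgument G) (p : S) :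
    ∃ (a b : ℝ) (J : Set ℝ) (M Φ Q : ℝ → ℝ) (σ : ℝ) (W : Set S) (ζ : S → ℂ),
      (σ = 1 ∨ σ = -1) ∧
      IsSolutionOn (modulusField k σ) modulusDomain J (fun u => (M u, Φ u, Q u)) ∧
      IsOpen W ∧ p ∈ W ∧ W ⊆ (chartAt ℂ p).source ∧ IsConformalParameterOn ζ W ∧
      (∀ q ∈ W, ∃ z, (fderiv ℝ (ζ ∘ (chartAt ℂ p).symm) (chartAt ℂ p q) z).re ≠ 0) ∧
      ∀ q ∈ W, ζ q ∈ strip J ∧ G q = M (ζ q).re * Complex.exp (Complex.I * (ζ q).im) ∧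
        ψ q = revolution a b (profileRadius k M Q) (profileHeight k M Q) (ζ q) := by
  obtain ⟨R, ε, F, hR, hBt, hP, hgν⟩ := exists_isPolarChart hψ hN hG hm hν p
  have h0 := hP.deriv_ne_zero_of_not_constant hk hψ hN hG hm hν hν' hR hBt hgν
  obtain ⟨W, a, b, J, M, Φ, Q, σ, hWo, hpW, hWB, hWne, hinj, hσ, hsol, hrep⟩ :=
    hP.exists_local_representation hk (Metric.mem_ball_self hR) h0
  set e := chartAt ℂ p with he
  have heA : e ∈ atlas ℂ S := chart_mem_atlas ℂ p
  refine ⟨a, b, J, M, Φ, Q, σ, e.source ∩ e ⁻¹' W, fun q => paramMap ε (F (e q)), hσ, hsol,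
    e.isOpen_inter_preimage hWo, ⟨mem_chart_source ℂ p, hpW⟩, Set.inter_subset_left,
    isConformalParameterOn_paramMap heA hP.eps (hP.analytic.differentiableOn.mono hWB) hinj,
    fun q hq => ?_, fun q hq => ?_⟩
  · have heq : ((fun q => paramMap ε (F (e q))) ∘ e.symm) =ᶠ[nhds (e q)]
        fun w => paramMap ε (F w) := by
      filter_upwards [e.open_target.mem_nhds (e.map_source hq.1)] with w hw
      simp only [Function.comp, e.right_inv hw]
    have hF0 := hWne _ hq.2
    have hε0 : ε ≠ 0 := by rcases hP.eps with h | h <;> rw [h] <;> norm_num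
    -- In this direction dF = i, so du = ε ≠ 0.
    refine ⟨(deriv F (e q))⁻¹ * Complex.I, ?_⟩
    rw [heq.fderiv_eq, hP.fderiv_param (hWB hq.2), mul_inv_cancel_left₀ hF0, paramMap_re]
    simpa using hε0
  · obtain ⟨h1, h2, h3⟩ := hrep _ hq.2
    refine ⟨h1, ?_, ?_⟩
    · have h4 := hgν _ (hWB hq.2)
      rw [← h2, paramMap_im, e.left_inv hq.1]
      rwa [e.left_inv hq.1] at h4
    · rw [← h3, Function.comp, e.left_inv hq.1]

end WeightedSurface

end

/-! ### Continuation of the local representation over the whole surface -/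

open WeightedSurface in
theorem mainTheorem5 {S : Type*} [TopologicalSpace S] [T2Space S] [ConnectedSpace S]
    [ChartedSpace ℂ S] [IsManifold 𝓘(ℂ) ω S]
    (k : ℝ) (hk : k ≠ 0) (ψ N : S → E3) (G : S → ℂ)
    (hψ : WeightedSurface.IsConformalInClass k ψ)
    (hN : WeightedSurface.IsUnitNormal ψ N)
    (hG : ∀ p, G p = WeightedSurface.stereoSouth (N p))
    (hm : ∀ p, 0 < ‖G p‖ ∧ ‖G p‖ < 1)
    (hν : WeightedSurface.HasHarmonicArgument G)
    (hν' : ¬ WeightedSurface.HasConstantArgument G) :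
    ∃ (a b : ℝ) (J : Set ℝ) (m Φ Q : ℝ → ℝ) (σ : ℝ) (X : ℂ → E3),
      IsOpen J ∧ J.OrdConnected ∧ J.Nonempty ∧
      -- the modulus `m` solves the ordinary differential equation
      (σ = 1 ∨ σ = -1) ∧ WeightedSurface.SolvesModulusODE k σ J m Φ ∧
      (∀ u ∈ J, HasDerivAt Q (m u ^ 2 / (1 - m u ^ 4)) u) ∧
      -- the explicit surface of revolution about a vertical axis
      X = WeightedSurface.revolution a b (WeightedSurface.profileRadius k m Q)
        (WeightedSurface.profileHeight k m Q) ∧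
      WeightedSurface.IsConformalOn (WeightedSurface.strip J) X ∧
      (k = 1 → WeightedSurface.IsTranslatingSolitonOn (WeightedSurface.strip J) X) ∧
      (k ≠ 1 → WeightedSurface.IsSingularMinimalOn (2 / (k - 1)) (WeightedSurface.strip J) X) ∧
      -- the given surface lies on it
      Set.range ψ ⊆ X '' WeightedSurface.strip J ∧
      -- and is locally parametrised by it, with conformal parameter `ζ = u + i ν`
      (∀ p : S, ∃ (W : Set S) (ζ : S → ℂ), IsOpen W ∧ p ∈ W ∧
        WeightedSurface.IsConformalParameterOn ζ W ∧
        ∀ q ∈ W, ζ q ∈ WeightedSurface.strip J ∧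
          G q = m (ζ q).re * Complex.exp (Complex.I * (ζ q).im) ∧ ψ q = X (ζ q)) := by
  obtain ⟨p₀⟩ : Nonempty S := inferInstance
  obtain ⟨a, b, J₀, m₀, Φ₀, Q₀, σ, W₀, ζ₀, hσ, hsol₀, hW₀, hp₀, -, hζ₀, -, hrep₀⟩ :=
    exists_local_representation hk hψ hN hG hm hν hν' p₀
  -- The integral curve near one point is extended maximally, so that it contains, up to
  -- translation, every local curve met later.
  obtain ⟨J, γ, hsol, hJne, hγ, hmax⟩ := hsol₀.exists_maximal isOpen_modulusDomain
    ((contDiffOn_modulusField k σ).of_le (by simp)) (hrep₀ p₀ hp₀).1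
  set m : ℝ → ℝ := fun u => (γ u).1 with hmdef
  set Φ : ℝ → ℝ := fun u => (γ u).2.1 with hΦdef
  set Q : ℝ → ℝ := fun u => (γ u).2.2 with hQdef
  have hsolm : IsSolutionOn (modulusField k σ) modulusDomain J (fun u => (m u, Φ u, Q u)) := hsol
  obtain ⟨hJo, hJc, hode, hQ⟩ := isSolutionOn_iff.1 hsolm
  set X := revolution a b (profileRadius k m Q) (profileHeight k m Q) with hX
  -- a local representation by a translate of the maximal solution
  have transfer : ∀ {J' : Set ℝ} {M' Φ' Q' : ℝ → ℝ} {W : Set S} {ζ : S → ℂ} {p : S} {c : ℝ},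
      IsSolutionOn (modulusField k σ) modulusDomain J' (fun u => (M' u, Φ' u, Q' u)) →
      IsOpen W → p ∈ W → IsConformalParameterOn ζ W →
      (∀ q ∈ W, ζ q ∈ strip J' ∧ G q = M' (ζ q).re * Complex.exp (Complex.I * (ζ q).im) ∧
        ψ q = revolution a b (profileRadius k M' Q') (profileHeight k M' Q') (ζ q)) →
      (∀ u ∈ J', u + c ∈ J ∧ γ (u + c) = (M' u, Φ' u, Q' u)) →
      IsParametrizedNear ψ G X J m p := by
    intro J' M' Φ' Q' W ζ p c hsol' hW hp hζ hrep hsub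
    refine ⟨W, fun q => ζ q + (c : ℂ), hW, hp, hζ.add_const _, fun q hq => ?_⟩
    obtain ⟨h1, h2, h3⟩ := hrep q hq
    obtain ⟨h4, h5⟩ := hsub _ h1
    have hre : (ζ q + (c : ℂ)).re = (ζ q).re + c := by simp
    have him : (ζ q + (c : ℂ)).im = (ζ q).im := by simp
    have hmem : ζ q + (c : ℂ) ∈ strip J := by
      change (ζ q + (c : ℂ)).re ∈ J
      rwa [hre]
    have hm5 : m (ζ q + (c : ℂ)).re = M' (ζ q).re := by
      rw [hre]; exact congrArg (fun x => x.1) h5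
    have hΦ5 : Φ (ζ q + (c : ℂ)).re = Φ' (ζ q).re := by
      rw [hre]; exact congrArg (fun x => x.2.1) h5
    have hQ5 : Q (ζ q + (c : ℂ)).re = Q' (ζ q).re := by
      rw [hre]; exact congrArg (fun x => x.2.2) h5
    refine ⟨hmem, ?_, ?_⟩
    · rw [hm5, him]; exact h2
    · rw [h3]; exact (revolution_add_eq hsolm hsol' hmem h1 him hm5 hΦ5 hQ5).symm
  set A : Set S := {p | IsParametrizedNear ψ G X J m p} with hA
  have hpA : p₀ ∈ A := by
    have h1 := hmax J₀ _ hsol₀ _ hJne (hrep₀ p₀ hp₀).1 hγ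
    refine transfer (c := 0) hsol₀ hW₀ hp₀ hζ₀ hrep₀ fun u hu => ?_
    rw [add_zero]
    exact ⟨h1.1 hu, h1.2 hu⟩
  have hAo : IsOpen A := by
    rw [isOpen_iff_mem_nhds]
    rintro p ⟨W, ζ, hW, hp, h⟩
    filter_upwards [hW.mem_nhds hp] with q hq using ⟨W, ζ, hW, hq, h⟩
  -- Near a limit point there is a local representation; at a point common to both domains it is
  -- compared with the maximal one.
  have hAc : IsClosed A := by
    rw [← closure_subset_iff_isClosed]
    intro p hp
    obtain ⟨a', b', J', M', Φ', Q', σ', W', ζ', hσ', hsol', hW', hp', hWs, hζ', hne', hrep'⟩ :=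
      exists_local_representation hk hψ hN hG hm hν hν' p
    obtain ⟨q, hqW', W, ζ, hW, hqW, hζ, hrep⟩ := mem_closure_iff_nhds.1 hp _ (hW'.mem_nhds hp')
    set e := chartAt ℂ p with he
    have heA : e ∈ atlas ℂ S := chart_mem_atlas ℂ p
    have hqe := hWs hqW'
    have hev : ∀ᶠ y in nhds (e q), e.symm y ∈ W ∩ W' := by
      have h1 := e.continuousAt_symm (e.map_source hqe)
      refine h1.preimage_mem_nhds ?_
      rw [e.left_inv hqe]
      exact (hW.inter hW').mem_nhds ⟨hqW, hqW'⟩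
    have hcmp := representation_unique hk (ζ₁ := ζ ∘ e.symm) (ζ₂ := ζ' ∘ e.symm) (x := e q)
      (a₁ := a) (b₁ := b) (a₂ := a') (b₂ := b') hsolm hsol' hσ hσ'
      (hζ.differentiableAt hW heA hqW hqe) (hζ'.differentiableAt hW' heA hqW' hqe) (hne' q hqW')
      (hev.mono fun y hy => (hrep _ hy.1).1) (hev.mono fun y hy => (hrep' _ hy.2).1)
      (hev.mono fun y hy => (hrep _ hy.1).2.1.symm.trans (hrep' _ hy.2).2.1)
      (hev.mono fun y hy => (hrep _ hy.1).2.2.symm.trans (hrep' _ hy.2).2.2)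
    simp only [Function.comp, e.left_inv hqe] at hcmp
    obtain ⟨rfl, rfl, rfl, hcm, hcΦ, hcQ⟩ := hcmp
    -- After translation by c the two integral curves agree at one parameter, so maximality contains
    -- the local one.
    set c := (ζ q).re - (ζ' q).re with hc
    have hshift := hsol'.comp_sub_const c
    have hcq : (ζ q).re - c = (ζ' q).re := by rw [hc]; ring
    have h1 := hmax _ _ hshift (ζ q).re (hrep q hqW).1
      (by
        change (ζ q).re - c ∈ J'
        rw [hcq]; exact (hrep' q hqW').1)
      (by
        simp only [hcq]
        exact Prod.ext hcm (Prod.ext hcΦ hcQ))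
    refine transfer (c := c) hsol' hW' hp' hζ' hrep' fun u hu => ?_
    have hu' : u + c ∈ {u | u - c ∈ J'} := by
      change u + c - c ∈ J'
      rwa [add_sub_cancel_right]
    have h2 := h1.2 hu'
    simp only [add_sub_cancel_right] at h2
    exact ⟨h1.1 hu', h2⟩
  have huniv : A = Set.univ := IsClopen.eq_univ ⟨hAc, hAo⟩ ⟨p₀, hpA⟩
  have hall : ∀ p, IsParametrizedNear ψ G X J m p := fun p => by
    have : p ∈ A := huniv ▸ Set.mem_univ p
    exact this
  have hclass := hode.inClassOn_revolution (a := a) (b := b) hJo hQ hk hσ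
  refine ⟨a, b, J, m, Φ, Q, σ, X, hJo, hJc, ⟨_, hJne⟩, hσ, hode, hQ, rfl,
    hode.isConformalOn_revolution hJo hQ, hclass.1, hclass.2, ?_, hall⟩
  rintro _ ⟨p, rfl⟩
  obtain ⟨W, ζ, -, hp, -, h⟩ := hall p
  exact ⟨ζ p, (h p hp).1, (h p hp).2.2.symm⟩
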